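/- \textbf{Setting.} Let $F:\mathbb R^n\to\mathbb R$ be twice differentiable, bounded below and coercive (all sublevel sets $\{F\le r\}$ are bounded), with $F^*=\inf F$, and with $L_H$-Lipschitz Hessian: $\|\nabla^2F(x)-\nabla^2F(y)\|\le L_H\|x-y\|$ for all $x,y$ (operator norm). Let $F$ be gradient-dominated with exponent $\alpha\in[1,2]$: $F(x)-F^*\le C_{\rm gd}\|\nabla F(x)\|^\alpha$ for all $x\in\mathbb R^n$, where $C_{\rm gd}>0$. For $\xi\sim\mathcal D$ let $\nabla F(x,\xi)$ and (symmetric) $\nabla^2F(x,\xi)$ be unbiased estimators of $\nabla F(x)$ and $\nabla^2F(x)$, measurable in $(x,\xi)$, with $\mathbb E\|\nabla F(x)-\nabla F(x,\xi)\|^2\le\sigma_g^2$ and $\mathbb E\|\nabla^2F(x)-\nabla^2F(x,\xi)\|^{2\alpha}\le\sigma_h^2$ for all $x$. \textbf{Algorithm (SHSODM).} Inputs: $x_0\in\mathbb R^n$, batch sizes $n_g,n_H$, tolerances $\epsilon_{\rm eig},\epsilon_{\rm ls}>0$, ratio $C_e=(L_H+4)/3$. In iteration $k=0,\dots,K-1$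 draw $n_g+n_H$ i.i.d. samples from $\mathcal D$, independent of the past; let $\hat g$ and $\hat H$ be the averages of $n_g$ stochastic gradients and of $n_H$ stochastic Hessians at $x_k$; set $x_{k+1}=x_k+d_k$, where $d_k$ is computed as follows. \begin{itemize} \item \emph{Perturbation.} Let $p$ be the orthogonal projection of $\hat g$ to the eigenspace $S$ of the smallest eigenvalue of $\hat H$. If $\|p\|\ge\epsilon_{\rm eig}$ put $g'=\hat g$; otherwise put $g'=\hat g+\epsilon_{\rm eig}u$ with $u=p/\|p\|$ (any unit vector $u\in S$ if $p=0$). \item \emph{Line search.} For $\delta\in\mathbb R$ let $(\mu(\delta),[v;t])$ be a leftmost eigenpair of $\begin{bmatrix}\hat H&g'\\ g'^T&\delta\end{bmatrix}$, and $d(\delta)=v/t$. Start from an interval $[\delta_l,\delta_r]$ containing a point where $C_e\|d(\delta)\|=-\mu(\delta)$. Repeat: let $\delta_m=(\delta_l+\delta_r)/2$; if $C_e\|d(\delta_m)\|\le-\mu(\delta_m)$ set $\delta_l\leftarrow\delta_m$, else $\delta_r\leftarrow\delta_m$; if now $|\delta_r-\delta_l|<\epsilon_{\rm ls}$, return $d_k=d(\delta_m)$.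 \end{itemize} \textbf{Theorem.} For every $n,\alpha,C_{\rm gd},L_H,\sigma_g,\sigma_h$ and $\Delta_0\ge0$ there are constants $c_g,c_H,c_{\rm eig},c_{\rm ls},C>0$ and $\epsilon_0\in(0,1)$, depending only on these numbers, such that for every $\epsilon\in(0,\epsilon_0)$, with $$n_g=\lceil c_g\epsilon^{-2/\alpha}\rceil,\quad n_H=\lceil c_H\epsilon^{-1/\alpha}\rceil,\quad \epsilon_{\rm eig}=c_{\rm eig}\epsilon^{1/\alpha},\quad \epsilon_{\rm ls}=c_{\rm ls}\epsilon^{1/\alpha},$$ there is a number $K$ of iterations, depending only on $\epsilon$ and the numbers above, satisfying \begin{itemize} \item $K\le C\epsilon^{1-3/(2\alpha)}$ and $K(n_g+n_H)\le C\epsilon^{-7/(2\alpha)+1}$ if $\alpha\in[1,3/2)$; \item $K\le C\log(1/\epsilon)$ and $K(n_g+n_H)\le C\log(1/\epsilon)\,\epsilon^{-2/\alpha}$ if $\alpha=3/2$; \item $K\le C\log\log(1/\epsilon)$ and $K(n_g+n_H)\le C\log\log(1/\epsilon)\,\epsilon^{-2/\alpha}$ if $\alpha\in(3/2,2]$, \end{itemize}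 such that for all $F$, $x_0$ and oracles as above with $F(x_0)-F^*\le\Delta_0$, every run of SHSODM has $F(x_K)$ integrable and $\mathbb E[F(x_K)-F^*]\le\epsilon$. Here $K(n_g+n_H)$ is the total number of samples drawn. -/

import Mathlib

open MeasureTheory ProbabilityTheory
open scoped RealInnerProductSpace

namespace SHSODM

/-- The space `ℝⁿ` with its Euclidean norm. -/
abbrev Vec (n : ℕ) : Type := EuclideanSpace ℝ (Fin n)

/-- Operators on `ℝⁿ` (Hessians), with the operator norm. -/
abbrev Op (n : ℕ) : Type := Vec n →L[ℝ] Vec n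

/-! ### The objective function -/

/-- The infimum `F* = inf F`. -/
noncomputable def infVal {n : ℕ} (F : Vec n → ℝ) : ℝ := ⨅ x, F x

/-- The Hessian `∇²F(x)`, the derivative of the gradient at `x`. -/
noncomputable def hess {n : ℕ} (F : Vec n → ℝ) (x : Vec n) : Op n :=
  fderiv ℝ (gradient F) x

/-- (Strong) gradient dominance with exponent `α` and constant `C`. -/
def GradientDominated {n : ℕ} (F : Vec n → ℝ) (α C : ℝ) : Prop :=
  ∀ x, F x - infVal F ≤ C * ‖gradient F x‖ ^ α

/-- `F` is bounded below and coercive, i.e. all its sublevel sets are bounded. -/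
structure CoerciveBddBelow {n : ℕ} (F : Vec n → ℝ) : Prop where
  bddBelow : BddBelow (Set.range F)
  coercive : ∀ r : ℝ, Bornology.IsBounded {x | F x ≤ r}

/-- `F` is twice differentiable and its Hessian is Lipschitz with constant `L`. -/
structure LipschitzHessian {n : ℕ} (F : Vec n → ℝ) (L : ℝ) : Prop where
  differentiable : Differentiable ℝ F
  differentiable_gradient : Differentiable ℝ (gradient F)
  lipschitz : ∀ x y, ‖hess F x - hess F y‖ ≤ L * ‖x - y‖

/-- Unbiased stochastic gradients `G x ξ` and stochastic Hessians `Q x ξ` of `F`, where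
`ξ` has law `D`, with `E‖∇F(x) - G x ξ‖² ≤ σg²` and `E‖∇²F(x) - Q x ξ‖^(2α) ≤ σh²`. -/
structure UnbiasedOracle {n : ℕ} {Ξ : Type*} [MeasurableSpace Ξ] (F : Vec n → ℝ)
    (α σg σh : ℝ) (D : Measure Ξ) (G : Vec n → Ξ → Vec n) (Q : Vec n → Ξ → Op n) : Prop where
  measurable_grad : Measurable (Function.uncurry G)
  measurable_hess : Measurable (Function.uncurry Q)
  symmetric_hess : ∀ x ξ, IsSelfAdjoint (Q x ξ)
  integrable_grad : ∀ x, Integrable (G x) D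
  unbiased_grad : ∀ x, ∫ ξ, G x ξ ∂D = gradient F x
  integrable_hess : ∀ x, Integrable (Q x) D
  unbiased_hess : ∀ x, ∫ ξ, Q x ξ ∂D = hess F x
  integrable_var_grad : ∀ x, Integrable (fun ξ => ‖gradient F x - G x ξ‖ ^ 2) D
  var_grad : ∀ x, ∫ ξ, ‖gradient F x - G x ξ‖ ^ 2 ∂D ≤ σg ^ 2
  integrable_var_hess : ∀ x, Integrable (fun ξ => ‖hess F x - Q x ξ‖ ^ (2 * α)) D
  var_hess : ∀ x, ∫ ξ, ‖hess F x - Q x ξ‖ ^ (2 * α) ∂D ≤ σh ^ 2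

/-! ### The homogenized eigenvalue problem -/

/-- `μ` is the leftmost (smallest) eigenvalue of the endomorphism `T`. -/
def IsLeftmostEigenvalue {V : Type*} [AddCommGroup V] [Module ℝ V] (T : Module.End ℝ V)
    (μ : ℝ) : Prop :=
  T.HasEigenvalue μ ∧ ∀ ν : ℝ, T.HasEigenvalue ν → μ ≤ ν

/-- The augmented matrix `[H, g; gᵀ, δ]`, acting on column vectors `[v; t]`. -/
noncomputable def augmented {n : ℕ} (H : Op n) (g : Vec n) (δ : ℝ) :
    Module.End ℝ (Vec n × ℝ) where
  toFun z := (H z.1 + z.2 • g, ⟪g, z.1⟫ + δ * z.2)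
  map_add' z w := by
    ext1
    · simp [add_smul]; abel
    · simp [inner_add_right]; ring
  map_smul' c z := by
    ext1
    · simp [smul_smul]
    · simp [inner_smul_right]; ring

/-- `(μ, [v; t])` is a leftmost eigenpair of `[H, g; gᵀ, δ]`. -/
def IsLeftmostEigenpair {n : ℕ} (H : Op n) (g : Vec n) (δ μ : ℝ) (v : Vec n) (t : ℝ) : Prop :=
  IsLeftmostEigenvalue (augmented H g δ) μ ∧ (augmented H g δ).HasEigenvector μ (v, t)

/-! ### The perturbation strategy -/

/-- `g'` is an output of the perturbation strategy for `(g, H)` with tolerance `ε`. With `p` the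
orthogonal projection of `g` to the eigenspace `S` of the smallest eigenvalue of `H`, it is
`g` if `ε ≤ ‖p‖`, and otherwise `g + ε u` with the unit vector `u = p / ‖p‖`; when `p = 0`, `u`
is allowed to be any unit vector of `S`. -/
def IsPerturbed {n : ℕ} (H : Op n) (g : Vec n) (ε : ℝ) (g' : Vec n) : Prop :=
  ∃ μ : ℝ, IsLeftmostEigenvalue (H : Module.End ℝ (Vec n)) μ ∧
    ∃ S : Submodule ℝ (Vec n), S = Module.End.eigenspace (H : Module.End ℝ (Vec n)) μ ∧
    ∃ p : Vec n, p = S.starProjection g ∧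
      ((ε ≤ ‖p‖ ∧ g' = g) ∨
        (‖p‖ < ε ∧ ∃ u ∈ S, ‖u‖ = 1 ∧ ‖p‖ • u = p ∧ g' = g + ε • u))

/-! ### The line search -/

/-- One pass of the loop of the line search from the interval `[l, r]`: at the midpoint `m`
a leftmost eigenpair `(μ, [v; t])` of `[H, g; gᵀ, m]` is computed, giving the direction
`d = v / t`. If `Ce ‖d‖ ≤ -μ` then `l` is replaced by `m`, otherwise `r` is. -/
def BisectionStep {n : ℕ} (H : Op n) (g : Vec n) (Ce l r l' r' : ℝ) (d : Vec n) : Prop :=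
  ∃ (m μ t : ℝ) (v : Vec n), m = (l + r) / 2 ∧ IsLeftmostEigenpair H g m μ v t ∧
    d = t⁻¹ • v ∧
    ((Ce * ‖d‖ ≤ -μ ∧ l' = m ∧ r' = r) ∨ (-μ < Ce * ‖d‖ ∧ l' = l ∧ r' = m))

/-- `Bisection H g Ce tol l r d`: the bisection started from `[l, r]` returns `d`. It stops as
soon as, after a pass, the interval is shorter than `tol`, with the direction of that pass. -/
inductive Bisection {n : ℕ} (H : Op n) (g : Vec n) (Ce tol : ℝ) : ℝ → ℝ → Vec n → Prop
  | last {l r l' r' : ℝ} {d : Vec n} (step : BisectionStep H g Ce l r l' r' d)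
      (short : |r' - l'| < tol) : Bisection H g Ce tol l r d
  | more {l r l' r' : ℝ} {d₀ d : Vec n} (step : BisectionStep H g Ce l r l' r' d₀)
      (long : tol ≤ |r' - l'|) (rest : Bisection H g Ce tol l' r' d) :
      Bisection H g Ce tol l r d

/-- `[l, r]` contains a parameter at which `-μ = Ce ‖v / t‖` holds exactly. -/
def Brackets {n : ℕ} (H : Op n) (g : Vec n) (Ce l r : ℝ) : Prop :=
  ∃ δ ∈ Set.Icc l r, ∃ (μ t : ℝ) (v : Vec n),
    IsLeftmostEigenpair H g δ μ v t ∧ t ≠ 0 ∧ Ce * ‖t⁻¹ • v‖ = -μ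

/-- `d` is an output of the line search for `(g, H)`: perturb `g`, then bisect from some initial
interval which contains the parameter that is searched for. -/
def IsLineSearchOutput {n : ℕ} (H : Op n) (g : Vec n) (Ce εeig εls : ℝ) (d : Vec n) : Prop :=
  ∃ (g' : Vec n) (l r : ℝ), IsPerturbed H g εeig g' ∧ Brackets H g' Ce l r ∧
    Bisection H g' Ce εls l r d

/-! ### The algorithm -/

/-- The average of a finite batch. -/
noncomputable def batchMean {V : Type*} [AddCommGroup V] [Module ℝ V] {N : ℕ}
    (y : Fin N → V) : V :=
  (N : ℝ)⁻¹ • ∑ i, y i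

/-- `x 0, …, x K` are the iterates of a `K`-iteration run of SHSODM started at `x₀`.
In iteration `k` the fresh samples `ξ k (inl i)`, `i < ng`, and `ξ k (inr i)`, `i < nH`, are
drawn: they are independent with law `D`, and independent of the history `ℱ k` of the run. -/
structure IsRun {n : ℕ} {Ω Ξ : Type*} [mΩ : MeasurableSpace Ω] [MeasurableSpace Ξ]
    (P : Measure Ω) (D : Measure Ξ) (G : Vec n → Ξ → Vec n) (Q : Vec n → Ξ → Op n)
    (K ng nH : ℕ) (Ce εeig εls : ℝ) (x₀ : Vec n) (ℱ : Filtration ℕ mΩ)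
    (ξ : ℕ → Fin ng ⊕ Fin nH → Ω → Ξ) (x : ℕ → Ω → Vec n) : Prop where
  init : ∀ ω, x 0 ω = x₀
  adapted : ∀ k ≤ K, Measurable[ℱ k] (x k)
  sample_measurable : ∀ k < K, ∀ i, Measurable[ℱ (k + 1)] (ξ k i)
  sample_law : ∀ k < K, ∀ i, P.map (ξ k i) = D
  sample_indep : ∀ k < K, iIndepFun (ξ k) P
  sample_fresh : ∀ k < K,
    Indep (MeasurableSpace.comap (fun ω i => ξ k i ω) MeasurableSpace.pi) (ℱ k) P
  step : ∀ k < K, ∀ᵐ ω ∂P, ∃ d : Vec n,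
    IsLineSearchOutput (batchMean fun i => Q (x k ω) (ξ k (Sum.inr i) ω))
      (batchMean fun i => G (x k ω) (ξ k (Sum.inl i) ω)) Ce εeig εls d ∧
    x (k + 1) ω = x k ω + d

end SHSODM

/-! The argument splits at `α = 3/2`. Below it, gradient dominance on the whole space forces faster
than cubic growth, while a Lipschitz Hessian permits at most cubic growth, so only dimension zero
survives (`GradientDominated.dim_eq_zero`) and every iterate is a minimiser.

For `α ≥ 3/2`, the perturbation rules out the hard case of the eigenvalue problem. The line search
then returns an approximate cubic-regularized Newton step: `H d + lam d = -g'` with `H + lam`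
nonnegative along `d` and `lam` close to `(L + 4) / 3 * ‖d‖` (`IsLineSearchOutput.newton_step`).
Such a step lowers `F` by about `‖d‖ ^ 3 / 4` and leaves a gradient of order `‖d‖ ^ 2`, up to
sampling errors. With gradient dominance and `p = 3 / (2 * α) ≤ 1`, consecutive gaps `a`, `y`
satisfy `y + 2 c y ^ p ≤ a + 6 b ^ p`, where `b` is the noise of the step (`suboptimality_step`).
Without noise the gap contracts linearly if `p = 1` and superlinearly if `p < 1`.

For `p < 1` one cannot simply take expectations in this inequality, because `y ^ p` is concave. The
recursion is therefore unrolled along each path: a step either contracts, or lands below a value `ν`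
with `ν + ν ^ (1 / p) ≤ B * b * (1 + a ^ (1 / p))` (`exists_jump_bound`). The effect of a jump
decays at a summable rate (`exists_summable_weights`), so the final gap is the noiseless one plus a
weighted sum of the terms `b * (1 + a ^ (1 / p))`. Fresh samples decouple `b` from `a`, and the
batch sizes make the conditional mean of `b` at most `η ε` (`exists_noise_bound`, through a
Marcinkiewicz–Zygmund inequality). The moments of `1 + a ^ (1 / p)` grow by a factor `1 + B η ε` per
step, hence stay bounded over `O(1 / ε)` steps, far more than are needed. A small `η` closes the
estimate (`expectation_bound`, `exists_constants_of_iterations`). -/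

namespace SHSODM

/-! ### Taylor expansions under a Lipschitz Hessian. -/

section Taylor

variable {n : ℕ} {F : Vec n → ℝ} {L : ℝ}

theorem LipschitzHessian.hasDerivAt_gradient_line (hF : LipschitzHessian F L) (x d : Vec n)
    (t : ℝ) : HasDerivAt (fun t : ℝ => gradient F (x + t • d)) (hess F (x + t • d) d) t := by
  have h1 : HasDerivAt (fun t : ℝ => x + t • d) d t := by
    simpa using ((hasDerivAt_id t).smul_const d).const_add x
  exact (hF.differentiable_gradient (x + t • d)).hasFDerivAt.comp_hasDerivAt t h1

theorem LipschitzHessian.hasDerivAt_line (hF : LipschitzHessian F L) (x d : Vec n)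
    (t : ℝ) : HasDerivAt (fun t : ℝ => F (x + t • d)) ⟪gradient F (x + t • d), d⟫ t := by
  have h1 : HasDerivAt (fun t : ℝ => x + t • d) d t := by
    simpa using ((hasDerivAt_id t).smul_const d).const_add x
  have h2 := (hF.differentiable (x + t • d)).hasGradientAt.hasFDerivAt.comp_hasDerivAt t h1
  simp only [InnerProductSpace.toDual_apply_apply] at h2
  exact h2

/-- The derivative in `t` is bounded by `L t ‖d‖ ^ 2`, which the mean value inequality integrates.
All `t` in `[0, 1]` are needed because the second-order expansion integrates this bound once more.
-/
theorem LipschitzHessian.norm_gradient_sub_le_line (hF : LipschitzHessian F L) (x d : Vec n)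
    {t : ℝ} (ht : t ∈ Set.Icc (0 : ℝ) 1) :
    ‖gradient F (x + t • d) - gradient F x - t • hess F x d‖ ≤ L / 2 * t ^ 2 * ‖d‖ ^ 2 := by
  have hder : ∀ t : ℝ, HasDerivAt
      (fun t : ℝ => gradient F (x + t • d) - gradient F x - t • hess F x d)
      (hess F (x + t • d) d - hess F x d) t := fun t => by
    have := ((hF.hasDerivAt_gradient_line x d t).sub_const (gradient F x)).fun_sub
      ((hasDerivAt_id t).smul_const (hess F x d))
    simpa only [one_smul, id] using this
  refine image_norm_le_of_norm_deriv_right_le_deriv_boundary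
    (f := fun t : ℝ => gradient F (x + t • d) - gradient F x - t • hess F x d)
    (B := fun t => L / 2 * t ^ 2 * ‖d‖ ^ 2) (B' := fun t => L * t * ‖d‖ ^ 2)
    (f' := fun t => hess F (x + t • d) d - hess F x d)
    (fun t _ => (hder t).continuousAt.continuousWithinAt)
    (fun t _ => (hder t).hasDerivWithinAt) (by simp) (fun t => ?_) (fun t ht => ?_) ht
  · have := (((hasDerivAt_pow 2 t).const_mul (L / 2)).mul_const (‖d‖ ^ 2))
    exact this.congr_deriv (by push_cast; ring)
  · calc ‖hess F (x + t • d) d - hess F x d‖ = ‖(hess F (x + t • d) - hess F x) d‖ := by simp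
      _ ≤ ‖hess F (x + t • d) - hess F x‖ * ‖d‖ := ContinuousLinearMap.le_opNorm _ _
      _ ≤ L * ‖x + t • d - x‖ * ‖d‖ := by gcongr; exact hF.lipschitz _ _
      _ = L * t * ‖d‖ ^ 2 := by
        rw [add_sub_cancel_left, norm_smul, Real.norm_of_nonneg ht.1]; ring

/-- First-order expansion of the gradient. -/
theorem LipschitzHessian.norm_gradient_sub_le (hF : LipschitzHessian F L) (x d : Vec n) :
    ‖gradient F (x + d) - gradient F x - hess F x d‖ ≤ L / 2 * ‖d‖ ^ 2 := by
  simpa using hF.norm_gradient_sub_le_line x d (t := 1) (by simp)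

/-- Second-order expansion of the function. -/
theorem LipschitzHessian.abs_sub_le (hF : LipschitzHessian F L) (x d : Vec n) :
    |F (x + d) - F x - ⟪gradient F x, d⟫ - 1 / 2 * ⟪hess F x d, d⟫| ≤ L / 6 * ‖d‖ ^ 3 := by
  have hder : ∀ t : ℝ, HasDerivAt
      (fun t : ℝ => F (x + t • d) - F x - t * ⟪gradient F x, d⟫ - t ^ 2 / 2 * ⟪hess F x d, d⟫)
      ⟪gradient F (x + t • d) - gradient F x - t • hess F x d, d⟫ t := fun t => by
    have := (((hF.hasDerivAt_line x d t).sub_const (F x)).fun_sub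
      ((hasDerivAt_id t).mul_const ⟪gradient F x, d⟫)).fun_sub
      (((hasDerivAt_pow 2 t).div_const 2).mul_const ⟪hess F x d, d⟫)
    exact this.congr_deriv (by simp [inner_sub_left, real_inner_smul_left])
  have key := image_norm_le_of_norm_deriv_right_le_deriv_boundary (a := 0) (b := 1)
    (f := fun t : ℝ => F (x + t • d) - F x - t * ⟪gradient F x, d⟫ - t ^ 2 / 2 * ⟪hess F x d, d⟫)
    (B := fun t => L / 6 * t ^ 3 * ‖d‖ ^ 3) (B' := fun t => L / 2 * t ^ 2 * ‖d‖ ^ 2 * ‖d‖)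
    (f' := fun t => ⟪gradient F (x + t • d) - gradient F x - t • hess F x d, d⟫)
    (fun t _ => (hder t).continuousAt.continuousWithinAt)
    (fun t _ => (hder t).hasDerivWithinAt) (by simp) (fun t => ?_) (fun t ht => ?_)
    (x := 1) (by simp)
  · simpa using key
  · have := (((hasDerivAt_pow 3 t).const_mul (L / 6)).mul_const (‖d‖ ^ 3))
    exact this.congr_deriv (by push_cast; ring)
  · refine (norm_inner_le_norm _ _).trans ?_
    gcongr
    exact hF.norm_gradient_sub_le_line x d ⟨ht.1, ht.2.le⟩

theorem CoerciveBddBelow.infVal_le (hb : CoerciveBddBelow F) (x : Vec n) : infVal F ≤ F x :=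
  ciInf_le hb.bddBelow x

/-- A function with Lipschitz Hessian grows at most cubically. -/
theorem LipschitzHessian.cubic_growth (hF : LipschitzHessian F L) (hL : 0 ≤ L) (x₀ : Vec n) (m : ℝ) :
    ∃ B > 0, ∀ x, F x - m ≤ B * (1 + ‖x - x₀‖) ^ 3 := by
  refine ⟨|F x₀ - m| + ‖gradient F x₀‖ + ‖hess F x₀‖ + L + 1, by positivity, fun x => ?_⟩
  have h := (abs_le.1 (hF.abs_sub_le x₀ (x - x₀))).2
  rw [add_sub_cancel] at h
  set r := ‖x - x₀‖ with hr
  have hr0 : 0 ≤ r := norm_nonneg _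
  have h1 : ⟪gradient F x₀, x - x₀⟫ ≤ ‖gradient F x₀‖ * r := real_inner_le_norm _ _
  have h2 : ⟪hess F x₀ (x - x₀), x - x₀⟫ ≤ ‖hess F x₀‖ * r * r :=
    (real_inner_le_norm _ _).trans (by gcongr; exact ContinuousLinearMap.le_opNorm _ _)
  have h3 := le_abs_self (F x₀ - m)
  have e1 : 1 ≤ (1 + r) ^ 3 := one_le_pow₀ (by linarith)
  have e2 : r ≤ (1 + r) ^ 3 := by nlinarith [pow_nonneg hr0 2, pow_nonneg hr0 3]
  have e3 : r * r ≤ (1 + r) ^ 3 := by nlinarith [pow_nonneg hr0 2, pow_nonneg hr0 3]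
  have e4 : r ^ 3 ≤ (1 + r) ^ 3 := by gcongr; linarith
  have f1 := mul_le_mul_of_nonneg_left e1 (abs_nonneg (F x₀ - m))
  have f2 := mul_le_mul_of_nonneg_left e2 (norm_nonneg (gradient F x₀))
  have f3 := mul_le_mul_of_nonneg_left e3 (norm_nonneg (hess F x₀))
  have f4 := mul_le_mul_of_nonneg_left e4 hL
  have f5 : 0 ≤ ‖hess F x₀‖ * (1 + r) ^ 3 := by positivity
  have f6 : 0 ≤ L * (1 + r) ^ 3 := by positivity
  nlinarith

end Taylor

/-! ### Incompatibility of an exponent below `3 / 2` with a Lipschitz Hessian. -/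

section Growth

variable {n : ℕ} {F : Vec n → ℝ} {L α C : ℝ}

/-- A coercive function which is gradient-dominated on the whole space with an exponent below `3 / 2`
grows faster than cubically, and a globally Lipschitz Hessian allows at most cubic growth. So such
functions exist in dimension zero only. The proof maximises `(F - F*) ^ s - c ‖x - x₀‖` for some
`s ∈ (1 - 1 / α, 1 / 3)`. -/
theorem GradientDominated.dim_eq_zero (hgd : GradientDominated F α C) (hC : 0 < C)
    (hα : 1 ≤ α) (hα' : α < 3 / 2) (hb : CoerciveBddBelow F) (hF : LipschitzHessian F L)
    (hL : 0 ≤ L) : n = 0 := by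
  by_contra hn
  have : NeZero n := ⟨hn⟩
  have hα0 : 0 < α := by linarith
  -- Coercivity excludes constant functions: the sublevel set at the infimum would be the whole,
  -- unbounded space.
  obtain ⟨x₀, hx₀⟩ : ∃ x₀, infVal F < F x₀ := by
    by_contra! h
    have h1 := hb.coercive (infVal F)
    have h2 : {x | F x ≤ infVal F} = Set.univ := Set.eq_univ_of_forall h
    rw [h2] at h1
    exact NormedSpace.unbounded_univ ℝ (Vec n) h1
  -- `s < 1 / 3` makes `f ^ s` sublinear, so the penalty wins at infinity; `s > 1 - 1 / α` makes the
  -- slope of `f ^ s` bounded below where `f ≥ f x₀`. Both are possible exactly because `α < 3 / 2`.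
  obtain ⟨s, hs1, hs2⟩ : ∃ s, 1 - 1 / α < s ∧ s < 1 / 3 := by
    apply exists_between
    have : 1 / (3 / 2 : ℝ) < 1 / α := one_div_lt_one_div_of_lt hα0 hα'
    linarith
  have hs0 : 0 < s := lt_of_le_of_lt (by
    have : 1 / α ≤ 1 := by rw [div_le_one hα0]; exact hα
    linarith) hs1
  set f : Vec n → ℝ := fun x => F x - infVal F with hf
  have hf0 : ∀ x, 0 ≤ f x := fun x => sub_nonneg.2 (hb.infVal_le x)
  have hfx₀ : 0 < f x₀ := sub_pos.2 hx₀
  have hfcont : Continuous f := hF.differentiable.continuous.sub continuous_const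
  -- Half of the lower bound that gradient dominance gives for the slope of `f ^ s` on `{f ≥ f x₀}`.
  -- Maximality will bound the slope by `c`, dominance by `2 * c` from below.
  set c : ℝ := s * (f x₀ ^ (s - 1 + 1 / α) * (C⁻¹) ^ (1 / α)) / 2 with hc
  have hcpos : 0 < c := by positivity
  obtain ⟨B, hB, hgrow⟩ := hF.cubic_growth hL x₀ (infVal F)
  -- the penalised function attains its maximum
  obtain ⟨z, hz⟩ : ∃ z, ∀ x, f x ^ s - c * ‖x - x₀‖ ≤ f z ^ s - c * ‖z - x₀‖ := by
    apply Continuous.exists_forall_ge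
    · exact (hfcont.rpow_const fun _ => Or.inr hs0.le).sub (by fun_prop)
    · have h1 : Filter.Tendsto (fun r : ℝ => B ^ s * r ^ (3 * s) - c * (r - 1)) Filter.atTop
          Filter.atBot := by
        have hlit : (fun r : ℝ => r ^ (3 * s)) =o[Filter.atTop] fun r : ℝ => r := by
          rw [Asymptotics.isLittleO_iff_tendsto' ((Filter.eventually_gt_atTop 0).mono
            fun r hr h => absurd h (ne_of_gt hr))]
          refine (tendsto_rpow_neg_atTop (y := 1 - 3 * s) (by linarith)).congr' ?_
          filter_upwards [Filter.eventually_gt_atTop 0] with r hr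
          rw [show -(1 - 3 * s) = 3 * s - 1 by ring, Real.rpow_sub_one hr.ne']
        have h2 : (fun r : ℝ => B ^ s * r ^ (3 * s)) =o[Filter.atTop] fun r : ℝ => r :=
          hlit.const_mul_left _
        have h3 := h2.def (half_pos hcpos)
        have h4 : Filter.Tendsto (fun r : ℝ => c - c / 2 * r) Filter.atTop Filter.atBot := by
          have := (Filter.tendsto_id (α := ℝ) (x := Filter.atTop)).const_mul_atTop
            (half_pos hcpos)
          simpa [sub_eq_add_neg] using Filter.tendsto_atBot_add_const_left _ c
            (Filter.tendsto_neg_atTop_atBot.comp this)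
        refine Filter.tendsto_atBot_mono' _ ?_ h4
        filter_upwards [h3, Filter.eventually_ge_atTop 0] with r hr hr0
        have := (le_abs_self _).trans hr
        rw [Real.norm_of_nonneg hr0] at this
        linarith
      have h5 : Filter.Tendsto (fun x : Vec n => 1 + ‖x - x₀‖) (Filter.cocompact (Vec n))
          Filter.atTop := by
        apply Filter.tendsto_atTop_add_const_left
        refine Filter.tendsto_atTop_mono (f := fun x : Vec n => ‖x‖ - ‖x₀‖)
          (fun x => norm_sub_norm_le x x₀) ?_
        exact Filter.tendsto_atTop_add_const_right _ (-‖x₀‖) (tendsto_norm_cocompact_atTop)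
      refine Filter.tendsto_atBot_mono (fun x => ?_) (h1.comp h5)
      have h6 : f x ^ s ≤ B ^ s * (1 + ‖x - x₀‖) ^ (3 * s) := by
        calc f x ^ s ≤ (B * (1 + ‖x - x₀‖) ^ 3) ^ s :=
              Real.rpow_le_rpow (hf0 x) (hgrow x) hs0.le
          _ = B ^ s * (1 + ‖x - x₀‖) ^ (3 * s) := by
              rw [Real.mul_rpow hB.le (by positivity), Real.rpow_mul (by positivity)]
              norm_num
      simp only [Function.comp]
      linarith
  have hz1 : f x₀ ^ s ≤ f z ^ s := by
    have := hz x₀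
    simp only [sub_self, norm_zero, mul_zero, sub_zero] at this
    have h2 : 0 ≤ c * ‖z - x₀‖ := by positivity
    linarith
  have hz2 : f x₀ ≤ f z := (Real.rpow_le_rpow_iff hfx₀.le (hf0 z) hs0).1 hz1
  have hfz : 0 < f z := hfx₀.trans_le hz2
  set G := gradient F z with hG
  have hgrad : (f z) ^ (1 / α) * (C⁻¹) ^ (1 / α) ≤ ‖G‖ := by
    rw [← Real.mul_rpow hfz.le (by positivity)]
    have h1 : f z * C⁻¹ ≤ ‖G‖ ^ α := by
      rw [← div_eq_mul_inv, div_le_iff₀ hC, mul_comm]; exact hgd z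
    calc (f z * C⁻¹) ^ (1 / α) ≤ (‖G‖ ^ α) ^ (1 / α) :=
          Real.rpow_le_rpow (by positivity) h1 (by positivity)
      _ = ‖G‖ := by rw [← Real.rpow_mul (norm_nonneg _), mul_one_div_cancel hα0.ne', Real.rpow_one]
  have hGpos : 0 < ‖G‖ := lt_of_lt_of_le (by positivity) hgrad
  set e : Vec n := ‖G‖⁻¹ • G with he
  have henorm : ‖e‖ = 1 := by rw [he, norm_smul, norm_inv, norm_norm, inv_mul_cancel₀ hGpos.ne']
  have hinner : ⟪G, e⟫ = ‖G‖ := by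
    rw [he, real_inner_smul_right, real_inner_self_eq_norm_sq]; field_simp
  have hd : HasDerivAt (fun t : ℝ => f (z + t • e) ^ s) (‖G‖ * s * f z ^ (s - 1)) 0 := by
    have h1 := (hF.hasDerivAt_line z e 0).sub_const (infVal F)
    simp only [zero_smul, add_zero] at h1
    rw [← hG, hinner] at h1
    have h2 := h1.rpow_const (p := s) (Or.inl (by simpa using hfz.ne'))
    simpa [hf] using h2
  have hslope : ‖G‖ * s * f z ^ (s - 1) ≤ c := by
    have h1 := hd.hasDerivWithinAt (s := Set.Ioi 0)
    rw [hasDerivWithinAt_iff_tendsto_slope' (by simp)] at h1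
    refine le_of_tendsto h1 ?_
    filter_upwards [self_mem_nhdsWithin] with t ht
    have ht0 : (0 : ℝ) < t := ht
    rw [slope_def_field, sub_zero, div_le_iff₀ ht0]
    have h2 := hz (z + t • e)
    have h3 : ‖z + t • e - x₀‖ ≤ ‖z - x₀‖ + t := by
      calc ‖z + t • e - x₀‖ = ‖(z - x₀) + t • e‖ := by congr 1; abel
        _ ≤ ‖z - x₀‖ + ‖t • e‖ := norm_add_le _ _
        _ = ‖z - x₀‖ + t := by rw [norm_smul, henorm, Real.norm_of_nonneg ht0.le, mul_one]
    have h4 := mul_le_mul_of_nonneg_left h3 hcpos.le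
    simp only [zero_smul, add_zero]
    linarith
  have hlow : 2 * c ≤ ‖G‖ * s * f z ^ (s - 1) := by
    have h1 : f x₀ ^ (s - 1 + 1 / α) ≤ f z ^ (s - 1 + 1 / α) :=
      Real.rpow_le_rpow hfx₀.le hz2 (by linarith)
    rw [Real.rpow_add hfz] at h1
    calc 2 * c = s * (f x₀ ^ (s - 1 + 1 / α) * (C⁻¹) ^ (1 / α)) := by rw [hc]; ring
      _ ≤ s * (f z ^ (s - 1) * f z ^ (1 / α) * (C⁻¹) ^ (1 / α)) := by gcongr
      _ = (f z ^ (1 / α) * (C⁻¹) ^ (1 / α)) * (s * f z ^ (s - 1)) := by ring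
      _ ≤ ‖G‖ * (s * f z ^ (s - 1)) := by gcongr
      _ = _ := by ring
  linarith

end Growth

end SHSODM

namespace SHSODM

/-! ### The augmented eigenvalue problem, the perturbation and the line search. -/

section Eigen

/-- The Rayleigh quotient is bounded below by every lower bound of the spectrum. -/
theorem mul_norm_sq_le_inner_of_le_eigenvalues {E : Type*} [NormedAddCommGroup E]
    [InnerProductSpace ℝ E] [FiniteDimensional ℝ E] {T : E →ₗ[ℝ] E} (hT : T.IsSymmetric) {μ : ℝ}
    (hμ : ∀ ν : ℝ, Module.End.HasEigenvalue T ν → μ ≤ ν) (x : E) : μ * ‖x‖ ^ 2 ≤ ⟪T x, x⟫ := by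
  rcases eq_or_ne x 0 with rfl | hx
  · simp
  have : Nontrivial E := ⟨x, 0, hx⟩
  have h1 := hμ _ hT.hasEigenvalue_iInf_of_finiteDimensional
  have hbdd : BddBelow (Set.range fun y : {y : E // y ≠ 0} => ⟪T y, (y : E)⟫ / ‖(y : E)‖ ^ 2) := by
    refine ⟨-‖LinearMap.toContinuousLinearMap T‖, ?_⟩
    rintro _ ⟨⟨y, hy⟩, rfl⟩
    have hy' : 0 < ‖y‖ := norm_pos_iff.2 hy
    rw [le_div_iff₀ (by positivity)]
    have h2 := (abs_le.1 (abs_real_inner_le_norm (T y) y)).1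
    have h3 := (LinearMap.toContinuousLinearMap T).le_opNorm y
    simp only [LinearMap.coe_toContinuousLinearMap'] at h3
    nlinarith
  have h2 : μ ≤ ⟪T x, x⟫ / ‖x‖ ^ 2 := h1.trans (ciInf_le hbdd ⟨x, hx⟩)
  rwa [le_div_iff₀ (by have := norm_pos_iff.2 hx; positivity)] at h2

variable {n : ℕ} {H : Op n} {g : Vec n}

theorem IsLeftmostEigenvalue.mul_norm_sq_le (hH : IsSelfAdjoint H) {μ : ℝ}
    (hμ : IsLeftmostEigenvalue (H : Module.End ℝ (Vec n)) μ) (w : Vec n) :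
    μ * ‖w‖ ^ 2 ≤ ⟪H w, w⟫ :=
  mul_norm_sq_le_inner_of_le_eigenvalues
    (ContinuousLinearMap.isSelfAdjoint_iff_isSymmetric.1 hH) hμ.2 w

/-- The product `Vec n × ℝ` carries the sup norm, so the matrix is transported to the `L²` product,
where it is symmetric and the Rayleigh bound applies. -/
theorem IsLeftmostEigenvalue.augmented_form (hH : IsSelfAdjoint H) {δ μ : ℝ}
    (hμ : IsLeftmostEigenvalue (augmented H g δ) μ) (w : Vec n) (s : ℝ) :
    μ * (‖w‖ ^ 2 + s ^ 2) ≤ ⟪H w, w⟫ + 2 * s * ⟪g, w⟫ + δ * s ^ 2 := by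
  let e := WithLp.linearEquiv 2 ℝ (Vec n × ℝ)
  let T : WithLp 2 (Vec n × ℝ) →ₗ[ℝ] WithLp 2 (Vec n × ℝ) :=
    e.symm.toLinearMap ∘ₗ augmented H g δ ∘ₗ e.toLinearMap
  have hTapp : ∀ z, (T z).ofLp = (H z.ofLp.1 + z.ofLp.2 • g, ⟪g, z.ofLp.1⟫ + δ * z.ofLp.2) :=
    fun z => rfl
  have hsymm := ContinuousLinearMap.isSelfAdjoint_iff_isSymmetric.1 hH
  have hT : T.IsSymmetric := by
    intro y z
    have := hsymm y.ofLp.1 z.ofLp.1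
    simp only [ContinuousLinearMap.coe_coe] at this
    simp only [WithLp.prod_inner_apply, hTapp, inner_add_left, inner_add_right,
      real_inner_smul_left, real_inner_smul_right, this, RCLike.inner_apply, conj_trivial,
      real_inner_comm g]
    ring
  have hev : ∀ ν : ℝ, Module.End.HasEigenvalue T ν → μ ≤ ν := by
    intro ν hν
    obtain ⟨z, hz⟩ := hν.exists_hasEigenvector
    refine hμ.2 ν (Module.End.hasEigenvalue_of_hasEigenvector (x := e z) ⟨?_, ?_⟩)
    · rw [Module.End.mem_eigenspace_iff, ← map_smul, ← hz.apply_eq_smul]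
      rfl
    · simpa using hz.2
  have h1 := mul_norm_sq_le_inner_of_le_eigenvalues hT hev (WithLp.toLp 2 (w, s))
  rw [WithLp.prod_norm_sq_eq_of_L2, WithLp.prod_inner_apply, hTapp] at h1
  simp only [inner_add_left, real_inner_smul_left, RCLike.inner_apply, conj_trivial,
    Real.norm_eq_abs, sq_abs, WithLp.fst, WithLp.snd] at h1
  linarith

/-- The perturbed gradient is close to the gradient and has a component of size at least `ε` in
the eigenspace of the smallest eigenvalue. -/
theorem IsPerturbed.exists_eigenvector {ε : ℝ} (hε : 0 < ε) {g' : Vec n}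
    (h : IsPerturbed H g ε g') :
    ‖g' - g‖ ≤ ε ∧ ∃ (μ : ℝ) (u : Vec n), IsLeftmostEigenvalue (H : Module.End ℝ (Vec n)) μ ∧
      ‖u‖ = 1 ∧ H u = μ • u ∧ ε ≤ ⟪g', u⟫ := by
  obtain ⟨μ, hμ, S, hS, p, hp, hcase⟩ := h
  have hpS : p ∈ S := by rw [hp]; exact Submodule.starProjection_apply_mem S g
  have hmem : ∀ u ∈ S, H u = μ • u := fun u hu => by
    rw [hS, Module.End.mem_eigenspace_iff] at hu; exact hu
  have hinner : ∀ u ∈ S, ⟪g, u⟫ = ⟪p, u⟫ := fun u hu => by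
    have := Submodule.starProjection_inner_eq_zero (𝕜 := ℝ) (K := S) g u hu
    rw [inner_sub_left, ← hp] at this
    linarith
  rcases hcase with ⟨hle, rfl⟩ | ⟨hlt, u, hu, hu1, hup, rfl⟩
  · have hp0 : 0 < ‖p‖ := hε.trans_le hle
    refine ⟨by simpa using hε.le, μ, ‖p‖⁻¹ • p, hμ, ?_, hmem _ (S.smul_mem _ hpS), ?_⟩
    · rw [norm_smul, norm_inv, norm_norm, inv_mul_cancel₀ hp0.ne']
    · rw [hinner _ (S.smul_mem _ hpS), real_inner_smul_right, real_inner_self_eq_norm_sq]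
      field_simp
      exact hle
  · refine ⟨by simp [norm_smul, hu1, abs_of_pos hε], μ, u, hμ, hu1, hmem u hu, ?_⟩
    rw [inner_add_left, hinner u hu, ← hup, real_inner_smul_left, real_inner_smul_left,
      real_inner_self_eq_norm_sq, hu1]
    have := norm_nonneg p
    linarith

/-- `d` solves `(H + lam) d = -g` with `H + lam` positive definite, the bound on the inverse being
`‖d‖ / ε`, and `δ` is the parameter of the augmented matrix which belongs to `lam`. -/
structure ShiftedSolution (H : Op n) (g : Vec n) (ε δ lam : ℝ) (d : Vec n) : Prop where
  equation : H d + lam • d = -g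
  parameter : δ = -lam - ⟪g, d⟫
  coercive : ∃ κ > 0, ε ≤ κ * ‖d‖ ∧ ∀ w, κ * ‖w‖ ^ 2 ≤ ⟪H w, w⟫ + lam * ‖w‖ ^ 2

/-- Since `g` has a component along the bottom eigenvector `u` of `H`, mixing `u` with the last
coordinate pushes the leftmost eigenvalue strictly below `μ₀`. Hence `t ≠ 0` and `H - μ` is positive
definite with `κ = μ₀ - μ`; pairing the equation with `u` gives `ε ≤ κ * ‖d‖`. -/
theorem IsLeftmostEigenpair.shiftedSolution (hH : IsSelfAdjoint H) {ε : ℝ} (hε : 0 < ε)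
    {μ₀ : ℝ} {u : Vec n} (hμ₀ : IsLeftmostEigenvalue (H : Module.End ℝ (Vec n)) μ₀)
    (hu : ‖u‖ = 1) (hHu : H u = μ₀ • u) (hgu : ε ≤ ⟪g, u⟫) {δ μ t : ℝ} {v : Vec n}
    (h : IsLeftmostEigenpair H g δ μ v t) :
    ShiftedSolution H g ε δ (-μ) (t⁻¹ • v) := by
  have hform := h.1.augmented_form hH
  have hlow := hμ₀.mul_norm_sq_le hH
  have heig := h.2.apply_eq_smul
  have hne := h.2.2
  have h1 : H v + t • g = μ • v := congrArg Prod.fst heig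
  have h2 : ⟪g, v⟫ + δ * t = μ * t := congrArg Prod.snd heig
  have huu : ⟪H u, u⟫ = μ₀ := by
    rw [hHu, real_inner_smul_left, real_inner_self_eq_norm_sq, hu]; ring
  have hlt : μ < μ₀ := by
    by_contra! hle
    set p := ⟪g, u⟫ with hp
    have hp0 : 0 < p := hε.trans_le hgu
    -- test the form at `(u, -s)` with a small `s`
    have hq : ∀ s : ℝ, 0 < s → 2 * p ≤ |δ - μ| * s := fun s hs => by
      have := hform u (-s)
      rw [hu, huu] at this
      have h3 : 2 * p * s ≤ (δ - μ) * s * s := by nlinarith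
      have h4 : 2 * p ≤ (δ - μ) * s := le_of_mul_le_mul_right h3 hs
      exact h4.trans (by gcongr; exact le_abs_self _)
    have h3 := hq (p / (|δ - μ| + 1)) (by positivity)
    have h4 : |δ - μ| * (p / (|δ - μ| + 1)) ≤ p := by
      rw [mul_div_assoc', div_le_iff₀ (by positivity)]
      nlinarith [abs_nonneg (δ - μ)]
    linarith
  -- With `t = 0`, `v` would be an eigenvector of `H` for a value below its spectrum.
  have ht : t ≠ 0 := by
    rintro rfl
    have hv : v ≠ 0 := fun hv => hne (by rw [hv]; rfl)
    have h3 := hlow v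
    rw [zero_smul, add_zero] at h1
    rw [h1, real_inner_smul_left, real_inner_self_eq_norm_sq] at h3
    have : 0 < ‖v‖ ^ 2 := by have := norm_pos_iff.2 hv; positivity
    nlinarith
  have heq : H (t⁻¹ • v) + (-μ) • t⁻¹ • v = -g := by
    have h3 : H v = μ • v - t • g := by rw [← h1]; abel
    rw [map_smul, h3, smul_sub, smul_smul t⁻¹ t, inv_mul_cancel₀ ht, one_smul, smul_comm t⁻¹ μ,
      neg_smul]
    abel
  refine ⟨heq, ?_, μ₀ - μ, sub_pos.2 hlt, ?_, fun w => ?_⟩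
  · rw [real_inner_smul_right]
    field_simp
    linarith
  · generalize t⁻¹ • v = d at heq
    have hsymm := ContinuousLinearMap.isSelfAdjoint_iff_isSymmetric.1 hH d u
    simp only [ContinuousLinearMap.coe_coe] at hsymm
    have h3 : ⟪H d + (-μ) • d, u⟫ = -⟪g, u⟫ := by rw [heq, inner_neg_left]
    rw [inner_add_left, hsymm, hHu, real_inner_smul_right, real_inner_smul_left] at h3
    have h4 := (abs_le.1 (abs_real_inner_le_norm d u)).1
    rw [hu, mul_one] at h4
    nlinarith
  · linarith [hlow w]

namespace ShiftedSolution

variable {ε δ₁ δ₂ lam₁ lam₂ : ℝ} {d₁ d₂ : Vec n}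

/-- Pair each equation with the other solution and subtract: by symmetry the terms in `H` cancel.
This replaces differentiating `δ` as a function of the shift. -/
theorem parameter_sub (hH : IsSelfAdjoint H) (h₁ : ShiftedSolution H g ε δ₁ lam₁ d₁)
    (h₂ : ShiftedSolution H g ε δ₂ lam₂ d₂) :
    δ₁ - δ₂ = (lam₂ - lam₁) * (1 + ⟪d₁, d₂⟫) := by
  have e1 : ⟪H d₁ + lam₁ • d₁, d₂⟫ = -⟪g, d₂⟫ := by rw [h₁.equation, inner_neg_left]
  have e2 : ⟪H d₂ + lam₂ • d₂, d₁⟫ = -⟪g, d₁⟫ := by rw [h₂.equation, inner_neg_left]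
  have hsymm := ContinuousLinearMap.isSelfAdjoint_iff_isSymmetric.1 hH d₁ d₂
  simp only [ContinuousLinearMap.coe_coe] at hsymm
  rw [inner_add_left, real_inner_smul_left] at e1 e2
  rw [real_inner_comm d₁ d₂] at e2
  rw [real_inner_comm (H d₂) d₁] at hsymm
  rw [h₁.parameter, h₂.parameter]
  linarith

theorem form_sub (h₁ : ShiftedSolution H g ε δ₁ lam₁ d₁)
    (h₂ : ShiftedSolution H g ε δ₂ lam₂ d₂) :
    ⟪H (d₁ - d₂), d₁ - d₂⟫ + lam₁ * ‖d₁ - d₂‖ ^ 2 = (lam₂ - lam₁) * ⟪d₂, d₁ - d₂⟫ := by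
  have h : H (d₁ - d₂) + lam₁ • (d₁ - d₂) = (lam₂ - lam₁) • d₂ := by
    have h3 : H d₁ = -g - lam₁ • d₁ := by rw [← h₁.equation]; abel
    have h4 : H d₂ = -g - lam₂ • d₂ := by rw [← h₂.equation]; abel
    rw [map_sub, h3, h4]
    module
  rw [← real_inner_self_eq_norm_sq, ← real_inner_smul_left, ← inner_add_left, h,
    real_inner_smul_left]

/-- By `form_sub` the coercive form at `d₁ - d₂` equals `(lam₂ - lam₁) * ⟪d₂, d₁ - d₂⟫`, so the
latter inner product is nonnegative. This is the source of the monotonicity in the shift. -/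
theorem norm_sq_le_inner (h₁ : ShiftedSolution H g ε δ₁ lam₁ d₁)
    (h₂ : ShiftedSolution H g ε δ₂ lam₂ d₂) (hlt : lam₁ < lam₂) :
    ‖d₂‖ ^ 2 ≤ ⟪d₁, d₂⟫ := by
  obtain ⟨κ, hκ, -, hc⟩ := h₁.coercive
  have h3 := hc (d₁ - d₂)
  rw [form_sub h₁ h₂] at h3
  have h4 : 0 ≤ ⟪d₂, d₁ - d₂⟫ := by
    have : 0 ≤ (lam₂ - lam₁) * ⟪d₂, d₁ - d₂⟫ := le_trans (by positivity) h3
    exact nonneg_of_mul_nonneg_right this (sub_pos.2 hlt)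
  rw [inner_sub_right, real_inner_self_eq_norm_sq, real_inner_comm] at h4
  linarith

theorem norm_le (h₁ : ShiftedSolution H g ε δ₁ lam₁ d₁)
    (h₂ : ShiftedSolution H g ε δ₂ lam₂ d₂) (hlt : lam₁ < lam₂) : ‖d₂‖ ≤ ‖d₁‖ := by
  have h := (norm_sq_le_inner h₁ h₂ hlt).trans (real_inner_le_norm d₁ d₂)
  by_contra! hcon
  nlinarith [norm_nonneg d₁]

theorem eq_of_shift_eq (h₁ : ShiftedSolution H g ε δ₁ lam₁ d₁)
    (h₂ : ShiftedSolution H g ε δ₂ lam₂ d₂) (heq : lam₁ = lam₂) : d₁ = d₂ := by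
  obtain ⟨κ, hκ, -, hc⟩ := h₁.coercive
  have h3 := hc (d₁ - d₂)
  rw [form_sub h₁ h₂, heq, sub_self, zero_mul] at h3
  have h4 : ‖d₁ - d₂‖ ^ 2 ≤ 0 := by
    by_contra! h
    nlinarith
  exact sub_eq_zero.1 (norm_eq_zero.1 (pow_eq_zero_iff two_ne_zero |>.1
    (le_antisymm h4 (by positivity))))

theorem shift_lt_of_parameter_lt (hH : IsSelfAdjoint H) (h₁ : ShiftedSolution H g ε δ₁ lam₁ d₁)
    (h₂ : ShiftedSolution H g ε δ₂ lam₂ d₂) (hlt : δ₂ < δ₁) : lam₁ < lam₂ := by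
  have h := parameter_sub hH h₁ h₂
  by_contra! hle
  rcases hle.lt_or_eq with h3 | h3
  · have h4 := norm_sq_le_inner h₂ h₁ h3
    rw [real_inner_comm] at h4
    nlinarith [sq_nonneg ‖d₁‖]
  · rw [h3] at h; linarith

/-- Stability of the direction in `δ`. The identity `parameter_sub` bounds `x * (1 + ‖d₂‖ ^ 2)`,
hence by AM-GM `2 * x * ‖d₂‖`, by `τ * ε`; the form identity gives `κ * ‖d₁ - d₂‖ ≤ x * ‖d₂‖`, and
`ε ≤ κ * ‖d₁‖` turns this into a relative error, whatever the size of `κ`. -/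
theorem close_of_shift_lt (hH : IsSelfAdjoint H) (h₁ : ShiftedSolution H g ε δ₁ lam₁ d₁)
    (h₂ : ShiftedSolution H g ε δ₂ lam₂ d₂) (hlt : lam₁ < lam₂) {τ : ℝ} (hε : 0 < ε)
    (hτ : τ ≤ 1) (hδ : |δ₁ - δ₂| ≤ τ * ε) :
    lam₂ - lam₁ ≤ τ * ε ∧ ‖d₁ - d₂‖ ≤ τ * ‖d₁‖ ∧ ‖d₁ - d₂‖ ≤ τ * ‖d₂‖ := by
  have hpar := parameter_sub hH h₁ h₂
  have hin := norm_sq_le_inner h₁ h₂ hlt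
  have hform := form_sub h₁ h₂
  obtain ⟨κ, hκ, hκd, hc⟩ := h₁.coercive
  set x := lam₂ - lam₁ with hx
  have hx0 : 0 < x := sub_pos.2 hlt
  have hτ0 : 0 ≤ τ := nonneg_of_mul_nonneg_left ((abs_nonneg _).trans hδ) hε
  have hb : x * (1 + ‖d₂‖ ^ 2) ≤ τ * ε := by
    calc x * (1 + ‖d₂‖ ^ 2) ≤ x * (1 + ⟪d₁, d₂⟫) := by gcongr
      _ = δ₁ - δ₂ := hpar.symm
      _ ≤ τ * ε := (le_abs_self _).trans hδ
  have hb1 : x ≤ τ * ε := by nlinarith [sq_nonneg ‖d₂‖]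
  have hb2 : 2 * (x * ‖d₂‖) ≤ τ * ε := by nlinarith [sq_nonneg (‖d₂‖ - 1)]
  set w := ‖d₁ - d₂‖ with hw
  have hw0 : 0 ≤ w := norm_nonneg _
  have h3 : κ * w ≤ x * ‖d₂‖ := by
    rcases hw0.eq_or_lt with h0 | h0
    · rw [← h0, mul_zero]; exact mul_nonneg hx0.le (norm_nonneg _)
    · have h4 := hc (d₁ - d₂)
      rw [hform] at h4
      have h5 := mul_le_mul_of_nonneg_left (real_inner_le_norm d₂ (d₁ - d₂)) hx0.le
      refine le_of_mul_le_mul_right ?_ h0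
      nlinarith
  have h4 : 2 * (ε * w) ≤ τ * ε * ‖d₁‖ := by
    have e1 : ε * w ≤ κ * ‖d₁‖ * w := by gcongr
    have e2 : κ * w * ‖d₁‖ ≤ x * ‖d₂‖ * ‖d₁‖ := by gcongr
    have e3 : 2 * (x * ‖d₂‖) * ‖d₁‖ ≤ τ * ε * ‖d₁‖ := by gcongr
    linarith
  -- The spare factor `2` pays for replacing `‖d₁‖` by `‖d₂‖ + w`, since `τ ≤ 1`.
  have h5 : 2 * w ≤ τ * ‖d₁‖ := by
    refine le_of_mul_le_mul_left ?_ hε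
    linarith
  have h6 : ‖d₁‖ ≤ ‖d₂‖ + w := by
    have := norm_add_le d₂ (d₁ - d₂)
    rwa [add_sub_cancel] at this
  have h7 : τ * ‖d₁‖ ≤ τ * (‖d₂‖ + w) := by gcongr
  refine ⟨hb1, by linarith, ?_⟩
  nlinarith

theorem close (hH : IsSelfAdjoint H) (h₁ : ShiftedSolution H g ε δ₁ lam₁ d₁)
    (h₂ : ShiftedSolution H g ε δ₂ lam₂ d₂) {τ : ℝ} (hε : 0 < ε)
    (hτ : τ ≤ 1) (hδ : |δ₁ - δ₂| ≤ τ * ε) :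
    |lam₁ - lam₂| ≤ τ * ε ∧ ‖d₁ - d₂‖ ≤ τ * ‖d₁‖ := by
  have hτε : 0 ≤ τ * ε := (abs_nonneg _).trans hδ
  have hτ0 : 0 ≤ τ := nonneg_of_mul_nonneg_left hτε hε
  rcases lt_trichotomy lam₁ lam₂ with h | h | h
  · obtain ⟨e1, e2, e3⟩ := close_of_shift_lt hH h₁ h₂ h hε hτ hδ
    exact ⟨by rw [abs_sub_comm, abs_of_pos (sub_pos.2 h)]; exact e1, e2⟩
  · rw [eq_of_shift_eq h₁ h₂ h, h]
    simp only [sub_self, abs_zero, norm_zero]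
    exact ⟨hτε, by positivity⟩
  · rw [abs_sub_comm] at hδ
    obtain ⟨e1, e2, e3⟩ := close_of_shift_lt hH h₂ h₁ h hε hτ hδ
    exact ⟨by rw [abs_of_pos (sub_pos.2 h)]; exact e1, by rwa [norm_sub_rev]⟩

end ShiftedSolution

/-- As `δ` increases, the shift decreases and `‖d‖` does not decrease, so the sign test keeps the
root `δ₀` in the interval. The returned midpoint is an endpoint of the last interval, which has
length below `tol`. -/
theorem Bisection.exists_close {Ce tol ε : ℝ} (hH : IsSelfAdjoint H) (hCe : 0 ≤ Ce)
    (hsol : ∀ {δ μ t : ℝ} {v : Vec n}, IsLeftmostEigenpair H g δ μ v t →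
      ShiftedSolution H g ε δ (-μ) (t⁻¹ • v))
    {δ₀ lam₀ : ℝ} {d₀ : Vec n} (h₀ : ShiftedSolution H g ε δ₀ lam₀ d₀)
    (hroot : Ce * ‖d₀‖ = lam₀) {l r : ℝ} {d : Vec n} (h : Bisection H g Ce tol l r d)
    (hl : l ≤ δ₀) (hr : δ₀ ≤ r) :
    ∃ δ lam, |δ - δ₀| ≤ tol ∧ ShiftedSolution H g ε δ lam d := by
  have step : ∀ {l r l' r' : ℝ} {d : Vec n}, BisectionStep H g Ce l r l' r' d → l ≤ δ₀ →
      δ₀ ≤ r → ∃ δ lam, ShiftedSolution H g ε δ lam d ∧ l' ≤ δ₀ ∧ δ₀ ≤ r' ∧ (δ = l' ∨ δ = r') := by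
    rintro l r l' r' d ⟨m, μ, t, v, -, hpair, rfl, hcase⟩ hl hr
    have hm := hsol hpair
    refine ⟨m, -μ, hm, ?_⟩
    rcases hcase with ⟨hle, rfl, rfl⟩ | ⟨hlt, rfl, rfl⟩
    · refine ⟨?_, hr, Or.inl rfl⟩
      by_contra! hcon
      have h1 := ShiftedSolution.shift_lt_of_parameter_lt hH hm h₀ hcon
      have h2 := mul_le_mul_of_nonneg_left (ShiftedSolution.norm_le hm h₀ h1) hCe
      linarith
    · refine ⟨hl, ?_, Or.inr rfl⟩
      by_contra! hcon
      have h1 := ShiftedSolution.shift_lt_of_parameter_lt hH h₀ hm hcon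
      have h2 := mul_le_mul_of_nonneg_left (ShiftedSolution.norm_le h₀ hm h1) hCe
      linarith
  induction h with
  | last hstep short =>
    obtain ⟨δ, lam, hs, h1, h2, h3⟩ := step hstep hl hr
    refine ⟨δ, lam, ?_, hs⟩
    have h4 := (abs_lt.1 short).2
    rw [abs_le]
    rcases h3 with rfl | rfl <;> constructor <;> linarith
  | more hstep long rest ih =>
    obtain ⟨δ, lam, hs, h1, h2, -⟩ := step hstep hl hr
    exact ih h1 h2

/-- The direction of the line search is an approximate cubic-regularized Newton step. -/
theorem IsLineSearchOutput.newton_step {L ε : ℝ} (hL : 0 ≤ L) (hH : IsSelfAdjoint H) (hε : 0 < ε)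
    {d : Vec n} (h : IsLineSearchOutput H g ((L + 4) / 3) ε (ε / (L + 4)) d) :
    ∃ (g' : Vec n) (lam : ℝ), ‖g' - g‖ ≤ ε ∧ H d + lam • d = -g' ∧
      0 ≤ ⟪H d, d⟫ + lam * ‖d‖ ^ 2 ∧
      |lam - (L + 4) / 3 * ‖d‖| ≤ ‖d‖ / 3 + ε / (L + 4) := by
  obtain ⟨g', l, r, hpert, ⟨δ₀, ⟨hl, hr⟩, μ, t, v, hpair, -, hroot⟩, hbis⟩ := h
  obtain ⟨hg', μ₀, u, hμ₀, hu, hHu, hgu⟩ := hpert.exists_eigenvector hε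
  have hsol : ∀ {δ μ t : ℝ} {v : Vec n}, IsLeftmostEigenpair H g' δ μ v t →
      ShiftedSolution H g' ε δ (-μ) (t⁻¹ • v) :=
    fun hp => hp.shiftedSolution hH hε hμ₀ hu hHu hgu
  obtain ⟨δ, lam, hδ, hs⟩ := hbis.exists_close hH (by positivity) hsol (hsol hpair) hroot hl hr
  -- The tolerance is `τ * ε` with `τ = 1 / (L + 4)`, so that the ratio `(L + 4) / 3` times the
  -- relative error `τ` is just `1 / 3`.
  have hτ : 1 / (L + 4) ≤ 1 := by rw [div_le_one (by positivity)]; linarith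
  obtain ⟨e1, e2⟩ := hs.close hH (hsol hpair) hε hτ (hδ.trans (le_of_eq (by ring)))
  obtain ⟨κ, hκ, -, hc⟩ := hs.coercive
  refine ⟨g', lam, hg', hs.equation, le_trans (by positivity) (hc d), ?_⟩
  have h3 := abs_norm_sub_norm_le d (t⁻¹ • v)
  have h4 : (L + 4) / 3 * |‖d‖ - ‖t⁻¹ • v‖| ≤ ‖d‖ / 3 := by
    calc (L + 4) / 3 * |‖d‖ - ‖t⁻¹ • v‖| ≤ (L + 4) / 3 * (1 / (L + 4) * ‖d‖) := by
          gcongr; exact h3.trans e2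
      _ = ‖d‖ / 3 := by field_simp
  calc |lam - (L + 4) / 3 * ‖d‖|
      = |(lam - -μ) - (L + 4) / 3 * (‖d‖ - ‖t⁻¹ • v‖)| := by rw [← hroot]; congr 1; ring
    _ ≤ |lam - -μ| + |(L + 4) / 3 * (‖d‖ - ‖t⁻¹ • v‖)| := abs_sub _ _
    _ = |lam - -μ| + (L + 4) / 3 * |‖d‖ - ‖t⁻¹ • v‖| := by
        rw [abs_mul, abs_of_nonneg (by positivity : 0 ≤ (L + 4) / 3)]
    _ ≤ 1 / (L + 4) * ε + ‖d‖ / 3 := add_le_add e1 h4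
    _ = _ := by ring

end Eigen

end SHSODM

namespace SHSODM

/-! ### Progress of one iteration. -/

section OneStep

variable {n : ℕ} {F : Vec n → ℝ} {L : ℝ}

/-- Young's inequality from `(D - a) ^ 2 * (D + 2 * a) ≥ 0`; the next lemma uses `(D - a) ^ 2 * (D +
a / 2) ≥ 0`. Each error term of the descent estimate may consume only `D ^ 3 / 8`. -/
theorem sq_mul_le_cube_add {s D : ℝ} (hs : 0 ≤ s) (hD : 0 ≤ D) :
    s ^ 2 * D ≤ D ^ 3 / 8 + 2 * s ^ 3 := by
  have h : 0 ≤ (D - 5 / 3 * s) ^ 2 * (D + 10 / 3 * s) := by positivity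
  have h1 : 0 ≤ s ^ 2 * D := by positivity
  have h2 : 0 ≤ s ^ 3 := by positivity
  nlinarith

theorem mul_sq_le_cube_add {h D : ℝ} (hh : 0 ≤ h) (hD : 0 ≤ D) :
    1 / 2 * (h * D ^ 2) ≤ D ^ 3 / 8 + 2 * h ^ 3 := by
  have h0 : 0 ≤ (D - 8 / 3 * h) ^ 2 * (D + 4 / 3 * h) := by positivity
  have h2 : 0 ≤ h ^ 3 := by positivity
  nlinarith

theorem rpow_three_halves_sq {s : ℝ} (hs : 0 ≤ s) : (s ^ 2) ^ (3 / 2 : ℝ) = s ^ 3 := by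
  rw [← Real.rpow_natCast s 2, ← Real.rpow_mul hs, ← Real.rpow_natCast s 3]
  norm_num

/-- Decrease of the function along an approximate cubic-regularized Newton step. -/
theorem descent (hF : LipschitzHessian F L) {x d g g' : Vec n} {H : Op n} {ε τ lam : ℝ}
    (hε : 0 ≤ ε) (hτ : 0 ≤ τ) (hg : ‖g' - g‖ ≤ ε)
    (heq : H d + lam • d = -g') (hpos : 0 ≤ ⟪H d, d⟫ + lam * ‖d‖ ^ 2)
    (hlam : |lam - (L + 4) / 3 * ‖d‖| ≤ ‖d‖ / 3 + τ) :
    F (x + d) + ‖d‖ ^ 3 / 4 ≤ F x + 2 * (‖g - gradient F x‖ + ε) ^ (3 / 2 : ℝ) +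
      2 * (‖H - hess F x‖ + τ) ^ 3 := by
  have h1 := (abs_le.1 (hF.abs_sub_le x d)).2
  set D := ‖d‖ with hD
  have hD0 : 0 ≤ D := norm_nonneg _
  set e := ‖g - gradient F x‖ with he
  set E := ‖H - hess F x‖ with hE
  have hgrad : ⟪gradient F x, d⟫ ≤ -(⟪H d, d⟫ + lam * D ^ 2) + (e + ε) * D := by
    have e1 : gradient F x = -(H d + lam • d) - ((g - gradient F x) + (g' - g)) := by
      rw [heq]; abel
    have e2 : -⟪(g - gradient F x) + (g' - g), d⟫ ≤ (e + ε) * D := by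
      have h3 := (abs_le.1 (abs_real_inner_le_norm ((g - gradient F x) + (g' - g)) d)).1
      have h4 : ‖(g - gradient F x) + (g' - g)‖ * ‖d‖ ≤ (e + ε) * D := by
        gcongr; exact (norm_add_le _ _).trans (by gcongr)
      linarith
    calc ⟪gradient F x, d⟫
        = -(⟪H d, d⟫ + lam * D ^ 2) + -⟪(g - gradient F x) + (g' - g), d⟫ := by
          conv_lhs => rw [e1]
          rw [inner_sub_left, inner_neg_left, inner_add_left, real_inner_smul_left,
            real_inner_self_eq_norm_sq]
          ring
      _ ≤ _ := by gcongr
  have hhess : ⟪hess F x d, d⟫ ≤ ⟪H d, d⟫ + E * D ^ 2 := by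
    have h3 := (abs_le.1 (abs_real_inner_le_norm ((H - hess F x) d) d)).1
    have h4 : ‖(H - hess F x) d‖ * ‖d‖ ≤ E * D * D := by
      gcongr; exact ContinuousLinearMap.le_opNorm _ _
    have h5 : ⟪(H - hess F x) d, d⟫ = ⟪H d, d⟫ - ⟪hess F x d, d⟫ := by
      rw [sub_apply, inner_sub_left]
    rw [h5] at h3
    nlinarith
  -- Half of `lam * D ^ 2` remains after using `hpos`. Its part `L / 6 * D ^ 3` cancels the Taylor
  -- remainder, leaving `D ^ 3 / 2`; the two Young inequalities take `D ^ 3 / 8` each, so `D ^ 3 /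
  -- 4` survives.
  have hl : (L + 3) / 3 * D - τ ≤ lam := by linarith [(abs_le.1 hlam).1]
  have hl2 : ((L + 3) / 3 * D - τ) * D ^ 2 ≤ lam * D ^ 2 := by gcongr
  set s := √(e + ε) with hs
  have hs2 : s ^ 2 = e + ε := Real.sq_sqrt (by positivity)
  have hy1 : (e + ε) * D ≤ D ^ 3 / 8 + 2 * (e + ε) ^ (3 / 2 : ℝ) := by
    rw [← hs2, rpow_three_halves_sq (Real.sqrt_nonneg _)]
    exact sq_mul_le_cube_add (Real.sqrt_nonneg _) hD0
  have hy2 := mul_sq_le_cube_add (h := E + τ) (by positivity) hD0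
  nlinarith

/-- Size of the gradient after an approximate cubic-regularized Newton step. -/
theorem norm_gradient_next_le (hF : LipschitzHessian F L) (hL : 0 ≤ L) {x d g g' : Vec n}
    {H : Op n} {ε τ lam : ℝ} (hg : ‖g' - g‖ ≤ ε)
    (heq : H d + lam • d = -g')
    (hlam : |lam - (L + 4) / 3 * ‖d‖| ≤ ‖d‖ / 3 + τ) :
    ‖gradient F (x + d)‖ ≤ (L + 3) * (‖d‖ ^ 2 + (‖g - gradient F x‖ + ε) +
      (‖H - hess F x‖ + τ) ^ 2) := by
  have hε : 0 ≤ ε := (norm_nonneg _).trans hg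
  have h1 := hF.norm_gradient_sub_le x d
  have e1 : gradient F (x + d) = (gradient F (x + d) - gradient F x - hess F x d) -
      ((g - gradient F x) + (g' - g)) - (H - hess F x) d - lam • d := by
    have : g' = -(H d + lam • d) := by rw [heq]; abel
    rw [this, sub_apply]
    abel
  set D := ‖d‖ with hD
  have hD0 : 0 ≤ D := norm_nonneg _
  set e := ‖g - gradient F x‖ with he
  set E := ‖H - hess F x‖ with hE
  have hE0 : 0 ≤ E := norm_nonneg _
  have he0 : 0 ≤ e := norm_nonneg _
  have h2 : ‖(g - gradient F x) + (g' - g)‖ ≤ e + ε := (norm_add_le _ _).trans (by gcongr)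
  have h3 : ‖(H - hess F x) d‖ ≤ E * D := ContinuousLinearMap.le_opNorm _ _
  have h4 : ‖lam • d‖ ≤ ((L + 5) / 3 * D + τ) * D := by
    rw [norm_smul, Real.norm_eq_abs]
    gcongr
    have h5 := abs_le.1 hlam
    have : 0 ≤ (L + 3) / 3 * D := by positivity
    rw [abs_le]
    constructor <;> linarith
  have h6 : ‖gradient F (x + d)‖ ≤ L / 2 * D ^ 2 + (e + ε) + E * D +
      ((L + 5) / 3 * D + τ) * D := by
    rw [e1]
    refine (norm_sub_le _ _).trans (add_le_add ?_ h4)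
    refine (norm_sub_le _ _).trans (add_le_add ?_ h3)
    exact (norm_sub_le _ _).trans (add_le_add h1 h2)
  have h7 : (E + τ) * D ≤ 1 / 2 * D ^ 2 + 1 / 2 * (E + τ) ^ 2 := by
    nlinarith [sq_nonneg (E + τ - D)]
  have h8 : 0 ≤ L * (e + ε) := by positivity
  have h9 : 0 ≤ L * (E + τ) ^ 2 := by positivity
  have h10 : 0 ≤ L * D ^ 2 := by positivity
  nlinarith [sq_nonneg D, sq_nonneg (E + τ)]

/-- The constant `c` of the one-step recursion. -/
noncomputable def stepConst (α C L : ℝ) : ℝ :=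
  (36 * (C ^ (3 / (2 * α)) * (L + 3) ^ (3 / 2 : ℝ)))⁻¹

theorem stepConst_pos {α C : ℝ} (hC : 0 < C) (hL : 0 ≤ L) : 0 < stepConst α C L := by
  unfold stepConst; positivity

/-- The size of the errors of one iteration, on the scale of the function values. -/
noncomputable def noise (F : Vec n → ℝ) (α ε τ : ℝ) (x g : Vec n) (H : Op n) : ℝ :=
  (‖g - gradient F x‖ + ε) ^ α + (‖H - hess F x‖ + τ) ^ (2 * α)

theorem noise_nonneg {α ε τ : ℝ} (hε : 0 ≤ ε) (hτ : 0 ≤ τ) (x g : Vec n) (H : Op n) :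
    0 ≤ noise F α ε τ x g H := by
  unfold noise; positivity

/-- The recursion satisfied by the suboptimality along one iteration. -/
theorem suboptimality_step {α C : ℝ} (hα : 1 ≤ α) (hC : 0 < C) (hgd : GradientDominated F α C)
    (hb : CoerciveBddBelow F) (hF : LipschitzHessian F L) (hL : 0 ≤ L) {x d g : Vec n} {H : Op n}
    {ε : ℝ} (hε : 0 < ε) (hH : IsSelfAdjoint H)
    (h : IsLineSearchOutput H g ((L + 4) / 3) ε (ε / (L + 4)) d) :
    (F (x + d) - infVal F) + stepConst α C L * (F (x + d) - infVal F) ^ (3 / (2 * α)) ≤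
      (F x - infVal F) + 6 * noise F α ε (ε / (L + 4)) x g H ^ (3 / (2 * α)) := by
  obtain ⟨g', lam, hg, heq, hpos, hlam⟩ := h.newton_step hL hH hε
  have hα0 : 0 < α := by linarith
  have hτ : 0 ≤ ε / (L + 4) := by positivity
  have hdesc := descent hF (x := x) hε.le hτ hg heq hpos hlam
  have hnext := norm_gradient_next_le hF hL (x := x) hg heq hlam
  set τ := ε / (L + 4) with hτdef
  set γ := ‖g - gradient F x‖ + ε with hγ
  set η := ‖H - hess F x‖ + τ with hη
  have hγ0 : 0 ≤ γ := by positivity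
  have hη0 : 0 ≤ η := by positivity
  set D := ‖d‖ with hD
  have hD0 : 0 ≤ D := norm_nonneg _
  set y := F (x + d) - infVal F with hy
  have hy0 : 0 ≤ y := sub_nonneg.2 (hb.infVal_le _)
  set p := 3 / (2 * α) with hp
  have hp0 : 0 < p := by positivity
  have hαp : α * p = 3 / 2 := by rw [hp]; field_simp
  set s := √γ with hs
  have hs0 : 0 ≤ s := Real.sqrt_nonneg _
  have hs2 : s ^ 2 = γ := Real.sq_sqrt hγ0
  have hγs : γ ^ (3 / 2 : ℝ) = s ^ 3 := by rw [← hs2, rpow_three_halves_sq hs0]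
  -- The quantities `D`, `s = √γ` and `η` have the same scale, and `9` is the power-mean constant
  -- for three cubes.
  have hcube : (D ^ 2 + γ + η ^ 2) ^ (3 / 2 : ℝ) ≤ 9 * (D ^ 3 + γ ^ (3 / 2 : ℝ) + η ^ 3) := by
    calc (D ^ 2 + γ + η ^ 2) ^ (3 / 2 : ℝ) ≤ ((D + s + η) ^ 2) ^ (3 / 2 : ℝ) := by
          apply Real.rpow_le_rpow (by positivity) _ (by norm_num)
          rw [← hs2]
          nlinarith [mul_nonneg hD0 hs0, mul_nonneg hD0 hη0, mul_nonneg hs0 hη0]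
      _ = (D + s + η) ^ 3 := rpow_three_halves_sq (by positivity)
      _ ≤ 9 * (D ^ 3 + s ^ 3 + η ^ 3) := by
          nlinarith [mul_nonneg (add_nonneg hD0 hs0) (sq_nonneg (D - s)),
            mul_nonneg (add_nonneg hD0 hη0) (sq_nonneg (D - η)),
            mul_nonneg (add_nonneg hs0 hη0) (sq_nonneg (s - η)),
            mul_nonneg hD0 (sq_nonneg (s - η)), mul_nonneg hs0 (sq_nonneg (D - η)),
            mul_nonneg hη0 (sq_nonneg (D - s))]
      _ = _ := by rw [hγs]
  set B := C ^ p * (L + 3) ^ (3 / 2 : ℝ) with hB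
  have hB0 : 0 < B := by positivity
  have hyp : y ^ p ≤ B * (9 * (D ^ 3 + γ ^ (3 / 2 : ℝ) + η ^ 3)) := by
    calc y ^ p ≤ (C * ‖gradient F (x + d)‖ ^ α) ^ p := Real.rpow_le_rpow hy0 (hgd _) hp0.le
      _ ≤ (C * ((L + 3) * (D ^ 2 + γ + η ^ 2)) ^ α) ^ p := by gcongr
      _ = B * (D ^ 2 + γ + η ^ 2) ^ (3 / 2 : ℝ) := by
          rw [Real.mul_rpow hC.le (by positivity), ← Real.rpow_mul (by positivity), hαp,
            Real.mul_rpow (by positivity) (by positivity), hB]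
          ring
      _ ≤ _ := by gcongr
  -- The `36` in `stepConst` is `9 * 4`: the term in `y ^ p` then costs no more than the decrease `D
  -- ^ 3 / 4`, plus errors.
  have hstep : stepConst α C L * y ^ p ≤ (D ^ 3 + γ ^ (3 / 2 : ℝ) + η ^ 3) / 4 := by
    unfold stepConst
    rw [← hp, ← hB, inv_mul_le_iff₀ (by positivity)]
    linarith
  have hN1 : γ ^ (3 / 2 : ℝ) ≤ noise F α ε τ x g H ^ p := by
    rw [← hαp, Real.rpow_mul hγ0]
    refine Real.rpow_le_rpow (by positivity) ?_ hp0.le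
    unfold noise
    exact le_add_of_nonneg_right (by positivity)
  have hN2 : η ^ 3 ≤ noise F α ε τ x g H ^ p := by
    have : η ^ 3 = (η ^ (2 * α)) ^ p := by
      rw [← Real.rpow_mul hη0, mul_assoc, hαp, ← Real.rpow_natCast]
      norm_num
    rw [this]
    refine Real.rpow_le_rpow (by positivity) ?_ hp0.le
    unfold noise
    exact le_add_of_nonneg_left (by positivity)
  have : 0 ≤ γ ^ (3 / 2 : ℝ) := by positivity
  have : 0 ≤ η ^ 3 := by positivity
  linarith

end OneStep

end SHSODM

namespace SHSODM

/-! ### The scalar recursion with a power-type contraction and jumps. -/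

section Recursion

/-- A majorant of the solution `y` of `y + c y ^ p = a`. -/
noncomputable def contraction (c p a : ℝ) : ℝ := a / (1 + c * a ^ (p - 1))

variable {c p : ℝ}

theorem contraction_nonneg (hc : 0 < c) {a : ℝ} (ha : 0 ≤ a) : 0 ≤ contraction c p a := by
  unfold contraction; positivity

theorem contraction_le_self (hc : 0 < c) {a : ℝ} (ha : 0 ≤ a) : contraction c p a ≤ a :=
  div_le_self ha (le_add_of_nonneg_right (by positivity))

theorem contraction_le_div (hc : 0 < c) (hp : p ≤ 1) {a R : ℝ} (ha : 0 ≤ a) (haR : a ≤ R) :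
    contraction c p a ≤ a / (1 + c * R ^ (p - 1)) := by
  unfold contraction
  -- Zero is split off because `0 ^ (p - 1)` is `0` when `p < 1`, which breaks the monotonicity of
  -- the power.
  rcases ha.eq_or_lt with rfl | ha
  · simp
  · have h1 : R ^ (p - 1) ≤ a ^ (p - 1) :=
      Real.rpow_le_rpow_of_nonpos ha haR (by linarith)
    have h2 : 0 ≤ R ^ (p - 1) := Real.rpow_nonneg (ha.le.trans haR) _
    gcongr

theorem contraction_mono (hc : 0 < c) (hp : p ≤ 1) {a b : ℝ} (ha : 0 ≤ a) (hab : a ≤ b) :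
    contraction c p a ≤ contraction c p b := by
  refine (contraction_le_div hc hp ha hab).trans ?_
  unfold contraction
  have : 0 ≤ b ^ (p - 1) := Real.rpow_nonneg (ha.trans hab) _
  gcongr

/-- Factor `y + c * y ^ p = y * (1 + c * y ^ (p - 1))`. As `y ≤ a` and `p - 1 ≤ 0`, replacing `y ^
(p - 1)` by `a ^ (p - 1)` only decreases it. -/
theorem le_contraction (hc : 0 < c) (hp : p ≤ 1) {a y : ℝ} (hy : 0 ≤ y)
    (h : y + c * y ^ p ≤ a) : y ≤ contraction c p a := by
  have hyp : 0 ≤ y ^ p := Real.rpow_nonneg hy _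
  have hya : y ≤ a := by nlinarith
  rcases hy.eq_or_lt with rfl | hy
  · exact contraction_nonneg hc hya
  · have ha : 0 < a := hy.trans_le hya
    unfold contraction
    rw [le_div_iff₀ (by positivity)]
    have h1 : a ^ (p - 1) ≤ y ^ (p - 1) :=
      Real.rpow_le_rpow_of_nonpos hy hya (by linarith)
    have h2 : y * y ^ (p - 1) = y ^ p := by
      rw [Real.rpow_sub_one hy.ne']; field_simp
    have h3 : y * (c * a ^ (p - 1)) ≤ c * y ^ p := by
      rw [← h2]
      calc y * (c * a ^ (p - 1)) ≤ y * (c * y ^ (p - 1)) := by gcongr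
        _ = _ := by ring
    linarith

theorem contraction_iterate_nonneg (hc : 0 < c) {r : ℝ} (hr : 0 ≤ r) (j : ℕ) :
    0 ≤ (contraction c p)^[j] r := by
  induction j with
  | zero => exact hr
  | succ j ih => rw [Function.iterate_succ_apply']; exact contraction_nonneg hc ih

theorem contraction_iterate_mono (hc : 0 < c) (hp : p ≤ 1) {r t : ℝ} (hr : 0 ≤ r) (hrt : r ≤ t)
    (j : ℕ) : (contraction c p)^[j] r ≤ (contraction c p)^[j] t := by
  induction j with
  | zero => exact hrt
  | succ j ih =>
    rw [Function.iterate_succ_apply', Function.iterate_succ_apply']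
    exact contraction_mono hc hp (contraction_iterate_nonneg hc hr j) ih

theorem contraction_iterate_le (hc : 0 < c) (hp : p ≤ 1) {r R : ℝ} (hr : 0 ≤ r) (hrR : r ≤ R)
    (j : ℕ) : (contraction c p)^[j] r ≤ r * ((1 + c * R ^ (p - 1)) ^ j)⁻¹ := by
  have hR : 0 ≤ R := hr.trans hrR
  induction j with
  | zero => simp
  | succ j ih =>
    rw [Function.iterate_succ_apply']
    have h1 : ((1 + c * R ^ (p - 1)) ^ j)⁻¹ ≤ 1 :=
      inv_le_one_of_one_le₀ (one_le_pow₀ (le_add_of_nonneg_right (by positivity)))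
    have h2 : (contraction c p)^[j] r ≤ R :=
      ih.trans ((mul_le_of_le_one_right hr h1).trans hrR)
    refine (contraction_le_div hc hp (contraction_iterate_nonneg hc hr j) h2).trans ?_
    rw [pow_succ, mul_inv, ← mul_assoc, ← div_eq_mul_inv _ (1 + _)]
    gcongr

/-- The iterates of the contraction decay at a summable rate. -/
theorem exists_summable_weights (hc : 0 < c) (hp : 1 / 2 ≤ p) (hp1 : p ≤ 1) :
    ∃ w : ℕ → ℝ, Summable w ∧ (∀ j, 0 ≤ w j) ∧
      ∀ j r, 0 ≤ r → (contraction c p)^[j] r ≤ w j * (r + r ^ (1 / p)) := by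
  have hp0 : 0 < p := by linarith
  have hgeo : Summable fun j : ℕ => ((1 + c) ^ j)⁻¹ := by
    simp_rw [← inv_pow]
    exact summable_geometric_of_lt_one (by positivity) (inv_lt_one_of_one_lt₀ (by linarith))
  have hsmall : ∀ j (r : ℝ), 0 ≤ r → r ≤ 1 → (contraction c p)^[j] r ≤ ((1 + c) ^ j)⁻¹ * r := by
    intro j r hr hr1
    have := contraction_iterate_le hc hp1 hr hr1 j
    rwa [Real.one_rpow, mul_one, mul_comm] at this
  -- At `p = 1` the polynomial rate below would not be summable, but then the rate is geometric at
  -- every scale.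
  rcases hp1.eq_or_lt with rfl | hp1'
  · refine ⟨fun j => ((1 + c) ^ j)⁻¹, hgeo, fun j => by positivity, fun j r hr => ?_⟩
    have := contraction_iterate_le hc le_rfl hr le_rfl j
    rw [sub_self, Real.rpow_zero, mul_one, mul_comm] at this
    refine this.trans ?_
    gcongr
    exact le_add_of_nonneg_right (by positivity)
  set q := 1 / p with hq
  have hq0 : 0 < q := by positivity
  have hq1 : 1 < q := by rw [hq, lt_div_iff₀ hp0]; linarith
  have hq2 : q ≤ 2 := by rw [hq, div_le_iff₀ hp0]; linarith
  have hpq : p * q = 1 := by rw [hq]; field_simp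
  set B := (1 + c) ^ 2 * (q / c) ^ q with hB
  refine ⟨fun j => ((1 + c) ^ j)⁻¹ + B * (((j + 2 : ℕ) : ℝ) ^ q)⁻¹, hgeo.add ?_,
    fun j => by positivity, fun j r hr => ?_⟩
  · exact Summable.mul_left _ ((summable_nat_add_iff 2).2 (Real.summable_nat_rpow_inv.2 hq1))
  have hrq : 0 ≤ r ^ q := by positivity
  rcases le_total r 1 with hr1 | hr1
  · calc _ ≤ ((1 + c) ^ j)⁻¹ * r := hsmall j r hr hr1
      _ ≤ _ := by
        gcongr
        · exact le_add_of_nonneg_right (by positivity)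
        · exact le_add_of_nonneg_right hrq
  -- For large `r` the factor `1 + x` per step may be close to `1`. Bernoulli gives `(1 + x) ^ (j +
  -- 2) ≥ (N * x / q) ^ q`, and `x ^ q` is a multiple of `r ^ (1 - q)`, so the loss is absorbed in
  -- `r ^ q` and the decay is `N ^ (-q)`. The shift by `2` makes the exponent `N / q` at least `1`,
  -- at the cost of `(1 + c) ^ 2`.
  · have hr0 : 0 < r := by linarith
    set x := c * r ^ (p - 1) with hx
    have hx0 : 0 < x := by positivity
    have hxc : x ≤ c := mul_le_of_le_one_right hc.le
      (Real.rpow_le_one_of_one_le_of_nonpos hr1 (by linarith))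
    set N : ℝ := ((j + 2 : ℕ) : ℝ) with hN
    have hN2 : 2 ≤ N := by rw [hN]; push_cast; linarith [(Nat.cast_nonneg j : (0 : ℝ) ≤ j)]
    have hbern : N / q * x ≤ (1 + x) ^ (N / q) := by
      have := one_add_mul_self_le_rpow_one_add (s := x) (by linarith) (p := N / q)
        (by rw [le_div_iff₀ hq0]; linarith)
      linarith
    have h1 : (N / q * x) ^ q ≤ (1 + x) ^ j * (1 + c) ^ 2 := by
      calc (N / q * x) ^ q ≤ ((1 + x) ^ (N / q)) ^ q :=
            Real.rpow_le_rpow (by positivity) hbern hq0.le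
        _ = (1 + x) ^ j * (1 + x) ^ 2 := by
            rw [← Real.rpow_mul (by positivity), div_mul_cancel₀ _ hq0.ne', hN,
              Real.rpow_natCast, pow_add]
        _ ≤ _ := by gcongr
    have hxq : x ^ q = c ^ q * (r * (r ^ q)⁻¹) := by
      rw [hx, Real.mul_rpow hc.le (by positivity), ← Real.rpow_mul hr, sub_mul, hpq, one_mul,
        Real.rpow_sub hr0, Real.rpow_one, div_eq_mul_inv]
    have h2 : r * ((1 + x) ^ j)⁻¹ ≤ B * (N ^ q)⁻¹ * r ^ q := by
      rw [Real.mul_rpow (by positivity) hx0.le, Real.div_rpow (by positivity) hq0.le, hxq] at h1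
      rw [hB, Real.div_rpow hq0.le hc.le]
      have e1 : 0 < N ^ q := by positivity
      have e2 : 0 < q ^ q := by positivity
      have e3 : 0 < c ^ q := by positivity
      have e4 : 0 < r ^ q := by positivity
      have e5 : 0 < (1 + x) ^ j := by positivity
      rw [← div_eq_mul_inv, div_le_iff₀ e5]
      have h3 := mul_le_mul_of_nonneg_right h1
        (by positivity : 0 ≤ q ^ q * r ^ q / (N ^ q * c ^ q))
      field_simp at h3 ⊢
      linarith
    calc _ ≤ r * ((1 + x) ^ j)⁻¹ := contraction_iterate_le hc hp1 hr le_rfl j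
      _ ≤ B * (N ^ q)⁻¹ * r ^ q := h2
      _ ≤ _ := by
        gcongr
        · exact le_add_of_nonneg_left (by positivity)
        · exact le_add_of_nonneg_left hr

/-- One step of the perturbed recursion: either the contraction acts, or the new value is
controlled by the noise. -/
theorem exists_jump_bound (hc : 0 < c) (hp : 0 < p) (hp1 : p ≤ 1) {C : ℝ} (hC : 0 ≤ C) :
    ∃ B > 0, ∀ a b y : ℝ, 0 ≤ a → 0 ≤ b → 0 ≤ y → y + 2 * c * y ^ p ≤ a + C * b ^ p →
      ∃ ν, 0 ≤ ν ∧ y ≤ max (contraction c p a) ν ∧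
        ν + ν ^ (1 / p) ≤ B * (b * (1 + a ^ (1 / p))) := by
  set q := 1 / p with hq
  have hq0 : 0 < q := by positivity
  have hq1 : 1 ≤ q := by rw [hq, le_div_iff₀ hp]; linarith
  have hpq : p * q = 1 := by rw [hq]; field_simp
  set C' := (C / c) ^ q with hC'
  have hC'0 : 0 ≤ C' := by positivity
  refine ⟨C' + C' ^ q + (1 + C + 2 ^ q * (1 + C ^ q)), by positivity, ?_⟩
  intro a b y ha hb hy h
  have haq : 0 ≤ a ^ q := by positivity
  -- For `b < 1`, either half of `2 * c * y ^ p` absorbs the noise and the other half contracts, or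
  -- `y ≤ C' * b`. For `b ≥ 1` the trivial bound `y ≤ a + C * b ^ p` suffices, because `b` itself
  -- then pays for the power `a ^ q`.
  rcases lt_or_ge b 1 with hb1 | hb1
  · refine ⟨C' * b, by positivity, ?_, ?_⟩
    · rcases le_or_gt (C * b ^ p) (c * y ^ p) with h1 | h1
      · exact le_max_of_le_left (le_contraction hc hp1 hy (by linarith))
      · refine le_max_of_le_right ?_
        have h2 : y ^ p ≤ C / c * b ^ p := by
          rw [div_mul_eq_mul_div, le_div_iff₀ hc]; linarith
        calc y = (y ^ p) ^ q := by rw [← Real.rpow_mul hy, hpq, Real.rpow_one]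
          _ ≤ (C / c * b ^ p) ^ q := Real.rpow_le_rpow (by positivity) h2 hq0.le
          _ = C' * b := by
            rw [Real.mul_rpow (by positivity) (by positivity), ← Real.rpow_mul hb, hpq,
              Real.rpow_one]
    · have h1 : b ^ q ≤ b := by
        simpa using Real.rpow_le_rpow_of_exponent_ge' hb hb1.le zero_le_one hq1
      have h2 : b ≤ b * (1 + a ^ q) := le_mul_of_one_le_right hb (by linarith)
      calc C' * b + (C' * b) ^ q = C' * b + C' ^ q * b ^ q := by rw [Real.mul_rpow hC'0 hb]
        _ ≤ (C' + C' ^ q) * b := by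
          rw [add_mul]; gcongr
        _ ≤ (C' + C' ^ q) * (b * (1 + a ^ q)) := by gcongr
        _ ≤ _ := mul_le_mul_of_nonneg_right
          (le_add_of_nonneg_right (by positivity)) (by positivity)
  · have hbp : b ^ p ≤ b := by
      simpa using Real.rpow_le_rpow_of_exponent_le hb1 hp1
    refine ⟨a + C * b ^ p, by positivity, le_max_of_le_right ?_, ?_⟩
    · have : 0 ≤ 2 * c * y ^ p := by positivity
      linarith
    · set X := b * (1 + a ^ q) with hX
      have hX1 : a ^ q ≤ X := by nlinarith
      have hX2 : b ≤ X := le_mul_of_one_le_right hb (by linarith)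
      have hX0 : 0 ≤ X := hb.trans hX2
      have ha1 : a ≤ X := by
        have : a ≤ 1 + a ^ q := by
          rcases le_total a 1 with h1 | h1
          · linarith
          · have := Real.rpow_le_rpow_of_exponent_le h1 hq1
            rw [Real.rpow_one] at this
            linarith
        nlinarith
      have h1 : a + C * b ^ p ≤ (1 + C) * X := by
        calc a + C * b ^ p ≤ X + C * X := by gcongr; exact hbp.trans hX2
          _ = _ := by ring
      have h2 : (a + C * b ^ p) ^ q ≤ 2 ^ q * (1 + C ^ q) * X := by
        have hm : a + C * b ^ p ≤ 2 * max a (C * b ^ p) := by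
          linarith [le_max_left a (C * b ^ p), le_max_right a (C * b ^ p)]
        have h3 : (max a (C * b ^ p)) ^ q ≤ a ^ q + C ^ q * b := by
          rcases max_cases a (C * b ^ p) with ⟨e, -⟩ | ⟨e, -⟩
          · rw [e]; exact le_add_of_nonneg_right (by positivity)
          · rw [e, Real.mul_rpow hC (by positivity), ← Real.rpow_mul hb, hpq, Real.rpow_one]
            exact le_add_of_nonneg_left haq
        calc (a + C * b ^ p) ^ q ≤ (2 * max a (C * b ^ p)) ^ q :=
              Real.rpow_le_rpow (by positivity) hm hq0.le
          _ = 2 ^ q * (max a (C * b ^ p)) ^ q :=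
              Real.mul_rpow (by norm_num) (le_max_of_le_left ha)
          _ ≤ 2 ^ q * (X + C ^ q * X) := by
              gcongr
              refine h3.trans ?_
              gcongr
          _ = _ := by ring
      calc _ ≤ (1 + C) * X + 2 ^ q * (1 + C ^ q) * X := add_le_add h1 h2
        _ = (1 + C + 2 ^ q * (1 + C ^ q)) * X := by ring
        _ ≤ _ := mul_le_mul_of_nonneg_right
          (le_add_of_nonneg_left (by positivity)) hX0

/-- Iterates of the monotone contraction commute with the maximum, so no subadditivity is needed;
the maximum is then bounded by the sum. The additional `j` iterations make the induction on `k`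
close: a jump at time `i` is contracted during the remaining `k - 1 - i` steps. -/
theorem iterate_le_of_step_le_max (hc : 0 < c) (hp : p ≤ 1) {a ν : ℕ → ℝ} (ha : ∀ i, 0 ≤ a i)
    (hν : ∀ i, 0 ≤ ν i) (k : ℕ) (hstep : ∀ i < k, a (i + 1) ≤ max (contraction c p (a i)) (ν i))
    (j : ℕ) : (contraction c p)^[j] (a k) ≤ (contraction c p)^[j + k] (a 0) +
      ∑ i ∈ Finset.range k, (contraction c p)^[j + (k - 1 - i)] (ν i) := by
  induction k generalizing j with
  | zero => simp
  | succ k ih =>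
    have hs : 0 ≤ ∑ i ∈ Finset.range k, (contraction c p)^[j + (k + 1 - 1 - i)] (ν i) :=
      Finset.sum_nonneg fun i _ => contraction_iterate_nonneg hc (hν i) _
    have h1 := contraction_iterate_mono hc hp (ha _) (hstep k (Nat.lt_succ_self k)) j
    rw [Finset.sum_range_succ]
    refine h1.trans ?_
    have e0 := contraction_iterate_nonneg (p := p) hc (ha 0) (j + (k + 1))
    have e1 := contraction_iterate_nonneg (p := p) hc (hν k) (j + (k + 1 - 1 - k))
    rcases max_cases (contraction c p (a k)) (ν k) with ⟨e, -⟩ | ⟨e, -⟩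
    · rw [e, ← Function.iterate_succ_apply]
      have h2 := ih (fun i hi => hstep i (Nat.lt_succ_of_lt hi)) (j + 1)
      have h3 : ∑ i ∈ Finset.range k, (contraction c p)^[j + 1 + (k - 1 - i)] (ν i) =
          ∑ i ∈ Finset.range k, (contraction c p)^[j + (k + 1 - 1 - i)] (ν i) := by
        refine Finset.sum_congr rfl fun i hi => ?_
        have := Finset.mem_range.1 hi
        rw [show j + 1 + (k - 1 - i) = j + (k + 1 - 1 - i) by omega]
      rw [h3, show j + 1 + k = j + (k + 1) by omega] at h2
      linarith
    · rw [e, show j + (k + 1 - 1 - k) = j by omega] at *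
      linarith

/-- Linear rate when `p = 1`. -/
theorem exists_iterations_of_eq_one (hc : 0 < c) {Δ : ℝ} (hΔ : 0 ≤ Δ) :
    ∃ A > 0, ∃ ε₁ ∈ Set.Ioo (0 : ℝ) 1, ∀ ε ∈ Set.Ioo 0 ε₁, ∃ K : ℕ,
      (K : ℝ) ≤ A * Real.log (1 / ε) ∧ (contraction c 1)^[K] Δ ≤ ε / 2 := by
  have hlc : 0 < Real.log (1 + c) := Real.log_pos (by linarith)
  -- Small `ε` makes `log (1 / ε) ≥ 1`, which absorbs the rounding, and `log (2 * (Δ + 1)) ≤ log (1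
  -- / ε)`, which absorbs the initial gap.
  refine ⟨2 / Real.log (1 + c) + 1, by positivity,
    min (Real.exp (-1)) (2 * (Δ + 1))⁻¹, ⟨by positivity, ?_⟩, ?_⟩
  · exact (min_le_left _ _).trans_lt (by rw [Real.exp_lt_one_iff]; norm_num)
  rintro ε ⟨hε, hε1⟩
  have h1 : ε < Real.exp (-1) := hε1.trans_le (min_le_left _ _)
  have h2 : ε < (2 * (Δ + 1))⁻¹ := hε1.trans_le (min_le_right _ _)
  have hl1 : 1 ≤ Real.log (1 / ε) := by
    rw [one_div, Real.log_inv]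
    have := Real.log_lt_log hε h1
    rw [Real.log_exp] at this
    linarith
  set X := Real.log (2 * (Δ + 1) / ε) with hX
  have hX2 : X ≤ 2 * Real.log (1 / ε) := by
    have h3 : Real.log (2 * (Δ + 1)) ≤ Real.log (1 / ε) := by
      apply Real.log_le_log (by positivity)
      rw [le_div_iff₀ hε]
      have := (lt_inv_comm₀ hε (by positivity)).1 h2
      rw [inv_eq_one_div, lt_div_iff₀ hε] at this
      exact this.le
    rw [hX, div_eq_mul_one_div, Real.log_mul (by positivity) (by positivity)]
    linarith
  refine ⟨⌈2 * Real.log (1 / ε) / Real.log (1 + c)⌉₊, ?_, ?_⟩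
  · refine (Nat.ceil_lt_add_one (by positivity)).le.trans ?_
    rw [add_mul, div_mul_eq_mul_div]
    linarith
  · set K := ⌈2 * Real.log (1 / ε) / Real.log (1 + c)⌉₊ with hK
    have h3 := contraction_iterate_le hc le_rfl hΔ le_rfl K (p := 1)
    rw [sub_self, Real.rpow_zero, mul_one] at h3
    have h4 : X ≤ K * Real.log (1 + c) := by
      refine hX2.trans ?_
      rw [← div_le_iff₀ hlc]
      exact Nat.le_ceil _
    rw [← Real.log_pow, hX, Real.log_le_log_iff (by positivity) (by positivity),
      div_le_iff₀ hε] at h4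
    refine h3.trans ?_
    rw [← div_eq_mul_inv, div_le_iff₀ (by positivity)]
    linarith

/-- Superlinear rate when `p < 1`. -/
theorem exists_iterations_of_lt_one (hc : 0 < c) (hp : 0 < p) (hp1 : p < 1) {Δ : ℝ} (hΔ : 0 ≤ Δ) :
    ∃ A > 0, ∃ ε₁ ∈ Set.Ioo (0 : ℝ) 1, ∀ ε ∈ Set.Ioo 0 ε₁, 1 ≤ Real.log (Real.log (1 / ε)) ∧
      ∃ K : ℕ, (K : ℝ) ≤ A * Real.log (Real.log (1 / ε)) ∧ (contraction c p)^[K] Δ ≤ ε / 2 := by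
  set s := 1 - p with hs
  have hs0 : 0 < s := by linarith
  -- The scale at which `c * a ^ (p - 1) = 1`. In units of `ρ` the contraction sends `E` below `E ^
  -- (1 + s)`, so below `ρ / e` the exponent is multiplied by `1 + s` at each step; reaching that
  -- region takes `k` steps, independently of `ε`.
  set ρ := c ^ (1 / s) with hρ
  have hρ0 : 0 < ρ := by positivity
  have hρs : ρ ^ s = c := by
    rw [hρ, ← Real.rpow_mul hc.le, one_div_mul_cancel hs0.ne', Real.rpow_one]
  obtain ⟨k, hk⟩ : ∃ k, (contraction c p)^[k] Δ ≤ ρ * Real.exp (-1) := by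
    -- The radius is `Δ + 1` because at `Δ = 0` the power `0 ^ (p - 1)` is `0` and `B` would be `1`.
    set B := 1 + c * (Δ + 1) ^ (p - 1) with hB
    have hB1 : 1 < B := lt_add_of_pos_right _ (by positivity)
    obtain ⟨k, hk⟩ := pow_unbounded_of_one_lt (Δ / (ρ * Real.exp (-1))) hB1
    refine ⟨k, (contraction_iterate_le hc hp1.le hΔ (by linarith : Δ ≤ Δ + 1) k).trans ?_⟩
    rw [← div_eq_mul_inv, div_le_iff₀ (by positivity)]
    rw [div_lt_iff₀ (by positivity)] at hk
    linarith
  have hsuper : ∀ m : ℕ, (contraction c p)^[m + k] Δ ≤ ρ * Real.exp (-(1 + s) ^ m) := by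
    intro m
    induction m with
    | zero => simpa using hk
    | succ m ih =>
      rw [show m + 1 + k = (m + k) + 1 by omega, Function.iterate_succ_apply']
      refine (contraction_mono hc hp1.le (contraction_iterate_nonneg hc hΔ _) ih).trans ?_
      set E := Real.exp (-(1 + s) ^ m) with hE
      have hE0 : 0 < E := Real.exp_pos _
      have h1 : c * (ρ * E) ^ (p - 1) = E ^ (-s) := by
        rw [show p - 1 = -s by rw [hs]; ring, Real.mul_rpow hρ0.le hE0.le, Real.rpow_neg hρ0.le,
          hρs, ← mul_assoc, mul_inv_cancel₀ hc.ne', one_mul]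
      have h2 : Real.exp (-(1 + s) ^ (m + 1)) = E * (E ^ (-s))⁻¹ := by
        rw [← Real.rpow_neg hE0.le, neg_neg, hE, ← Real.exp_mul, ← Real.exp_add]
        congr 1; ring
      unfold contraction
      rw [h1, h2, ← mul_assoc, ← div_eq_mul_inv]
      have : 0 < E ^ (-s) := by positivity
      gcongr
      linarith
  have hls : 0 < Real.log (1 + s) := Real.log_pos (by linarith)
  refine ⟨2 / Real.log (1 + s) + 1 + k, by positivity,
    min (Real.exp (-Real.exp 1)) (2 * ρ)⁻¹, ⟨by positivity, ?_⟩, ?_⟩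
  · exact (min_le_left _ _).trans_lt (by rw [Real.exp_lt_one_iff, neg_lt_zero]; positivity)
  rintro ε ⟨hε, hε1⟩
  have h1 : ε < Real.exp (-Real.exp 1) := hε1.trans_le (min_le_left _ _)
  have h2 : ε < (2 * ρ)⁻¹ := hε1.trans_le (min_le_right _ _)
  have hl0 : Real.exp 1 ≤ Real.log (1 / ε) := by
    rw [one_div, Real.log_inv]
    have := Real.log_lt_log hε h1
    rw [Real.log_exp] at this
    linarith
  have hlpos : 0 < Real.log (1 / ε) := (Real.exp_pos 1).trans_le hl0
  have hl1 : 1 ≤ Real.log (Real.log (1 / ε)) := by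
    rwa [Real.le_log_iff_exp_le hlpos]
  refine ⟨hl1, ⌈2 * Real.log (Real.log (1 / ε)) / Real.log (1 + s)⌉₊ + k, ?_, ?_⟩
  · push_cast
    have h3 : (⌈2 * Real.log (Real.log (1 / ε)) / Real.log (1 + s)⌉₊ : ℝ) ≤
      2 * Real.log (Real.log (1 / ε)) / Real.log (1 + s) + 1 :=
      (Nat.ceil_lt_add_one (by positivity)).le
    have h4 : (k : ℝ) ≤ k * Real.log (Real.log (1 / ε)) :=
      le_mul_of_one_le_right (Nat.cast_nonneg k) hl1
    rw [add_mul, add_mul, div_mul_eq_mul_div]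
    linarith
  · set m := ⌈2 * Real.log (Real.log (1 / ε)) / Real.log (1 + s)⌉₊ with hm
    refine (hsuper m).trans ?_
    have h3 : 2 * Real.log (Real.log (1 / ε)) ≤ m * Real.log (1 + s) := by
      rw [← div_le_iff₀ hls]
      exact Nat.le_ceil _
    -- The factor `2` in `m` gives `(1 + s) ^ m ≥ log (1 / ε) ^ 2`, and this dominates `2 * log (1 /
    -- ε)`, hence also `log (2 * ρ / ε)`.
    have h4 : Real.log (2 * Real.log (1 / ε)) ≤ 2 * Real.log (Real.log (1 / ε)) := by
      rw [Real.log_mul two_ne_zero hlpos.ne']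
      have : Real.log 2 ≤ 1 := by linarith [Real.log_two_lt_d9]
      linarith
    have h5 : 2 * Real.log (1 / ε) ≤ (1 + s) ^ m := by
      have := h4.trans h3
      rwa [← Real.log_pow, Real.log_le_log_iff (by positivity) (by positivity)] at this
    have h6 : Real.log (2 * ρ / ε) ≤ 2 * Real.log (1 / ε) := by
      have h7 : Real.log (2 * ρ) ≤ Real.log (1 / ε) := by
        apply Real.log_le_log (by positivity)
        rw [le_div_iff₀ hε]
        have := (lt_inv_comm₀ hε (by positivity)).1 h2
        rw [inv_eq_one_div, lt_div_iff₀ hε] at this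
        exact this.le
      rw [div_eq_mul_one_div, Real.log_mul (by positivity) (by positivity)]
      linarith
    have h8 : Real.exp (-(1 + s) ^ m) ≤ ε / (2 * ρ) := by
      rw [← Real.le_log_iff_exp_le (by positivity), ← inv_div, Real.log_inv]
      linarith
    calc ρ * Real.exp (-(1 + s) ^ m) ≤ ρ * (ε / (2 * ρ)) := by gcongr
      _ = ε / 2 := by field_simp

end Recursion

end SHSODM

namespace SHSODM

/-! ### Moments of averages of independent centred variables. -/

section Moments

/-- Bernoulli for the exponent `r - 1` in `[0, 1]`, multiplied by `1 + t`. -/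
theorem rpow_one_add_le {t r : ℝ} (ht : -1 ≤ t) (hr : 1 ≤ r) (hr2 : r ≤ 2) :
    (1 + t) ^ r ≤ 1 + r * t + (r - 1) * t ^ 2 := by
  have h0 : 0 ≤ 1 + t := by linarith
  have h1 := rpow_one_add_le_one_add_mul_self ht (p := r - 1) (by linarith) (by linarith)
  have h2 : (1 + t) ^ r = (1 + t) ^ (r - 1) * (1 + t) := by
    rcases h0.eq_or_lt with h | h
    · rw [← h, Real.zero_rpow (by linarith), mul_zero]
    · rw [Real.rpow_sub_one h.ne']; field_simp
  rw [h2]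
  nlinarith [mul_le_mul_of_nonneg_right h1 h0]

/-- Second-order expansion of `t ↦ |t| ^ (2 r)`. -/
theorem sq_add_rpow_le {r : ℝ} (hr : 1 ≤ r) (hr2 : r ≤ 2) (s x : ℝ) :
    ((s + x) ^ 2) ^ r ≤ (s ^ 2) ^ r + 2 * r * ((s ^ 2) ^ (r - 1) * s * x) +
      25 * ((s ^ 2) ^ (r - 1) * x ^ 2 + (x ^ 2) ^ r) := by
  have hx0 : 0 ≤ (x ^ 2) ^ r := by positivity
  have hs0 : 0 ≤ (s ^ 2) ^ (r - 1) := by positivity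
  -- For `|x| ≤ |s|` the square is `A * (1 + t)` and the one-variable expansion applies. Otherwise
  -- everything is comparable with `(x ^ 2) ^ r`: the left side costs `16` and the cross term at
  -- most `4`.
  rcases le_or_gt (x ^ 2) (s ^ 2) with hle | hlt
  · rcases eq_or_ne s 0 with rfl | hs
    · have : x = 0 := by nlinarith
      subst this
      simp [Real.zero_rpow (by linarith : r ≠ 0)]
    · have hA : 0 < s ^ 2 := by positivity
      set A := s ^ 2 with hAdef
      have hAr : A ^ r = A ^ (r - 1) * A := by
        rw [Real.rpow_sub_one hA.ne']; field_simp
      set t := (2 * s * x + x ^ 2) / A with ht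
      have hAt : A * t = 2 * s * x + x ^ 2 := by rw [ht]; field_simp
      have h1t : (s + x) ^ 2 = A * (1 + t) := by rw [mul_add, hAt, hAdef]; ring
      have ht1 : 0 ≤ 1 + t := by
        have : 0 ≤ A * (1 + t) := by rw [← h1t]; positivity
        exact nonneg_of_mul_nonneg_right this hA
      have h2 : A * t ^ 2 ≤ 9 * x ^ 2 := by
        have h3 : (2 * s + x) ^ 2 ≤ 9 * A := by
          nlinarith [sq_nonneg (s - x)]
        have h4 : A * (A * t ^ 2) ≤ A * (9 * x ^ 2) := by
          calc A * (A * t ^ 2) = (A * t) ^ 2 := by ring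
            _ = x ^ 2 * (2 * s + x) ^ 2 := by rw [hAt]; ring
            _ ≤ x ^ 2 * (9 * A) := by gcongr
            _ = _ := by ring
        exact le_of_mul_le_mul_left h4 hA
      have h5 := rpow_one_add_le (by linarith : -1 ≤ t) hr hr2
      calc ((s + x) ^ 2) ^ r = A ^ (r - 1) * (A * (1 + t) ^ r) := by
            rw [h1t, Real.mul_rpow hA.le ht1, hAr]; ring
        _ ≤ A ^ (r - 1) * (A * (1 + r * t + (r - 1) * t ^ 2)) := by gcongr
        _ = A ^ (r - 1) * (A + r * (A * t) + (r - 1) * (A * t ^ 2)) := by ring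
        _ ≤ A ^ (r - 1) * (A + r * (2 * s * x + x ^ 2) + 1 * (9 * x ^ 2)) := by
            rw [hAt]
            refine mul_le_mul_of_nonneg_left ?_ hs0
            have : 0 ≤ A * t ^ 2 := by positivity
            nlinarith
        _ ≤ A ^ (r - 1) * (A + 2 * r * (s * x) + 25 * x ^ 2) := by
            refine mul_le_mul_of_nonneg_left ?_ hs0
            nlinarith [sq_nonneg x]
        _ ≤ A ^ (r - 1) * A + 2 * r * (A ^ (r - 1) * s * x) +
            25 * (A ^ (r - 1) * x ^ 2 + (x ^ 2) ^ r) := by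
            nlinarith
        _ = _ := by rw [hAr]
  · have hX : 0 < x ^ 2 := (sq_nonneg s).trans_lt hlt
    have h1 : ((s + x) ^ 2) ^ r ≤ 16 * (x ^ 2) ^ r := by
      calc ((s + x) ^ 2) ^ r ≤ (4 * x ^ 2) ^ r := by
            refine Real.rpow_le_rpow (by positivity) ?_ (by linarith)
            nlinarith [sq_nonneg (s - x)]
        _ = 4 ^ r * (x ^ 2) ^ r := Real.mul_rpow (by norm_num) hX.le
        _ ≤ 4 ^ (2 : ℝ) * (x ^ 2) ^ r := by
            gcongr
            norm_num
        _ = _ := by norm_num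
    have h2 : -(x ^ 2) ^ r ≤ (s ^ 2) ^ (r - 1) * s * x := by
      have h3 : (s ^ 2) ^ (r - 1) ≤ (x ^ 2) ^ (r - 1) :=
        Real.rpow_le_rpow (sq_nonneg s) hlt.le (by linarith)
      have hx : x ≠ 0 := by rintro rfl; simp at hX
      have h4 : (x ^ 2) ^ r = (x ^ 2) ^ (r - 1) * x ^ 2 := by
        rw [Real.rpow_sub_one hX.ne']; field_simp
      have h5 : -(x ^ 2) ≤ s * x := by nlinarith [sq_nonneg (s + x), sq_nonneg (s - x)]
      have h6 : (s ^ 2) ^ (r - 1) * x ^ 2 ≤ (x ^ 2) ^ (r - 1) * x ^ 2 := by gcongr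
      have h7 := mul_le_mul_of_nonneg_left h5 hs0
      rw [h4]
      linarith
    have h3 : 0 ≤ (s ^ 2) ^ r := by positivity
    have h4 : 0 ≤ (s ^ 2) ^ (r - 1) * x ^ 2 := by positivity
    nlinarith

variable {Ω : Type*} [MeasurableSpace Ω] {P : Measure Ω} [IsProbabilityMeasure P]

theorem rpow_le_one_add_rpow {t a b : ℝ} (ht : 0 ≤ t) (ha : 0 ≤ a) (hab : a ≤ b) :
    t ^ a ≤ 1 + t ^ b := by
  rcases le_total t 1 with h | h
  · have := Real.rpow_le_one ht h ha
    have : 0 ≤ t ^ b := by positivity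
    linarith
  · linarith [Real.rpow_le_rpow_of_exponent_le h hab]

theorem sq_rpow_le_one_add {r : ℝ} (u : ℝ) {e : ℝ} (he : 0 ≤ e) (her : e ≤ r) :
    (u ^ 2) ^ e ≤ 1 + (u ^ 2) ^ r := rpow_le_one_add_rpow (sq_nonneg u) he her

theorem _root_.MeasureTheory.Integrable.sq_rpow_of_le {X : Ω → ℝ} {r e : ℝ} (hX : Measurable X)
    (h : Integrable (fun ω => (X ω ^ 2) ^ r) P) (he : 0 ≤ e) (her : e ≤ r) :
    Integrable (fun ω => (X ω ^ 2) ^ e) P := by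
  refine ((integrable_const (1 : ℝ)).add h).mono' (by fun_prop) (Filter.Eventually.of_forall ?_)
  intro ω
  rw [Real.norm_of_nonneg (by positivity)]
  exact sq_rpow_le_one_add (X ω) he her

/-- Adding an independent centred variable to a sum. -/
theorem moment_add_le {r V N : ℝ} (hr : 1 ≤ r) (hr2 : r ≤ 2) (hV : 1 ≤ V) (hN : 1 ≤ N)
    {S X : Ω → ℝ} (hS : Measurable S) (hX : Measurable X) (hind : IndepFun S X P)
    (hSi : Integrable (fun ω => (S ω ^ 2) ^ r) P) (hXi : Integrable (fun ω => (X ω ^ 2) ^ r) P)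
    (hX0 : ∫ ω, X ω ∂P = 0) (hXV : ∫ ω, (X ω ^ 2) ^ r ∂P ≤ V) :
    Integrable (fun ω => ((S ω + X ω) ^ 2) ^ r) P ∧
    ∫ ω, ((S ω + X ω) ^ 2) ^ r ∂P ≤
      (1 + 50 * V / N) * ∫ ω, (S ω ^ 2) ^ r ∂P + 75 * V * N ^ (r - 1) := by
  have hr0 : 0 < r := by linarith
  have hX2 : Integrable (fun ω => X ω ^ 2) P := by
    simpa using hXi.sq_rpow_of_le hX zero_le_one hr
  have hX1 : Integrable X P := by
    refine ((integrable_const (1 : ℝ)).add hX2).mono' (by fun_prop)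
      (Filter.Eventually.of_forall fun ω => ?_)
    rw [Real.norm_eq_abs]
    simp only [Pi.add_apply]
    nlinarith [sq_abs (X ω), sq_nonneg (|X ω| - 1)]
  have hSr : Integrable (fun ω => (S ω ^ 2) ^ (r - 1)) P :=
    hSi.sq_rpow_of_le hS (by linarith) (by linarith)
  have hST : Integrable (fun ω => (S ω ^ 2) ^ (r - 1) * S ω) P := by
    refine ((integrable_const (1 : ℝ)).add hSi).mono' (by fun_prop)
      (Filter.Eventually.of_forall fun ω => ?_)
    simp only [Pi.add_apply]
    have h1 : ‖(S ω ^ 2) ^ (r - 1) * S ω‖ = (S ω ^ 2) ^ (r - 1 / 2) := by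
      have hab : |S ω| = (S ω ^ 2) ^ (1 / 2 : ℝ) := by rw [← Real.sqrt_eq_rpow, Real.sqrt_sq_eq_abs]
      rw [norm_mul, Real.norm_of_nonneg (by positivity), Real.norm_eq_abs]
      rcases eq_or_ne (S ω) 0 with h | h
      · rw [h, abs_zero, mul_zero, zero_pow two_ne_zero, Real.zero_rpow (by linarith)]
      · rw [hab, ← Real.rpow_add (by positivity)]
        congr 1; ring
    rw [h1]
    exact sq_rpow_le_one_add (S ω) (by linarith) (by linarith)
  have hi1 : IndepFun (fun ω => (S ω ^ 2) ^ (r - 1) * S ω) X P :=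
    hind.comp (φ := fun u : ℝ => (u ^ 2) ^ (r - 1) * u) (ψ := id) (by fun_prop) measurable_id
  have hi2 : IndepFun (fun ω => (S ω ^ 2) ^ (r - 1)) (fun ω => X ω ^ 2) P :=
    hind.comp (φ := fun u : ℝ => (u ^ 2) ^ (r - 1)) (ψ := fun u : ℝ => u ^ 2) (by fun_prop)
      (by fun_prop)
  have hcross : Integrable (fun ω => (S ω ^ 2) ^ (r - 1) * S ω * X ω) P :=
    hi1.integrable_mul hST hX1
  have hcross0 : ∫ ω, (S ω ^ 2) ^ (r - 1) * S ω * X ω ∂P = 0 := by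
    rw [hi1.integral_fun_mul_eq_mul_integral hST.aestronglyMeasurable hX1.aestronglyMeasurable,
      hX0, mul_zero]
  have hquad : Integrable (fun ω => (S ω ^ 2) ^ (r - 1) * X ω ^ 2) P :=
    hi2.integrable_mul hSr hX2
  have hquadE : ∫ ω, (S ω ^ 2) ^ (r - 1) * X ω ^ 2 ∂P =
      (∫ ω, (S ω ^ 2) ^ (r - 1) ∂P) * ∫ ω, X ω ^ 2 ∂P :=
    hi2.integral_fun_mul_eq_mul_integral hSr.aestronglyMeasurable hX2.aestronglyMeasurable
  have hA : Integrable (fun ω => (S ω ^ 2) ^ r + 2 * r * ((S ω ^ 2) ^ (r - 1) * S ω * X ω)) P :=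
    hSi.add (hcross.const_mul _)
  have hB : Integrable (fun ω => (S ω ^ 2) ^ (r - 1) * X ω ^ 2 + (X ω ^ 2) ^ r) P := hquad.add hXi
  have hmaj : Integrable (fun ω => (S ω ^ 2) ^ r + 2 * r * ((S ω ^ 2) ^ (r - 1) * S ω * X ω) +
      25 * ((S ω ^ 2) ^ (r - 1) * X ω ^ 2 + (X ω ^ 2) ^ r)) P :=
    hA.add (hB.const_mul _)
  have hint : Integrable (fun ω => ((S ω + X ω) ^ 2) ^ r) P := by
    refine hmaj.mono' (((hS.add hX).pow_const 2).pow_const r).aestronglyMeasurable (Filter.Eventually.of_forall fun ω => ?_)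
    rw [Real.norm_of_nonneg (by positivity)]
    exact sq_add_rpow_le hr hr2 (S ω) (X ω)
  refine ⟨hint, (integral_mono hint hmaj fun ω => sq_add_rpow_le hr hr2 (S ω) (X ω)).trans ?_⟩
  rw [integral_add hA (hB.const_mul _),
    integral_add hSi (hcross.const_mul _), integral_const_mul, integral_const_mul, hcross0,
    integral_add hquad hXi, hquadE]
  set M := ∫ ω, (S ω ^ 2) ^ r ∂P with hM
  have hM0 : 0 ≤ M := integral_nonneg fun ω => by positivity
  have hEX2 : ∫ ω, X ω ^ 2 ∂P ≤ 2 * V := by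
    have h1 : ∫ ω, X ω ^ 2 ∂P ≤ ∫ ω, (1 + (X ω ^ 2) ^ r) ∂P :=
      integral_mono hX2 ((integrable_const _).add hXi) fun ω => by
        simpa using sq_rpow_le_one_add (r := r) (X ω) zero_le_one hr
    rw [integral_add (integrable_const _) hXi] at h1
    simp only [integral_const, probReal_univ, smul_eq_mul, mul_one] at h1
    linarith
  have hN0 : 0 < N := by linarith
  have hNr : 1 ≤ N ^ (r - 1) := Real.one_le_rpow hN (by linarith)
  -- Splitting at scale `N` rather than `1` is what gives the sharp order: each addition multiplies
  -- the moment by `1 + O(1 / N)` and adds `O(N ^ (r - 1))`, so `N` additions yield `O(N ^ r)`.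
  have hES : ∫ ω, (S ω ^ 2) ^ (r - 1) ∂P ≤ N ^ (r - 1) + M / N := by
    have h1 : ∀ ω, (S ω ^ 2) ^ (r - 1) ≤ N ^ (r - 1) + (S ω ^ 2) ^ r / N := by
      intro ω
      have h2 := rpow_le_one_add_rpow (t := S ω ^ 2 / N) (by positivity)
        (by linarith : 0 ≤ r - 1) (by linarith : r - 1 ≤ r)
      rw [Real.div_rpow (by positivity) hN0.le, Real.div_rpow (by positivity) hN0.le,
        div_le_iff₀ (by positivity)] at h2
      calc (S ω ^ 2) ^ (r - 1) ≤ _ := h2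
        _ = _ := by
          rw [Real.rpow_sub_one hN0.ne']
          have : 0 < N ^ r := by positivity
          field_simp
    have h3 : ∫ ω, (S ω ^ 2) ^ (r - 1) ∂P ≤ ∫ ω, (N ^ (r - 1) + (S ω ^ 2) ^ r / N) ∂P :=
      integral_mono hSr ((integrable_const _).add (hSi.div_const _)) h1
    rw [integral_add (integrable_const _) (hSi.div_const _), integral_div] at h3
    simpa using h3
  have h4 : (∫ ω, (S ω ^ 2) ^ (r - 1) ∂P) * ∫ ω, X ω ^ 2 ∂P ≤ (N ^ (r - 1) + M / N) * (2 * V) :=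
    mul_le_mul hES hEX2 (integral_nonneg fun ω => by positivity) (by positivity)
  have h5 : 50 * V / N * M = 50 * (V * (M / N)) := by ring
  rw [add_mul, h5]
  nlinarith

/-- A Marcinkiewicz–Zygmund inequality for exponents between `2` and `4`. -/
theorem moment_sum_le {ι : Type*} {r V N : ℝ} (hr : 1 ≤ r) (hr2 : r ≤ 2) (hV : 1 ≤ V)
    (hN : 1 ≤ N) {X : ι → Ω → ℝ} (hind : iIndepFun X P) (hX : ∀ i, Measurable (X i))
    (hXi : ∀ i, Integrable (fun ω => (X i ω ^ 2) ^ r) P) (hX0 : ∀ i, ∫ ω, X i ω ∂P = 0)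
    (hXV : ∀ i, ∫ ω, (X i ω ^ 2) ^ r ∂P ≤ V) (s : Finset ι) :
    Integrable (fun ω => ((∑ i ∈ s, X i ω) ^ 2) ^ r) P ∧
    ∫ ω, ((∑ i ∈ s, X i ω) ^ 2) ^ r ∂P ≤
      75 * V * N ^ (r - 1) * s.card * Real.exp (50 * V / N * s.card) := by
  classical
  induction s using Finset.induction_on with
  | empty => simp [Real.zero_rpow (by linarith : r ≠ 0)]
  | insert i s hi ih =>
    have h1 := (hind.indepFun_finsetSum_of_notMem hX hi)
    rw [show (∑ j ∈ s, X j) = fun ω => ∑ j ∈ s, X j ω from by ext ω; simp] at h1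
    obtain ⟨h2, h3⟩ := moment_add_le hr hr2 hV hN
      (Finset.measurable_sum s fun i _ => hX i) (hX i) h1 ih.1 (hXi i) (hX0 i) (hXV i)
    simp only [Finset.sum_insert hi, Finset.card_insert_of_notMem hi, add_comm (X i _)]
    refine ⟨h2, h3.trans ?_⟩
    set D := 75 * V * N ^ (r - 1) with hD
    set a := 50 * V / N with ha
    have ha0 : 0 ≤ a := by positivity
    have hD0 : 0 ≤ D := by positivity
    have e1 : 1 + a ≤ Real.exp a := by linarith [Real.add_one_le_exp a]
    have e2 : Real.exp (a * ((s.card + 1 : ℕ) : ℝ)) = Real.exp (a * s.card) * Real.exp a := by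
      rw [← Real.exp_add]; congr 1; push_cast; ring
    have e3 : 1 ≤ Real.exp (a * s.card) * Real.exp a := by
      rw [← Real.exp_add]; exact Real.one_le_exp (by positivity)
    rw [e2]
    push_cast
    have e4 : (1 + a) * ∫ ω, ((∑ i ∈ s, X i ω) ^ 2) ^ r ∂P ≤
        Real.exp a * (D * s.card * Real.exp (a * s.card)) :=
      mul_le_mul e1 ih.2 (integral_nonneg fun ω => by positivity) (Real.exp_pos _).le
    nlinarith [mul_le_mul_of_nonneg_left e3 hD0]

theorem moment_mean_le {r V : ℝ} (hr : 1 ≤ r) (hr2 : r ≤ 2) (hV : 1 ≤ V) {N : ℕ} (hN : 1 ≤ N)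
    {X : Fin N → Ω → ℝ} (hind : iIndepFun X P) (hX : ∀ i, Measurable (X i))
    (hXi : ∀ i, Integrable (fun ω => (X i ω ^ 2) ^ r) P) (hX0 : ∀ i, ∫ ω, X i ω ∂P = 0)
    (hXV : ∀ i, ∫ ω, (X i ω ^ 2) ^ r ∂P ≤ V) :
    ∫⁻ ω, ENNReal.ofReal ((((N : ℝ)⁻¹ * ∑ i, X i ω) ^ 2) ^ r) ∂P ≤
      ENNReal.ofReal (75 * V * Real.exp (50 * V) * (N : ℝ) ^ (-r)) := by
  have hN1 : (1 : ℝ) ≤ N := by exact_mod_cast hN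
  have hN0 : (0 : ℝ) < N := by linarith
  obtain ⟨h1, h2⟩ := moment_sum_le hr hr2 hV hN1 hind hX hXi hX0 hXV Finset.univ
  have h3 : ∀ ω, (((N : ℝ)⁻¹ * ∑ i, X i ω) ^ 2) ^ r =
      ((N : ℝ) ^ (-r)) ^ 2 * ((∑ i, X i ω) ^ 2) ^ r := fun ω => by
    rw [mul_pow, Real.mul_rpow (by positivity) (by positivity)]
    congr 1
    rw [← Real.rpow_neg_one, ← Real.rpow_natCast, ← Real.rpow_natCast, ← Real.rpow_mul hN0.le,
      ← Real.rpow_mul hN0.le, ← Real.rpow_mul hN0.le]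
    congr 1; ring
  simp_rw [h3]
  rw [← ofReal_integral_eq_lintegral_ofReal (h1.const_mul _)
    (Filter.Eventually.of_forall fun ω => by positivity), integral_const_mul]
  apply ENNReal.ofReal_le_ofReal
  rw [Finset.card_univ, Fintype.card_fin, div_mul_cancel₀ _ hN0.ne'] at h2
  have h4 : (N : ℝ) ^ (r - 1) * N = ((N : ℝ) ^ (-r))⁻¹ := by
    rw [Real.rpow_sub_one hN0.ne', Real.rpow_neg hN0.le, inv_inv]; field_simp
  have h5 : 0 < (N : ℝ) ^ (-r) := by positivity
  calc _ ≤ ((N : ℝ) ^ (-r)) ^ 2 * (75 * V * N ^ (r - 1) * N * Real.exp (50 * V)) := by gcongr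
    _ = ((N : ℝ) ^ (-r)) ^ 2 * (75 * V * (N ^ (r - 1) * N) * Real.exp (50 * V)) := by ring
    _ = _ := by rw [h4]; field_simp

/-- The moments of the error of a batch mean in a finite-dimensional space. -/
theorem exists_batchMean_moment_le (E : Type*) [NormedAddCommGroup E] [NormedSpace ℝ E]
    [FiniteDimensional ℝ E] [MeasurableSpace E] [BorelSpace E] {r : ℝ} (hr : 1 ≤ r) (hr2 : r ≤ 2)
    {V : ℝ} (hV : 0 ≤ V) :
    ∃ C > 0, ∀ {Ω : Type*} [MeasurableSpace Ω] (P : Measure Ω) [IsProbabilityMeasure P] {N : ℕ}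
      (Y : Fin N → Ω → E) (m : E), 1 ≤ N → iIndepFun Y P → (∀ i, Measurable (Y i)) →
      (∀ i, Integrable (Y i) P) → (∀ i, ∫ ω, Y i ω ∂P = m) →
      (∀ i, Integrable (fun ω => ‖m - Y i ω‖ ^ (2 * r)) P) →
      (∀ i, ∫ ω, ‖m - Y i ω‖ ^ (2 * r) ∂P ≤ V) →
      ∫⁻ ω, ENNReal.ofReal (‖batchMean (fun i => Y i ω) - m‖ ^ (2 * r)) ∂P ≤
        ENNReal.ofReal (C * (N : ℝ) ^ (-r)) := by
  set b := Module.finBasis ℝ E with hb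
  set k := Module.finrank ℝ E with hk
  -- Coordinates scaled so that `‖z‖ ≤ ∑ j, |ℓ j z|`. They serve for any norm, in particular the
  -- operator norm; the price is a constant depending on the dimension.
  let ℓ : Fin k → E →L[ℝ] ℝ := fun j => ‖b j‖ • LinearMap.toContinuousLinearMap (b.coord j)
  have hℓ : ∀ z : E, ‖z‖ ≤ ∑ j, |ℓ j z| := fun z => by
    conv_lhs => rw [← b.sum_repr z]
    refine (norm_sum_le _ _).trans (Finset.sum_le_sum fun j _ => ?_)
    rw [norm_smul]
    simp [ℓ, abs_mul, mul_comm]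
  set T := ∑ j, ‖ℓ j‖ with hT
  have hT0 : 0 ≤ T := Finset.sum_nonneg fun j _ => norm_nonneg _
  have hℓT : ∀ j z, |ℓ j z| ≤ T * ‖z‖ := fun j z => by
    refine ((ℓ j).le_opNorm z).trans ?_
    gcongr
    exact Finset.single_le_sum (f := fun j => ‖ℓ j‖) (fun j _ => norm_nonneg _) (Finset.mem_univ j)
  set V' := 1 + T ^ (2 * r) * V with hV'
  have hV'1 : 1 ≤ V' := le_add_of_nonneg_right (by positivity)
  set D := 75 * V' * Real.exp (50 * V') with hD
  have hD0 : 0 ≤ D := by positivity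
  -- The `+ 1` keeps the constant positive in dimension zero.
  refine ⟨(k : ℝ) ^ (2 * r - 1) * (k * D) + 1, by positivity, ?_⟩
  intro Ω _ P _ N Y m hN hind hmeas hint hmean hintV hVar
  have hsq : ∀ u : ℝ, |u| ^ (2 * r) = (u ^ 2) ^ r := fun u => by
    rw [← sq_abs, ← Real.rpow_natCast, ← Real.rpow_mul (abs_nonneg u)]; norm_num
  have hcoord : ∀ j, ∫⁻ ω, ENNReal.ofReal
      ((((N : ℝ)⁻¹ * ∑ i, ℓ j (Y i ω - m)) ^ 2) ^ r) ∂P ≤ ENNReal.ofReal (D * (N : ℝ) ^ (-r)) := by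
    intro j
    have hle : ∀ i ω, (ℓ j (Y i ω - m) ^ 2) ^ r ≤ T ^ (2 * r) * ‖m - Y i ω‖ ^ (2 * r) := by
      intro i ω
      rw [← hsq, ← Real.mul_rpow hT0 (norm_nonneg _), norm_sub_rev]
      exact Real.rpow_le_rpow (abs_nonneg _) (hℓT j _) (by linarith)
    have hm : ∀ i, Measurable fun ω => ℓ j (Y i ω - m) := fun i =>
      (ℓ j).continuous.measurable.comp ((hmeas i).sub_const m)
    have hI : ∀ i, Integrable (fun ω => (ℓ j (Y i ω - m) ^ 2) ^ r) P := fun i => by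
      refine ((hintV i).const_mul (T ^ (2 * r))).mono'
        (((hm i).pow_const 2).pow_const r).aestronglyMeasurable
        (Filter.Eventually.of_forall fun ω => ?_)
      rw [Real.norm_of_nonneg (by positivity)]
      exact hle i ω
    refine moment_mean_le hr hr2 hV'1 hN (X := fun i ω => ℓ j (Y i ω - m)) ?_ hm hI ?_ ?_
    · exact hind.comp (fun _ y => ℓ j (y - m)) fun _ =>
        (ℓ j).continuous.measurable.comp (measurable_id.sub_const m)
    · intro i
      have h1 : Integrable (fun ω => Y i ω - m) P := (hint i).sub (integrable_const m)
      rw [(ℓ j).integral_comp_comm h1, integral_sub (hint i) (integrable_const m), hmean i]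
      simp
    · intro i
      calc _ ≤ ∫ ω, T ^ (2 * r) * ‖m - Y i ω‖ ^ (2 * r) ∂P :=
            integral_mono (hI i) ((hintV i).const_mul _) (hle i)
        _ ≤ T ^ (2 * r) * V := by
            rw [integral_const_mul]
            gcongr
            exact hVar i
        _ ≤ V' := le_add_of_nonneg_left zero_le_one
  have hN0 : (N : ℝ) ≠ 0 := by positivity
  have hbatch : ∀ ω, batchMean (fun i => Y i ω) - m = (N : ℝ)⁻¹ • ∑ i, (Y i ω - m) := fun ω => by
    unfold batchMean
    rw [Finset.sum_sub_distrib, smul_sub, Finset.sum_const, Finset.card_univ, Fintype.card_fin,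
      ← Nat.cast_smul_eq_nsmul ℝ, smul_smul, inv_mul_cancel₀ hN0, one_smul]
  have hpt : ∀ ω, ‖batchMean (fun i => Y i ω) - m‖ ^ (2 * r) ≤
      ∑ j, (k : ℝ) ^ (2 * r - 1) * (((N : ℝ)⁻¹ * ∑ i, ℓ j (Y i ω - m)) ^ 2) ^ r := fun ω => by
    set z := batchMean (fun i => Y i ω) - m with hz
    have hzj : ∀ j, ℓ j z = (N : ℝ)⁻¹ * ∑ i, ℓ j (Y i ω - m) := fun j => by
      rw [hz, hbatch, map_smul, map_sum, smul_eq_mul]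
    calc ‖z‖ ^ (2 * r) ≤ (∑ j, |ℓ j z|) ^ (2 * r) :=
          Real.rpow_le_rpow (norm_nonneg _) (hℓ z) (by linarith)
      _ ≤ ((Finset.univ : Finset (Fin k)).card : ℝ) ^ (2 * r - 1) * ∑ j, |ℓ j z| ^ (2 * r) :=
          Real.rpow_sum_le_const_mul_sum_rpow _ _ (by linarith)
      _ = _ := by
          rw [Finset.card_univ, Fintype.card_fin, Finset.mul_sum]
          simp_rw [hsq, hzj]
  have hmeasj : ∀ j, Measurable fun ω =>
      ENNReal.ofReal ((((N : ℝ)⁻¹ * ∑ i, ℓ j (Y i ω - m)) ^ 2) ^ r) := fun j => by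
    refine ENNReal.measurable_ofReal.comp (((Measurable.const_mul ?_ _).pow_const 2).pow_const r)
    exact Finset.measurable_sum _ fun i _ =>
      (ℓ j).continuous.measurable.comp ((hmeas i).sub_const m)
  calc ∫⁻ ω, ENNReal.ofReal (‖batchMean (fun i => Y i ω) - m‖ ^ (2 * r)) ∂P
      ≤ ∫⁻ ω, ∑ j, ENNReal.ofReal ((k : ℝ) ^ (2 * r - 1)) *
          ENNReal.ofReal ((((N : ℝ)⁻¹ * ∑ i, ℓ j (Y i ω - m)) ^ 2) ^ r) ∂P := by
        refine lintegral_mono fun ω => ?_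
        refine (ENNReal.ofReal_le_ofReal (hpt ω)).trans (le_of_eq ?_)
        rw [ENNReal.ofReal_sum_of_nonneg fun j _ => by positivity]
        exact Finset.sum_congr rfl fun j _ => ENNReal.ofReal_mul (by positivity)
    _ = ∑ j, ENNReal.ofReal ((k : ℝ) ^ (2 * r - 1)) *
          ∫⁻ ω, ENNReal.ofReal ((((N : ℝ)⁻¹ * ∑ i, ℓ j (Y i ω - m)) ^ 2) ^ r) ∂P := by
        rw [lintegral_finsetSum _ fun j _ => (hmeasj j).const_mul _]
        exact Finset.sum_congr rfl fun j _ => lintegral_const_mul _ (hmeasj j)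
    _ ≤ ∑ _j : Fin k, ENNReal.ofReal ((k : ℝ) ^ (2 * r - 1)) *
          ENNReal.ofReal (D * (N : ℝ) ^ (-r)) := by
        gcongr with j _
        exact hcoord j
    _ = ENNReal.ofReal ((k : ℝ) ^ (2 * r - 1) * (k * D) * (N : ℝ) ^ (-r)) := by
        rw [Finset.sum_const, Finset.card_univ, Fintype.card_fin, nsmul_eq_mul,
          ← ENNReal.ofReal_natCast, ← ENNReal.ofReal_mul (by positivity),
          ← ENNReal.ofReal_mul (by positivity)]
        congr 1; ring
    _ ≤ _ := by
        apply ENNReal.ofReal_le_ofReal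
        gcongr
        linarith

end Moments

end SHSODM

namespace SHSODM

/-! ### Expected noise for the prescribed batch sizes. -/

section Noise

theorem add_rpow_le_two_rpow_mul {x y β : ℝ} (hx : 0 ≤ x) (hy : 0 ≤ y) (hβ : 0 ≤ β) :
    (x + y) ^ β ≤ 2 ^ β * (x ^ β + y ^ β) := by
  have h1 : x + y ≤ 2 * max x y := by linarith [le_max_left x y, le_max_right x y]
  have h2 : max x y ^ β ≤ x ^ β + y ^ β := by
    rcases max_cases x y with ⟨e, -⟩ | ⟨e, -⟩ <;> rw [e]
    · exact le_add_of_nonneg_right (by positivity)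
    · exact le_add_of_nonneg_left (by positivity)
  calc (x + y) ^ β ≤ (2 * max x y) ^ β := Real.rpow_le_rpow (by positivity) h1 hβ
    _ = 2 ^ β * max x y ^ β := Real.mul_rpow (by norm_num) (le_max_of_le_left hx)
    _ ≤ _ := by gcongr

/-- Only a second moment of the gradient error is available, while the noise contains its power `α ≤
2`. With `θ` of order `ε ^ (1 / α)` and variance of order `ε ^ (2 / α)`, both terms have order `ε`.
-/
theorem rpow_le_add_mul_sq {x θ α : ℝ} (hx : 0 ≤ x) (hθ : 0 < θ) (hα : 0 ≤ α) (hα2 : α ≤ 2) :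
    x ^ α ≤ θ ^ α + θ ^ (α - 2) * x ^ 2 := by
  have h := rpow_le_one_add_rpow (t := x / θ) (by positivity) hα hα2
  rw [Real.div_rpow hx hθ.le, Real.div_rpow hx hθ.le, div_le_iff₀ (by positivity),
    Real.rpow_two, Real.rpow_two] at h
  refine h.trans (le_of_eq ?_)
  rw [Real.rpow_sub hθ, Real.rpow_two]
  field_simp

theorem measurable_batchMean {V Ω : Type*} [MeasurableSpace Ω] [NormedAddCommGroup V]
    [NormedSpace ℝ V] [MeasurableSpace V] [BorelSpace V] [SecondCountableTopology V] {N : ℕ}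
    {Y : Fin N → Ω → V} (hY : ∀ i, Measurable (Y i)) :
    Measurable fun ω => batchMean fun i => Y i ω := by
  unfold batchMean
  exact (Finset.measurable_sum _ fun i _ => hY i).const_smul _

theorem LipschitzHessian.continuous_hess {n : ℕ} {F : Vec n → ℝ} {L : ℝ}
    (hF : LipschitzHessian F L) : Continuous (hess F) :=
  (LipschitzWith.of_dist_le' (K := L) fun x y => by
    rw [dist_eq_norm, dist_eq_norm]; exact hF.lipschitz x y).continuous

theorem noise_le {n : ℕ} {F : Vec n → ℝ} {α θ τ : ℝ} (hα : 1 ≤ α) (hα2 : α ≤ 2) (hθ : 0 < θ)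
    (hτ : 0 ≤ τ) (x g : Vec n) (H : Op n) :
    noise F α θ τ x g H ≤ (8 * θ ^ α + 16 * τ ^ (2 * α)) +
      4 * θ ^ (α - 2) * ‖g - gradient F x‖ ^ 2 + 16 * ‖H - hess F x‖ ^ (2 * α) := by
  have h1 := add_rpow_le_two_rpow_mul (norm_nonneg (g - gradient F x)) hθ.le
    (by linarith : 0 ≤ α)
  have h2 := add_rpow_le_two_rpow_mul (norm_nonneg (H - hess F x)) hτ
    (by linarith : 0 ≤ 2 * α)
  have h3 := rpow_le_add_mul_sq (norm_nonneg (g - gradient F x)) hθ (by linarith : 0 ≤ α) hα2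
  have h4 : (2 : ℝ) ^ α ≤ 4 := by
    have := Real.rpow_le_rpow_of_exponent_le (by norm_num : (1 : ℝ) ≤ 2) hα2
    norm_num at this ⊢
    exact this
  have h5 : (2 : ℝ) ^ (2 * α) ≤ 16 := by
    rw [Real.rpow_mul (by norm_num)]
    calc ((2 : ℝ) ^ (2 : ℝ)) ^ α ≤ ((2 : ℝ) ^ (2 : ℝ)) ^ (2 : ℝ) :=
          Real.rpow_le_rpow_of_exponent_le (by norm_num) hα2
      _ = 16 := by norm_num
  have h6 : 0 ≤ θ ^ α := by positivity
  have h7 : 0 ≤ ‖g - gradient F x‖ ^ α := by positivity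
  have h8 : 0 ≤ τ ^ (2 * α) := by positivity
  have h9 : 0 ≤ ‖H - hess F x‖ ^ (2 * α) := by positivity
  have h10 := mul_le_mul_of_nonneg_right h4 (add_nonneg h7 h6)
  have h11 := mul_le_mul_of_nonneg_right h5 (add_nonneg h9 h8)
  unfold noise
  nlinarith

/-- With batches of the prescribed sizes the expected noise is a small multiple of `ε`. -/
theorem exists_noise_bound (n : ℕ) {α L σg σh : ℝ} (hα : 1 ≤ α) (hα2 : α ≤ 2) (hL : 0 ≤ L)
    {η : ℝ} (hη : 0 < η) :
    ∃ cg > 0, ∃ cH > 0, ∃ ceig > 0, ∀ ε ∈ Set.Ioo (0 : ℝ) 1, ∀ ng nH : ℕ,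
      cg * ε ^ (-2 / α) ≤ ng → cH * ε ^ (-1 / α) ≤ nH →
      ∀ (F : Vec n → ℝ) {Ξ : Type*} [MeasurableSpace Ξ] (D : Measure Ξ)
        (G : Vec n → Ξ → Vec n) (Q : Vec n → Ξ → Op n), UnbiasedOracle F α σg σh D G Q →
      ∀ {Ω : Type*} [MeasurableSpace Ω] (P : Measure Ω) [IsProbabilityMeasure P]
        (ξ : Fin ng ⊕ Fin nH → Ω → Ξ), (∀ i, Measurable (ξ i)) → (∀ i, P.map (ξ i) = D) →
        iIndepFun ξ P → ∀ x : Vec n,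
        ∫⁻ ω, ENNReal.ofReal (noise F α (ceig * ε ^ (1 / α)) (ceig * ε ^ (1 / α) / (L + 4)) x
          (batchMean fun i => G x (ξ (Sum.inl i) ω)) (batchMean fun i => Q x (ξ (Sum.inr i) ω))) ∂P
          ≤ ENNReal.ofReal (η * ε) := by
  have hα0 : 0 < α := by linarith
  obtain ⟨C₁, hC₁, hG⟩ := exists_batchMean_moment_le (Vec n) le_rfl one_le_two (sq_nonneg σg)
  obtain ⟨C₂, hC₂, hQ⟩ := exists_batchMean_moment_le (Op n) hα hα2 (sq_nonneg σh)
  -- The budget `η * ε` is split as `η / 2` for the tolerances, whose coefficients add up to `8 + 16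
  -- = 24`, and `η / 4` for each batch; `cg` and `cH` are read off from the latter two. `cH ≥ 1` is
  -- needed for `cH ^ (-α) ≤ cH⁻¹`.
  set ceig := min 1 (η / 48) with hceig
  have hceig0 : 0 < ceig := lt_min one_pos (by positivity)
  have hceig1 : ceig ≤ 1 := min_le_left _ _
  have hceigη : 48 * ceig ≤ η := by have : ceig ≤ η / 48 := min_le_right _ _; linarith
  set cg := 16 * ceig ^ (α - 2) * C₁ / η with hcg
  set cH := max 1 (64 * C₂ / η) with hcH
  have hcg0 : 0 < cg := by positivity
  have hcH1 : 1 ≤ cH := le_max_left _ _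
  have hcH0 : 0 < cH := by linarith
  have hcH2 : 64 * C₂ ≤ cH * η := by
    rw [← div_le_iff₀ hη]; exact le_max_right _ _
  refine ⟨cg, hcg0, cH, hcH0, ceig, hceig0, ?_⟩
  rintro ε ⟨hε, hε1⟩ ng nH hng hnH F Ξ _ D G Q hO Ω _ P _ ξ hξ hlaw hind x
  have hng0 : (0 : ℝ) < ng := lt_of_lt_of_le (by positivity) hng
  have hnH0 : (0 : ℝ) < nH := lt_of_lt_of_le (by positivity) hnH
  have hGm : Measurable (G x) := hO.measurable_grad.of_uncurry_left
  have hQm : Measurable (Q x) := hO.measurable_hess.of_uncurry_left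
  have tr : ∀ i, MeasurePreserving (ξ i) P D := fun i => ⟨hξ i, hlaw i⟩
  have e1 : ∫⁻ ω, ENNReal.ofReal (‖batchMean (fun i => G x (ξ (Sum.inl i) ω)) - gradient F x‖ ^ 2)
      ∂P ≤ ENNReal.ofReal (C₁ * (ng : ℝ)⁻¹) := by
    have := hG P (fun i ω => G x (ξ (Sum.inl i) ω)) (gradient F x) (by exact_mod_cast hng0)
      ((hind.precomp Sum.inl_injective).comp (fun _ => G x) fun _ => hGm)
      (fun i => hGm.comp (hξ _))
      (fun i => (tr _).integrable_comp_of_integrable (hO.integrable_grad x))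
      (fun i => ?_) (fun i => ?_) (fun i => ?_)
    · simpa only [mul_one, Real.rpow_two, Real.rpow_neg_one] using this
    · rw [← hO.unbiased_grad x, ← hlaw (Sum.inl i),
        integral_map (hξ _).aemeasurable hGm.aestronglyMeasurable]
    · simp only [mul_one, Real.rpow_two]
      exact (tr (Sum.inl i)).integrable_comp_of_integrable (hO.integrable_var_grad x)
    · simp only [mul_one, Real.rpow_two]
      refine le_trans (le_of_eq ?_) (hO.var_grad x)
      rw [← hlaw (Sum.inl i), integral_map (hξ _).aemeasurable
        (Measurable.aestronglyMeasurable (by fun_prop))]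
  have e2 : ∫⁻ ω, ENNReal.ofReal
      (‖batchMean (fun i => Q x (ξ (Sum.inr i) ω)) - hess F x‖ ^ (2 * α)) ∂P ≤
      ENNReal.ofReal (C₂ * (nH : ℝ) ^ (-α)) := by
    refine hQ P (fun i ω => Q x (ξ (Sum.inr i) ω)) (hess F x) (by exact_mod_cast hnH0)
      ((hind.precomp Sum.inr_injective).comp (fun _ => Q x) fun _ => hQm)
      (fun i => hQm.comp (hξ _))
      (fun i => (tr _).integrable_comp_of_integrable (hO.integrable_hess x))
      (fun i => ?_) (fun i => ?_) (fun i => ?_)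
    · rw [← hO.unbiased_hess x, ← hlaw (Sum.inr i),
        integral_map (hξ _).aemeasurable hQm.aestronglyMeasurable]
    · exact (tr (Sum.inr i)).integrable_comp_of_integrable (hO.integrable_var_hess x)
    · refine le_trans (le_of_eq ?_) (hO.var_hess x)
      rw [← hlaw (Sum.inr i), integral_map (hξ _).aemeasurable
        (Measurable.aestronglyMeasurable (((hQm.const_sub _).norm).pow_const _))]
  set θ := ceig * ε ^ (1 / α) with hθ
  have hθ0 : 0 < θ := by positivity
  have hθα : θ ^ α = ceig ^ α * ε := by
    rw [hθ, Real.mul_rpow hceig0.le (by positivity), ← Real.rpow_mul hε.le,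
      one_div_mul_cancel hα0.ne', Real.rpow_one]
  have hcα : ceig ^ α ≤ ceig := by
    simpa using Real.rpow_le_rpow_of_exponent_ge hceig0 hceig1 hα
  have hA0 : 8 * θ ^ α + 16 * (θ / (L + 4)) ^ (2 * α) ≤ η / 2 * ε := by
    have h1 : θ ^ α ≤ ceig * ε := by rw [hθα]; gcongr
    have h2 : (θ / (L + 4)) ^ (2 * α) ≤ ceig * ε := by
      have hθ1 : θ ≤ 1 := by
        have : ε ^ (1 / α) ≤ 1 := Real.rpow_le_one hε.le hε1.le (by positivity)
        calc θ ≤ 1 * 1 := by rw [hθ]; gcongr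
          _ = 1 := one_mul 1
      calc (θ / (L + 4)) ^ (2 * α) ≤ θ ^ (2 * α) := by
            refine Real.rpow_le_rpow (by positivity) ?_ (by positivity)
            exact div_le_self hθ0.le (by linarith)
        _ ≤ θ ^ α := Real.rpow_le_rpow_of_exponent_ge hθ0 hθ1 (by linarith)
        _ ≤ _ := h1
    have h3 := mul_le_mul_of_nonneg_right hceigη hε.le
    linarith
  have hA1 : 4 * θ ^ (α - 2) * (C₁ * (ng : ℝ)⁻¹) ≤ η / 4 * ε := by
    have h1 : (ng : ℝ)⁻¹ ≤ (cg * ε ^ (-2 / α))⁻¹ := inv_anti₀ (by positivity) hng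
    have h2 : θ ^ (α - 2) = ceig ^ (α - 2) * (ε * ε ^ (-2 / α)) := by
      rw [hθ, Real.mul_rpow hceig0.le (by positivity), ← Real.rpow_mul hε.le,
        show 1 / α * (α - 2) = 1 + -2 / α by field_simp; ring, Real.rpow_add hε, Real.rpow_one]
    have h3 : 0 < ε ^ (-2 / α) := by positivity
    have h4 : 0 < ceig ^ (α - 2) := by positivity
    calc 4 * θ ^ (α - 2) * (C₁ * (ng : ℝ)⁻¹)
        ≤ 4 * θ ^ (α - 2) * (C₁ * (cg * ε ^ (-2 / α))⁻¹) := by gcongr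
      _ = η / 4 * ε := by
          rw [h2, hcg]
          field_simp
          ring
  have hA2 : 16 * (C₂ * (nH : ℝ) ^ (-α)) ≤ η / 4 * ε := by
    have h1 : (nH : ℝ) ^ (-α) ≤ (cH * ε ^ (-1 / α)) ^ (-α) :=
      Real.rpow_le_rpow_of_nonpos (by positivity) hnH (by linarith)
    have h2 : (cH * ε ^ (-1 / α)) ^ (-α) = cH ^ (-α) * ε := by
      rw [Real.mul_rpow hcH0.le (by positivity), ← Real.rpow_mul hε.le]
      congr 1
      rw [show -1 / α * -α = 1 by field_simp, Real.rpow_one]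
    have h3 : cH ^ (-α) ≤ cH⁻¹ := by
      rw [← Real.rpow_neg_one]
      exact Real.rpow_le_rpow_of_exponent_le hcH1 (by linarith)
    calc 16 * (C₂ * (nH : ℝ) ^ (-α)) ≤ 16 * (C₂ * (cH⁻¹ * ε)) := by
          rw [h2] at h1
          gcongr
          exact h1.trans (by gcongr)
      _ = 64 * C₂ / cH / 4 * ε := by ring
      _ ≤ η / 4 * ε := by
          gcongr
          rw [div_le_iff₀ hcH0]
          linarith
  have hmg : Measurable fun ω => ENNReal.ofReal
      (‖batchMean (fun i => G x (ξ (Sum.inl i) ω)) - gradient F x‖ ^ 2) :=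
    ENNReal.measurable_ofReal.comp
      ((((measurable_batchMean fun i => hGm.comp (hξ (Sum.inl i))).sub_const _).norm).pow_const _)
  have hmQ : Measurable fun ω => ENNReal.ofReal
      (‖batchMean (fun i => Q x (ξ (Sum.inr i) ω)) - hess F x‖ ^ (2 * α)) :=
    ENNReal.measurable_ofReal.comp
      ((((measurable_batchMean fun i => hQm.comp (hξ (Sum.inr i))).sub_const _).norm).pow_const _)
  calc _ ≤ ∫⁻ ω, (ENNReal.ofReal (8 * θ ^ α + 16 * (θ / (L + 4)) ^ (2 * α)) +
        ENNReal.ofReal (4 * θ ^ (α - 2)) * ENNReal.ofReal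
          (‖batchMean (fun i => G x (ξ (Sum.inl i) ω)) - gradient F x‖ ^ 2) +
        ENNReal.ofReal 16 * ENNReal.ofReal
          (‖batchMean (fun i => Q x (ξ (Sum.inr i) ω)) - hess F x‖ ^ (2 * α))) ∂P := by
        refine lintegral_mono fun ω => ?_
        rw [← ENNReal.ofReal_mul (by positivity), ← ENNReal.ofReal_mul (by norm_num),
          ← ENNReal.ofReal_add (by positivity) (by positivity),
          ← ENNReal.ofReal_add (by positivity) (by positivity)]
        exact ENNReal.ofReal_le_ofReal (noise_le hα hα2 hθ0 (by positivity) _ _ _)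
    _ ≤ ENNReal.ofReal (8 * θ ^ α + 16 * (θ / (L + 4)) ^ (2 * α)) +
        ENNReal.ofReal (4 * θ ^ (α - 2)) * ENNReal.ofReal (C₁ * (ng : ℝ)⁻¹) +
        ENNReal.ofReal 16 * ENNReal.ofReal (C₂ * (nH : ℝ) ^ (-α)) := by
        rw [lintegral_add_right _ (hmQ.const_mul _), lintegral_add_right _ (hmg.const_mul _),
          lintegral_const, measure_univ, mul_one, lintegral_const_mul _ hmg,
          lintegral_const_mul _ hmQ]
        gcongr
    _ ≤ _ := by
        rw [← ENNReal.ofReal_mul (by positivity), ← ENNReal.ofReal_mul (by norm_num),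
          ← ENNReal.ofReal_add (by positivity) (by positivity),
          ← ENNReal.ofReal_add (by positivity) (by positivity)]
        exact ENNReal.ofReal_le_ofReal (by linarith)

end Noise

end SHSODM

namespace SHSODM

/-! ### From paths to expectations, and the choice of constants. -/

section Run

/-- Unrolled form of the perturbed recursion, along one path. -/
theorem path_bound {c p C B : ℝ} (hc : 0 < c) (hp : 0 < p) (hp1 : p ≤ 1) {w : ℕ → ℝ}
    (hw : ∀ j, 0 ≤ w j)
    (hwφ : ∀ j r, 0 ≤ r → (contraction c p)^[j] r ≤ w j * (r + r ^ (1 / p)))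
    (hB : ∀ a b y : ℝ, 0 ≤ a → 0 ≤ b → 0 ≤ y → y + 2 * c * y ^ p ≤ a + C * b ^ p →
      ∃ ν, 0 ≤ ν ∧ y ≤ max (contraction c p a) ν ∧
        ν + ν ^ (1 / p) ≤ B * (b * (1 + a ^ (1 / p))))
    {a b : ℕ → ℝ} (ha : ∀ i, 0 ≤ a i) (hb : ∀ i, 0 ≤ b i) {K : ℕ}
    (hstep : ∀ i < K, a (i + 1) + 2 * c * a (i + 1) ^ p ≤ a i + C * b i ^ p) :
    a K ≤ (contraction c p)^[K] (a 0) +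
      ∑ i ∈ Finset.range K, w (K - 1 - i) * (B * (b i * (1 + a i ^ (1 / p)))) ∧
    ∀ i < K, 1 + a (i + 1) ^ (1 / p) ≤
      (1 + a i ^ (1 / p)) + B * (b i * (1 + a i ^ (1 / p))) := by
  have hq : 0 ≤ 1 / p := by positivity
  have hex : ∀ i, ∃ ν, 0 ≤ ν ∧ (i < K → a (i + 1) ≤ max (contraction c p (a i)) ν ∧
      ν + ν ^ (1 / p) ≤ B * (b i * (1 + a i ^ (1 / p)))) := fun i => by
    by_cases hi : i < K
    · obtain ⟨ν, h1, h2, h3⟩ := hB _ _ _ (ha i) (hb i) (ha (i + 1)) (hstep i hi)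
      exact ⟨ν, h1, fun _ => ⟨h2, h3⟩⟩
    · exact ⟨0, le_rfl, fun h => absurd h hi⟩
  choose ν hν hνi using hex
  constructor
  · have h := iterate_le_of_step_le_max hc hp1 ha hν K (fun i hi => (hνi i hi).1) 0
    simp only [Function.iterate_zero, id, zero_add] at h
    refine h.trans ?_
    gcongr with i hi
    refine (hwφ _ _ (hν i)).trans ?_
    exact mul_le_mul_of_nonneg_left (hνi i (Finset.mem_range.1 hi)).2 (hw _)
  -- The second bound concerns the weight `1 + a ^ (1 / p)` that multiplies the noise in the first;
  -- it will be closed by a discrete Gronwall argument in expectation.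
  · intro i hi
    obtain ⟨h1, h2⟩ := hνi i hi
    have h3 : a (i + 1) ^ (1 / p) ≤ a i ^ (1 / p) + ν i ^ (1 / p) := by
      have h4 : a (i + 1) ≤ max (a i) (ν i) :=
        h1.trans (max_le_max_right _ (contraction_le_self hc (ha i)))
      refine (Real.rpow_le_rpow (ha _) h4 hq).trans ?_
      have e1 : 0 ≤ a i ^ (1 / p) := Real.rpow_nonneg (ha i) _
      have e2 : 0 ≤ ν i ^ (1 / p) := Real.rpow_nonneg (hν i) _
      rcases max_cases (a i) (ν i) with ⟨e, -⟩ | ⟨e, -⟩ <;> rw [e] <;> linarith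
    linarith [hν i]

/-- The perturbed recursion in expectation. -/
theorem expectation_bound {c p C B κ Δ : ℝ} (hc : 0 < c) (hp : 0 < p) (hp1 : p ≤ 1)
    (hB0 : 0 ≤ B) (hκ : 0 ≤ κ) (hΔ : 0 ≤ Δ) {w : ℕ → ℝ} (hws : Summable w) (hw : ∀ j, 0 ≤ w j)
    (hwφ : ∀ j r, 0 ≤ r → (contraction c p)^[j] r ≤ w j * (r + r ^ (1 / p)))
    (hB : ∀ a b y : ℝ, 0 ≤ a → 0 ≤ b → 0 ≤ y → y + 2 * c * y ^ p ≤ a + C * b ^ p →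
      ∃ ν, 0 ≤ ν ∧ y ≤ max (contraction c p a) ν ∧
        ν + ν ^ (1 / p) ≤ B * (b * (1 + a ^ (1 / p))))
    {Ω : Type*} [MeasurableSpace Ω] {P : Measure Ω} [IsProbabilityMeasure P]
    {a b : ℕ → Ω → ℝ} {K : ℕ} (ha : ∀ i ω, 0 ≤ a i ω) (hb : ∀ i ω, 0 ≤ b i ω)
    (ham : ∀ i ≤ K, Measurable (a i)) (hbm : ∀ i < K, Measurable (b i))
    (ha0 : ∀ ω, a 0 ω ≤ Δ)
    (hstep : ∀ i < K, ∀ᵐ ω ∂P,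
      a (i + 1) ω + 2 * c * a (i + 1) ω ^ p ≤ a i ω + C * b i ω ^ p)
    (hdec : ∀ i < K, ∫⁻ ω, ENNReal.ofReal (1 + a i ω ^ (1 / p)) * ENNReal.ofReal (b i ω) ∂P ≤
      ENNReal.ofReal κ * ∫⁻ ω, ENNReal.ofReal (1 + a i ω ^ (1 / p)) ∂P) :
    ∫⁻ ω, ENNReal.ofReal (a K ω) ∂P ≤ ENNReal.ofReal ((contraction c p)^[K] Δ +
      (∑' j, w j) * (B * κ * ((1 + Δ ^ (1 / p)) * Real.exp (B * κ * K)))) := by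
  set q := 1 / p with hq
  have hq0 : 0 < q := by positivity
  have hae : ∀ᵐ ω ∂P, ∀ i < K,
      a (i + 1) ω + 2 * c * a (i + 1) ω ^ p ≤ a i ω + C * b i ω ^ p := by
    rw [ae_all_iff]
    intro i
    exact Filter.eventually_imp_distrib_left.2 (hstep i)
  have hpath : ∀ᵐ ω ∂P, a K ω ≤ (contraction c p)^[K] (a 0 ω) +
      ∑ i ∈ Finset.range K, w (K - 1 - i) * (B * (b i ω * (1 + a i ω ^ q))) ∧
      ∀ i < K, 1 + a (i + 1) ω ^ q ≤ (1 + a i ω ^ q) + B * (b i ω * (1 + a i ω ^ q)) := by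
    filter_upwards [hae] with ω hω
    exact path_bound hc hp hp1 hw hwφ hB (a := fun i => a i ω) (b := fun i => b i ω)
      (fun i => ha i ω) (fun i => hb i ω) hω
  have haq : ∀ i ω, 0 ≤ a i ω ^ q := fun i ω => Real.rpow_nonneg (ha i ω) _
  have hmul : ∀ i ω, ENNReal.ofReal (B * (b i ω * (1 + a i ω ^ q))) =
      ENNReal.ofReal B * (ENNReal.ofReal (1 + a i ω ^ q) * ENNReal.ofReal (b i ω)) := fun i ω => by
    rw [ENNReal.ofReal_mul hB0, mul_comm (b i ω),
      ENNReal.ofReal_mul (by linarith [haq i ω])]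
  have hm1 : ∀ i ≤ K, Measurable fun ω => ENNReal.ofReal (1 + a i ω ^ q) := fun i hi =>
    ENNReal.measurable_ofReal.comp (((ham i hi).pow_const q).const_add 1)
  have hm2 : ∀ i < K, Measurable fun ω =>
      ENNReal.ofReal (1 + a i ω ^ q) * ENNReal.ofReal (b i ω) := fun i hi =>
    (hm1 i hi.le).mul (ENNReal.measurable_ofReal.comp (hbm i hi))
  have hjump : ∀ i < K, ∫⁻ ω, ENNReal.ofReal (B * (b i ω * (1 + a i ω ^ q))) ∂P ≤
      ENNReal.ofReal (B * κ) * ∫⁻ ω, ENNReal.ofReal (1 + a i ω ^ q) ∂P := fun i hi => by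
    simp_rw [hmul i]
    rw [lintegral_const_mul _ (hm2 i hi), ENNReal.ofReal_mul hB0, mul_assoc]
    gcongr
    exact hdec i hi
  have hmoment : ∀ i ≤ K, ∫⁻ ω, ENNReal.ofReal (1 + a i ω ^ q) ∂P ≤
      ENNReal.ofReal ((1 + Δ ^ q) * Real.exp (B * κ * i)) := by
    intro i
    induction i with
    | zero =>
      intro _
      calc _ ≤ ∫⁻ _, ENNReal.ofReal (1 + Δ ^ q) ∂P := by
            refine lintegral_mono fun ω => ENNReal.ofReal_le_ofReal ?_
            have := Real.rpow_le_rpow (ha 0 ω) (ha0 ω) hq0.le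
            linarith
        _ = _ := by simp
    | succ i ih =>
      intro hi
      have hi' : i < K := hi
      have ih := ih hi'.le
      calc _ ≤ ∫⁻ ω, (ENNReal.ofReal (1 + a i ω ^ q) +
              ENNReal.ofReal (B * (b i ω * (1 + a i ω ^ q)))) ∂P := by
            refine lintegral_mono_ae ?_
            filter_upwards [hpath] with ω hω
            have h0 := haq i ω
            rw [← ENNReal.ofReal_add (by linarith)
              (mul_nonneg hB0 (mul_nonneg (hb i ω) (by linarith)))]
            exact ENNReal.ofReal_le_ofReal (hω.2 i hi')
        _ = ∫⁻ ω, ENNReal.ofReal (1 + a i ω ^ q) ∂P +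
              ∫⁻ ω, ENNReal.ofReal (B * (b i ω * (1 + a i ω ^ q))) ∂P :=
            lintegral_add_left (hm1 i hi'.le) _
        _ ≤ (1 + ENNReal.ofReal (B * κ)) * ∫⁻ ω, ENNReal.ofReal (1 + a i ω ^ q) ∂P := by
            rw [add_mul, one_mul]
            gcongr
            exact hjump i hi'
        _ ≤ (1 + ENNReal.ofReal (B * κ)) *
              ENNReal.ofReal ((1 + Δ ^ q) * Real.exp (B * κ * i)) := by gcongr
        _ = ENNReal.ofReal ((1 + B * κ) * ((1 + Δ ^ q) * Real.exp (B * κ * i))) := by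
            rw [ENNReal.ofReal_mul (p := 1 + B * κ) (by positivity),
              ENNReal.ofReal_add zero_le_one (by positivity), ENNReal.ofReal_one]
        _ ≤ _ := by
            apply ENNReal.ofReal_le_ofReal
            push_cast
            rw [mul_add, mul_one, Real.exp_add]
            have h1 := Real.add_one_le_exp (B * κ)
            calc (1 + B * κ) * ((1 + Δ ^ q) * Real.exp (B * κ * i))
                ≤ Real.exp (B * κ) * ((1 + Δ ^ q) * Real.exp (B * κ * i)) := by
                  gcongr
                  linarith
              _ = _ := by ring
  set M := (1 + Δ ^ q) * Real.exp (B * κ * K) with hM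
  have hM0 : 0 ≤ M := by positivity
  have hjumpM : ∀ i < K, ∫⁻ ω, ENNReal.ofReal (B * (b i ω * (1 + a i ω ^ q))) ∂P ≤
      ENNReal.ofReal (B * κ * M) := fun i hi => by
    refine (hjump i hi).trans ?_
    rw [ENNReal.ofReal_mul (by positivity : 0 ≤ B * κ)]
    gcongr
    refine (hmoment i hi.le).trans (ENNReal.ofReal_le_ofReal ?_)
    rw [hM]
    gcongr
  have hφ0 := contraction_iterate_nonneg (p := p) hc hΔ K
  have hterm : ∀ i ω, 0 ≤ B * (b i ω * (1 + a i ω ^ q)) := fun i ω =>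
    mul_nonneg hB0 (mul_nonneg (hb i ω) (by linarith [haq i ω]))
  calc ∫⁻ ω, ENNReal.ofReal (a K ω) ∂P
      ≤ ∫⁻ ω, (ENNReal.ofReal ((contraction c p)^[K] Δ) +
          ∑ i ∈ Finset.range K, ENNReal.ofReal (w (K - 1 - i)) *
            ENNReal.ofReal (B * (b i ω * (1 + a i ω ^ q)))) ∂P := by
        refine lintegral_mono_ae ?_
        filter_upwards [hpath] with ω hω
        have h1 : ∀ i, ENNReal.ofReal (w (K - 1 - i)) *
            ENNReal.ofReal (B * (b i ω * (1 + a i ω ^ q))) =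
            ENNReal.ofReal (w (K - 1 - i) * (B * (b i ω * (1 + a i ω ^ q)))) := fun i =>
          (ENNReal.ofReal_mul (hw _)).symm
        simp_rw [h1]
        rw [← ENNReal.ofReal_sum_of_nonneg fun i _ => mul_nonneg (hw _) (hterm i ω),
          ← ENNReal.ofReal_add hφ0 (Finset.sum_nonneg fun i _ => mul_nonneg (hw _) (hterm i ω))]
        refine ENNReal.ofReal_le_ofReal (hω.1.trans ?_)
        gcongr
        exact contraction_iterate_mono hc hp1 (ha 0 ω) (ha0 ω) K
    _ = ENNReal.ofReal ((contraction c p)^[K] Δ) +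
          ∑ i ∈ Finset.range K, ENNReal.ofReal (w (K - 1 - i)) *
            ∫⁻ ω, ENNReal.ofReal (B * (b i ω * (1 + a i ω ^ q))) ∂P := by
        have hm3 : ∀ i < K, Measurable fun ω =>
            ENNReal.ofReal (B * (b i ω * (1 + a i ω ^ q))) := fun i hi => by
          simp_rw [hmul i]
          exact (hm2 i hi).const_mul _
        rw [lintegral_add_left measurable_const, lintegral_const, measure_univ, mul_one,
          lintegral_finsetSum' _ fun i hi =>
            ((hm3 i (Finset.mem_range.1 hi)).const_mul _).aemeasurable]
        congr 1
        exact Finset.sum_congr rfl fun i hi =>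
          lintegral_const_mul _ (hm3 i (Finset.mem_range.1 hi))
    _ ≤ ENNReal.ofReal ((contraction c p)^[K] Δ) +
          ∑ i ∈ Finset.range K, ENNReal.ofReal (w (K - 1 - i)) * ENNReal.ofReal (B * κ * M) := by
        gcongr with i hi
        exact hjumpM i (Finset.mem_range.1 hi)
    _ = ENNReal.ofReal ((contraction c p)^[K] Δ +
          (∑ i ∈ Finset.range K, w i) * (B * κ * M)) := by
        rw [← Finset.sum_mul, ← ENNReal.ofReal_sum_of_nonneg fun i _ => hw _,
          Finset.sum_range_reflect, ← ENNReal.ofReal_mul (Finset.sum_nonneg fun i _ => hw _),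
          ← ENNReal.ofReal_add hφ0 (mul_nonneg (Finset.sum_nonneg fun i _ => hw _)
            (by positivity))]
    _ ≤ _ := by
        apply ENNReal.ofReal_le_ofReal
        gcongr
        exact hws.sum_le_tsum _ fun i _ => hw i

/-- Freezing of the past: a bound on the expectation over the fresh samples, uniform in the
current point, can be inserted under an expectation. -/
theorem lintegral_mul_le_of_indepFun {Ω X Z : Type*} [MeasurableSpace Ω] [MeasurableSpace X]
    [MeasurableSpace Z] {P : Measure Ω} [IsProbabilityMeasure P] {x : Ω → X} {ζ : Ω → Z}
    (hx : Measurable x) (hζ : Measurable ζ) (hind : IndepFun x ζ P) {f : X → ENNReal}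
    {β : X × Z → ENNReal} (hf : Measurable f) (hβ : Measurable β) {κ : ENNReal}
    (hκ : ∀ y, ∫⁻ ω, β (y, ζ ω) ∂P ≤ κ) :
    ∫⁻ ω, f (x ω) * β (x ω, ζ ω) ∂P ≤ κ * ∫⁻ ω, f (x ω) ∂P := by
  have hprod := (indepFun_iff_map_prod_eq_prod_map_map hx.aemeasurable hζ.aemeasurable).1 hind
  have : IsProbabilityMeasure (P.map x) := Measure.isProbabilityMeasure_map hx.aemeasurable
  have : IsProbabilityMeasure (P.map ζ) := Measure.isProbabilityMeasure_map hζ.aemeasurable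
  have hm : Measurable fun z : X × Z => f z.1 * β z := (hf.comp measurable_fst).mul hβ
  calc ∫⁻ ω, f (x ω) * β (x ω, ζ ω) ∂P
      = ∫⁻ z, f z.1 * β z ∂(P.map fun ω => (x ω, ζ ω)) :=
        (lintegral_map hm (hx.prodMk hζ)).symm
    _ = ∫⁻ y, ∫⁻ z, f y * β (y, z) ∂(P.map ζ) ∂(P.map x) := by
        rw [hprod, lintegral_prod _ hm.aemeasurable]
    _ = ∫⁻ y, f y * ∫⁻ ω, β (y, ζ ω) ∂P ∂(P.map x) := by
        refine lintegral_congr fun y => ?_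
        have hy : Measurable fun z => β (y, z) := hβ.comp measurable_prodMk_left
        rw [lintegral_const_mul _ hy, lintegral_map hy hζ]
    _ ≤ ∫⁻ y, f y * κ ∂(P.map x) := by
        refine lintegral_mono fun y => ?_
        gcongr
        exact hκ y
    _ = κ * ∫⁻ ω, f (x ω) ∂P := by
        rw [lintegral_mul_const _ hf, lintegral_map hf hx, mul_comm]

theorem isSelfAdjoint_batchMean {n N : ℕ} {Y : Fin N → Op n} (hY : ∀ i, IsSelfAdjoint (Y i)) :
    IsSelfAdjoint (batchMean Y) := by
  unfold batchMean
  have h : IsSelfAdjoint (∑ i, Y i) :=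
    Finset.sum_induction Y IsSelfAdjoint (fun _ _ => IsSelfAdjoint.add (R := Op n)) (IsSelfAdjoint.zero (Op n)) fun i _ => hY i
  exact (IsSelfAdjoint.all _).smul h

/-- Expected suboptimality after `K` iterations of a run whose expected noise is at most `κ`. -/
theorem IsRun.lintegral_suboptimality_le {n : ℕ} {α Cgd L σg σh Δ : ℝ} (hα : 3 / 2 ≤ α)
    (hCgd : 0 < Cgd) (hL : 0 ≤ L) (hΔ : 0 ≤ Δ) {F : Vec n → ℝ} {x₀ : Vec n}
    (hgd : GradientDominated F α Cgd) (hb : CoerciveBddBelow F) (hF : LipschitzHessian F L)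
    (hx₀ : F x₀ - infVal F ≤ Δ)
    {Ξ : Type*} [MeasurableSpace Ξ] {D : Measure Ξ} {G : Vec n → Ξ → Vec n}
    {Q : Vec n → Ξ → Op n} (hO : UnbiasedOracle F α σg σh D G Q)
    {Ω : Type*} [mΩ : MeasurableSpace Ω] {P : Measure Ω} [IsProbabilityMeasure P]
    {ℱ : Filtration ℕ mΩ} {K ng nH : ℕ} {ξ : ℕ → Fin ng ⊕ Fin nH → Ω → Ξ} {x : ℕ → Ω → Vec n}
    {θ : ℝ} (hθ : 0 < θ)
    (hrun : IsRun P D G Q K ng nH ((L + 4) / 3) θ (θ / (L + 4)) x₀ ℱ ξ x)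
    {κ : ℝ} (hκ : 0 ≤ κ)
    (hnoise : ∀ k < K, ∀ y : Vec n,
      ∫⁻ ω, ENNReal.ofReal (noise F α θ (θ / (L + 4)) y
        (batchMean fun i => G y (ξ k (Sum.inl i) ω))
        (batchMean fun i => Q y (ξ k (Sum.inr i) ω))) ∂P ≤ ENNReal.ofReal κ)
    {c p B : ℝ} (hcdef : 2 * c = stepConst α Cgd L) (hpdef : p = 3 / (2 * α)) (hB0 : 0 ≤ B)
    {w : ℕ → ℝ} (hws : Summable w) (hw : ∀ j, 0 ≤ w j)
    (hwφ : ∀ j r, 0 ≤ r → (contraction c p)^[j] r ≤ w j * (r + r ^ (1 / p)))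
    (hB : ∀ a b y : ℝ, 0 ≤ a → 0 ≤ b → 0 ≤ y → y + 2 * c * y ^ p ≤ a + 6 * b ^ p →
      ∃ ν, 0 ≤ ν ∧ y ≤ max (contraction c p a) ν ∧
        ν + ν ^ (1 / p) ≤ B * (b * (1 + a ^ (1 / p)))) :
    ∫⁻ ω, ENNReal.ofReal (F (x K ω) - infVal F) ∂P ≤ ENNReal.ofReal ((contraction c p)^[K] Δ +
      (∑' j, w j) * (B * κ * ((1 + Δ ^ (1 / p)) * Real.exp (B * κ * K)))) := by
  have hα0 : 0 < α := by linarith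
  have hc : 0 < c := by have := stepConst_pos (α := α) hCgd hL; linarith
  have hp : 0 < p := by rw [hpdef]; positivity
  have hp1 : p ≤ 1 := by rw [hpdef, div_le_one (by positivity)]; linarith
  have hFm : Measurable F := hF.differentiable.continuous.measurable
  have hxm : ∀ k ≤ K, Measurable (x k) := fun k hk => (hrun.adapted k hk).mono (ℱ.le k) le_rfl
  have hξm : ∀ k < K, ∀ i, Measurable (ξ k i) := fun k hk i =>
    (hrun.sample_measurable k hk i).mono (ℱ.le _) le_rfl
  have hτ : 0 < θ / (L + 4) := by positivity
  let β : Vec n × (Fin ng ⊕ Fin nH → Ξ) → ℝ := fun z => noise F α θ (θ / (L + 4)) z.1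
    (batchMean fun i => G z.1 (z.2 (Sum.inl i))) (batchMean fun i => Q z.1 (z.2 (Sum.inr i)))
  have hβm : Measurable β := by
    have hg : Measurable fun z : Vec n × (Fin ng ⊕ Fin nH → Ξ) =>
        batchMean fun i => G z.1 (z.2 (Sum.inl i)) :=
      measurable_batchMean fun i => hO.measurable_grad.comp
        (measurable_fst.prodMk ((measurable_pi_apply (Sum.inl i)).comp measurable_snd))
    have hh : Measurable fun z : Vec n × (Fin ng ⊕ Fin nH → Ξ) =>
        batchMean fun i => Q z.1 (z.2 (Sum.inr i)) :=
      measurable_batchMean fun i => hO.measurable_hess.comp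
        (measurable_fst.prodMk ((measurable_pi_apply (Sum.inr i)).comp measurable_snd))
    have hg' : Measurable fun z : Vec n × (Fin ng ⊕ Fin nH → Ξ) => gradient F z.1 :=
      hF.differentiable_gradient.continuous.measurable.comp measurable_fst
    have hh' : Measurable fun z : Vec n × (Fin ng ⊕ Fin nH → Ξ) => hess F z.1 :=
      hF.continuous_hess.measurable.comp measurable_fst
    exact ((((hg.sub hg').norm).add_const _).pow_const _).add
      ((((hh.sub hh').norm).add_const _).pow_const _)
  have hβ0 : ∀ z, 0 ≤ β z := fun z => noise_nonneg hθ.le hτ.le _ _ _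
  refine expectation_bound (C := 6) (a := fun k ω => F (x k ω) - infVal F)
    (b := fun k ω => β (x k ω, fun i => ξ k i ω)) hc hp hp1 hB0 hκ hΔ hws hw hwφ hB
    (fun k ω => sub_nonneg.2 (hb.infVal_le _)) (fun k ω => hβ0 _)
    (fun k hk => (hFm.comp (hxm k hk)).sub_const _)
    (fun k hk => hβm.comp ((hxm k hk.le).prodMk (measurable_pi_lambda _ (hξm k hk))))
    (fun ω => by rw [hrun.init]; exact hx₀) (fun k hk => ?_) (fun k hk => ?_)
  · filter_upwards [hrun.step k hk] with ω ⟨d, hd, hxd⟩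
    rw [hxd, hcdef, hpdef]
    exact suboptimality_step (by linarith) hCgd hgd hb hF hL hθ
      (isSelfAdjoint_batchMean fun i => hO.symmetric_hess _ _) hd
  -- The weight depends on the current point only, and the noise on that point and the fresh
  -- samples, which are independent of the history.
  · refine lintegral_mul_le_of_indepFun (x := x k) (ζ := fun ω i => ξ k i ω)
      (f := fun y => ENNReal.ofReal (1 + (F y - infVal F) ^ (1 / p)))
      (β := fun z => ENNReal.ofReal (β z)) (hxm k hk.le) (measurable_pi_lambda _ (hξm k hk)) ?_
      (ENNReal.measurable_ofReal.comp (((hFm.sub_const _).pow_const _).const_add 1))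
      (ENNReal.measurable_ofReal.comp hβm) (hnoise k hk)
    rw [IndepFun_iff_Indep]
    exact (indep_of_indep_of_le_right (hrun.sample_fresh k hk)
      (hrun.adapted k hk.le).comap_le).symm

/-- The run reaches accuracy `ε` in a number of iterations of the order of the number of steps
that the noiseless contraction needs. -/
theorem exists_constants_of_iterations (n : ℕ) {α Cgd L σg σh Δ : ℝ} (hα : 3 / 2 ≤ α)
    (hα2 : α ≤ 2) (hCgd : 0 < Cgd) (hL : 0 ≤ L) (hΔ : 0 ≤ Δ) {ℓ : ℝ → ℝ} {A ε₁ : ℝ} (hA : 0 < A)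
    (hε₁ : ε₁ ≤ 1) (hℓ : ∀ ε ∈ Set.Ioo 0 ε₁, ℓ ε ≤ 1 / ε ∧ ∃ K : ℕ, (K : ℝ) ≤ A * ℓ ε ∧
      (contraction (stepConst α Cgd L / 2) (3 / (2 * α)))^[K] Δ ≤ ε / 2) :
    ∃ cg > (0 : ℝ), ∃ cH > (0 : ℝ), ∃ ceig > (0 : ℝ), ∀ ε ∈ Set.Ioo 0 ε₁,
    ∃ K : ℕ, (K : ℝ) ≤ A * ℓ ε ∧ ∀ ng nH : ℕ, cg * ε ^ (-2 / α) ≤ ng → cH * ε ^ (-1 / α) ≤ nH →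
      ∀ (F : Vec n → ℝ) (x₀ : Vec n),
        GradientDominated F α Cgd → CoerciveBddBelow F → LipschitzHessian F L →
        F x₀ - infVal F ≤ Δ →
      ∀ {Ξ : Type*} [MeasurableSpace Ξ] (D : Measure Ξ) (G : Vec n → Ξ → Vec n)
        (Q : Vec n → Ξ → Op n), UnbiasedOracle F α σg σh D G Q →
      ∀ {Ω : Type*} [mΩ : MeasurableSpace Ω] (P : Measure Ω) [IsProbabilityMeasure P]
        (ℱ : Filtration ℕ mΩ) (ξ : ℕ → Fin ng ⊕ Fin nH → Ω → Ξ) (x : ℕ → Ω → Vec n),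
        IsRun P D G Q K ng nH ((L + 4) / 3) (ceig * ε ^ (1 / α)) (ceig / (L + 4) * ε ^ (1 / α))
          x₀ ℱ ξ x →
        Integrable (fun ω => F (x K ω)) P ∧ ∫ ω, (F (x K ω) - infVal F) ∂P ≤ ε := by
  have hα0 : 0 < α := by linarith
  set c := stepConst α Cgd L / 2 with hc
  set p := 3 / (2 * α) with hp
  have hc0 : 0 < c := by have := stepConst_pos (α := α) hCgd hL; positivity
  have hp0 : 0 < p := by positivity
  have hp1 : p ≤ 1 := by rw [hp, div_le_one (by positivity)]; linarith
  have hp2 : 1 / 2 ≤ p := by rw [hp, div_le_div_iff₀ (by norm_num) (by positivity)]; linarith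
  obtain ⟨w, hws, hw, hwφ⟩ := exists_summable_weights hc0 hp2 hp1
  obtain ⟨B, hB0, hB⟩ := exists_jump_bound hc0 hp0 hp1 (by norm_num : (0 : ℝ) ≤ 6)
  set W := ∑' j, w j with hW
  have hW0 : 0 ≤ W := tsum_nonneg hw
  have hden : 0 < A * B + 6 * W * B * (1 + Δ ^ (1 / p)) := by positivity
  -- The two summands serve two purposes: `η * A * B ≤ 1` keeps the Gronwall factor below `e < 3`
  -- over `K ≤ A / ε` steps, and `6 * η * W * B * (1 + Δ ^ (1 / p)) ≤ 1` bounds the accumulated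
  -- noise by `ε / 2`.
  set η := (A * B + 6 * W * B * (1 + Δ ^ (1 / p)))⁻¹ with hη
  have hη0 : 0 < η := inv_pos.2 hden
  have hη1 : η * (A * B) + η * (6 * W * B * (1 + Δ ^ (1 / p))) = 1 := by
    rw [← mul_add]; exact inv_mul_cancel₀ hden.ne'
  obtain ⟨cg, hcg, cH, hcH, ceig, hceig, hnoise⟩ :=
    exists_noise_bound n (σg := σg) (σh := σh) (by linarith : 1 ≤ α) hα2 hL hη0
  refine ⟨cg, hcg, cH, hcH, ceig, hceig, ?_⟩
  rintro ε ⟨hε, hεε₁⟩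
  obtain ⟨hℓε, K, hK, hφ⟩ := hℓ ε ⟨hε, hεε₁⟩
  refine ⟨K, hK, ?_⟩
  intro ng nH hng hnH F x₀ hgd hb hF hx₀ Ξ _ D G Q hO Ω mΩ P _ ℱ ξ x hrun
  set θ := ceig * ε ^ (1 / α) with hθ
  have hθ0 : 0 < θ := by positivity
  rw [show ceig / (L + 4) * ε ^ (1 / α) = θ / (L + 4) by rw [hθ]; ring] at hrun
  have hξm : ∀ k < K, ∀ i, Measurable (ξ k i) := fun k hk i =>
    (hrun.sample_measurable k hk i).mono (ℱ.le _) le_rfl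
  have hmain := hrun.lintegral_suboptimality_le hα hCgd hL hΔ hgd hb hF hx₀ hO hθ0
    (κ := η * ε) (by positivity)
    (fun k hk y => hnoise ε ⟨hε, hεε₁.trans_le hε₁⟩ ng nH hng hnH F D G Q hO P (ξ k) (hξm k hk)
      (hrun.sample_law k hk) (hrun.sample_indep k hk) y)
    (by rw [hc]; ring) hp hB0.le hws hw hwφ hB
  have hexp : Real.exp (B * (η * ε) * K) ≤ 3 := by
    have h1 : B * (η * ε) * K ≤ 1 := by
      have h2 : (K : ℝ) * ε ≤ A := by
        calc (K : ℝ) * ε ≤ A * (1 / ε) * ε := by gcongr; exact hK.trans (by gcongr)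
          _ = A := by field_simp
      have h3 : 0 ≤ η * (6 * W * B * (1 + Δ ^ (1 / p))) := by positivity
      calc B * (η * ε) * K = η * B * (K * ε) := by ring
        _ ≤ η * B * A := by gcongr
        _ ≤ 1 := by linarith
    have := Real.exp_le_exp.2 h1
    linarith [Real.exp_one_lt_d9]
  have hfin : (contraction c p)^[K] Δ +
      W * (B * (η * ε) * ((1 + Δ ^ (1 / p)) * Real.exp (B * (η * ε) * K))) ≤ ε := by
    have h1 : W * (B * (η * ε) * ((1 + Δ ^ (1 / p)) * Real.exp (B * (η * ε) * K))) ≤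
        W * (B * (η * ε) * ((1 + Δ ^ (1 / p)) * 3)) := by gcongr
    have h2 : 0 ≤ η * (A * B) := by positivity
    have h3 : η * (6 * W * B * (1 + Δ ^ (1 / p))) * ε ≤ 1 * ε := by gcongr; linarith
    linarith
  have hle : ∫⁻ ω, ENNReal.ofReal (F (x K ω) - infVal F) ∂P ≤ ENNReal.ofReal ε :=
    hmain.trans (ENNReal.ofReal_le_ofReal hfin)
  have hxm : Measurable (x K) := (hrun.adapted K le_rfl).mono (ℱ.le K) le_rfl
  have hm : Measurable fun ω => F (x K ω) - infVal F :=
    (hF.differentiable.continuous.measurable.comp hxm).sub_const _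
  have hnn : ∀ ω, 0 ≤ F (x K ω) - infVal F := fun ω => sub_nonneg.2 (hb.infVal_le _)
  have hint : Integrable (fun ω => F (x K ω) - infVal F) P := by
    refine ⟨hm.aestronglyMeasurable, ?_⟩
    rw [hasFiniteIntegral_iff_ofReal (Filter.Eventually.of_forall hnn)]
    exact hle.trans_lt ENNReal.ofReal_lt_top
  refine ⟨(hint.add (integrable_const (infVal F))).congr (ae_of_all _ fun ω => by simp), ?_⟩
  rw [integral_eq_lintegral_of_nonneg_ae (Filter.Eventually.of_forall hnn)
    hm.aestronglyMeasurable]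
  exact ENNReal.toReal_le_of_le_ofReal hε.le hle

theorem ceil_le_add_one_mul {a X Y : ℝ} (ha : 0 < a) (hXY : X ≤ Y) (hX : 0 ≤ X) (hY : 1 ≤ Y) :
    (⌈a * X⌉₊ : ℝ) ≤ (a + 1) * Y := by
  have h := (Nat.ceil_lt_add_one (mul_nonneg ha.le hX)).le
  have := mul_le_mul_of_nonneg_left hXY ha.le
  linarith

theorem add_ceil_le {cg cH ε α : ℝ} (hcg : 0 < cg) (hcH : 0 < cH) (hε : 0 < ε) (hε1 : ε < 1)
    (hα : 0 < α) :
    ((⌈cg * ε ^ (-2 / α)⌉₊ : ℕ) : ℝ) + ((⌈cH * ε ^ (-1 / α)⌉₊ : ℕ) : ℝ) ≤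
      (cg + cH + 2) * ε ^ (-2 / α) := by
  have h1 : 1 ≤ ε ^ (-2 / α) :=
    Real.one_le_rpow_of_pos_of_le_one_of_nonpos hε hε1.le
      (div_nonpos_of_nonpos_of_nonneg (by norm_num) hα.le)
  have h2 : ε ^ (-1 / α) ≤ ε ^ (-2 / α) :=
    Real.rpow_le_rpow_of_exponent_ge hε hε1.le (by gcongr; norm_num)
  have e1 := ceil_le_add_one_mul hcg (le_refl (ε ^ (-2 / α))) (by positivity) h1
  have e2 := ceil_le_add_one_mul hcH h2 (by positivity) h1
  linarith

end Run

end SHSODM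

/-! ### Assembly of the regimes `α < 3/2`, `α = 3/2` and `α > 3/2`. -/

theorem mainTheorem1 (n : ℕ) (α Cgd LH σg σh Δ₀ : ℝ) (hα : α ∈ Set.Icc (1 : ℝ) 2)
    (hCgd : 0 < Cgd) (hLH : 0 ≤ LH) (hσg : 0 ≤ σg) (hσh : 0 ≤ σh) (hΔ₀ : 0 ≤ Δ₀) :
    ∃ cg > (0 : ℝ), ∃ cH > (0 : ℝ), ∃ ceig > (0 : ℝ), ∃ cls > (0 : ℝ),
    ∃ C > (0 : ℝ), ∃ ε₀ ∈ Set.Ioo (0 : ℝ) 1, ∀ ε ∈ Set.Ioo 0 ε₀,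
    ∃ ng nH K : ℕ,
      ng = ⌈cg * ε ^ (-2 / α)⌉₊ ∧ nH = ⌈cH * ε ^ (-1 / α)⌉₊ ∧
      (α < 3 / 2 →
        (K : ℝ) ≤ C * ε ^ (1 - 3 / (2 * α)) ∧
        (K : ℝ) * (ng + nH) ≤ C * ε ^ (-7 / (2 * α) + 1)) ∧
      (α = 3 / 2 →
        (K : ℝ) ≤ C * Real.log (1 / ε) ∧
        (K : ℝ) * (ng + nH) ≤ C * (Real.log (1 / ε) * ε ^ (-2 / α))) ∧
      (3 / 2 < α →
        (K : ℝ) ≤ C * Real.log (Real.log (1 / ε)) ∧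
        (K : ℝ) * (ng + nH) ≤ C * (Real.log (Real.log (1 / ε)) * ε ^ (-2 / α))) ∧
      ∀ (F : SHSODM.Vec n → ℝ) (x₀ : SHSODM.Vec n),
        SHSODM.GradientDominated F α Cgd → SHSODM.CoerciveBddBelow F →
        SHSODM.LipschitzHessian F LH → F x₀ - SHSODM.infVal F ≤ Δ₀ →
      ∀ (Ξ : Type*) [MeasurableSpace Ξ] (D : Measure Ξ) [IsProbabilityMeasure D]
        (G : SHSODM.Vec n → Ξ → SHSODM.Vec n) (Q : SHSODM.Vec n → Ξ → SHSODM.Op n),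
        SHSODM.UnbiasedOracle F α σg σh D G Q →
      ∀ (Ω : Type*) [mΩ : MeasurableSpace Ω] (P : Measure Ω) [IsProbabilityMeasure P]
        (ℱ : Filtration ℕ mΩ) (ξ : ℕ → Fin ng ⊕ Fin nH → Ω → Ξ) (x : ℕ → Ω → SHSODM.Vec n),
        SHSODM.IsRun P D G Q K ng nH ((LH + 4) / 3) (ceig * ε ^ (1 / α)) (cls * ε ^ (1 / α))
          x₀ ℱ ξ x →
        Integrable (fun ω => F (x K ω)) P ∧
        ∫ ω, (F (x K ω) - SHSODM.infVal F) ∂P ≤ ε := by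
  obtain ⟨hα1, hα2⟩ := hα
  have hα0 : 0 < α := by linarith
  rcases lt_or_ge α (3 / 2) with hlt | hge
  · -- here gradient dominance and the Lipschitz Hessian leave only the zero-dimensional space
    refine ⟨1, one_pos, 1, one_pos, 1, one_pos, 1 / (LH + 4), by positivity, 8, by norm_num,
      1 / 2, by norm_num, ?_⟩
    rintro ε ⟨hε, hε2⟩
    have hε1 : ε < 1 := by linarith
    have hE : 1 ≤ ε ^ (1 - 3 / (2 * α)) := by
      apply Real.one_le_rpow_of_pos_of_le_one_of_nonpos hε hε1.le
      rw [sub_nonpos, le_div_iff₀ (by positivity)]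
      linarith
    have hK := SHSODM.ceil_le_add_one_mul one_pos (le_refl (ε ^ (1 - 3 / (2 * α))))
      (by positivity) hE
    rw [one_mul] at hK
    have hN := SHSODM.add_ceil_le one_pos one_pos hε hε1 hα0
    refine ⟨_, _, ⌈ε ^ (1 - 3 / (2 * α))⌉₊, rfl, rfl, fun _ => ⟨by linarith, ?_⟩,
      fun h => absurd h hlt.ne, fun h => absurd h (not_lt.2 hlt.le), ?_⟩
    -- The sample exponent is the sum of the exponents of `K` and of the batch size; the constant
    -- `8` is `2 * 4`, from rounding `K` and the two batches.
    · have e : ε ^ (-7 / (2 * α) + 1) = ε ^ (1 - 3 / (2 * α)) * ε ^ (-2 / α) := by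
        rw [← Real.rpow_add hε]
        congr 1
        field_simp
        ring
      have e0 : 0 < ε ^ (-2 / α) := by positivity
      calc _ ≤ ((1 + 1) * ε ^ (1 - 3 / (2 * α))) * ((1 + 1 + 2) * ε ^ (-2 / α)) := by gcongr
        _ = 8 * ε ^ (-7 / (2 * α) + 1) := by rw [e]; ring
    · intro F x₀ hgd hb hF _ Ξ _ D _ G Q _ Ω _ P _ ℱ ξ x _
      have hn := hgd.dim_eq_zero hCgd hα1 hlt hb hF hLH
      subst hn
      have hx : ∀ y, F y = F x₀ := fun y => congrArg F (Subsingleton.elim y x₀)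
      have hinf : SHSODM.infVal F = F x₀ := by
        unfold SHSODM.infVal
        simp_rw [hx]
        exact ciInf_const
      simp only [hx, hinf, sub_self, integral_zero]
      exact ⟨integrable_const _, hε.le⟩
  · have hc : 0 < SHSODM.stepConst α Cgd LH / 2 := half_pos (SHSODM.stepConst_pos hCgd hLH)
    -- the number of iterations is of the order of `ℓ ε`
    have hlog : ∀ ε : ℝ, 0 < ε → Real.log (1 / ε) ≤ 1 / ε := fun ε hε =>
      Real.log_le_self (by positivity)
    obtain ⟨ℓ, A, ε₁, hA, hε₁, hℓ, h1, h2⟩ : ∃ (ℓ : ℝ → ℝ) (A ε₁ : ℝ), 0 < A ∧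
        ε₁ ∈ Set.Ioo (0 : ℝ) 1 ∧
        (∀ ε ∈ Set.Ioo 0 ε₁, 0 ≤ ℓ ε ∧ ℓ ε ≤ 1 / ε ∧ ∃ K : ℕ, (K : ℝ) ≤ A * ℓ ε ∧
          (SHSODM.contraction (SHSODM.stepConst α Cgd LH / 2) (3 / (2 * α)))^[K] Δ₀ ≤ ε / 2) ∧
        (α = 3 / 2 → ∀ ε, ℓ ε = Real.log (1 / ε)) ∧
        (3 / 2 < α → ∀ ε, ℓ ε = Real.log (Real.log (1 / ε))) := by
      rcases hge.eq_or_lt with heq | hgt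
      · have hp : 3 / (2 * α) = 1 := by rw [← heq]; norm_num
        obtain ⟨A, hA, ε₁, hε₁, hit⟩ := SHSODM.exists_iterations_of_eq_one hc hΔ₀
        refine ⟨fun ε => Real.log (1 / ε), A, ε₁, hA, hε₁, fun ε hε => ⟨?_, hlog ε hε.1, ?_⟩,
          fun _ _ => rfl, fun h => absurd heq h.ne⟩
        · refine Real.log_nonneg ?_
          rw [le_div_iff₀ hε.1]
          linarith [hε.2, hε₁.2]
        · rw [hp]; exact hit ε hε
      · have hp : 3 / (2 * α) < 1 := by rw [div_lt_one (by positivity)]; linarith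
        obtain ⟨A, hA, ε₁, hε₁, hit⟩ :=
          SHSODM.exists_iterations_of_lt_one hc (by positivity : 0 < 3 / (2 * α)) hp hΔ₀
        refine ⟨fun ε => Real.log (Real.log (1 / ε)), A, ε₁, hA, hε₁,
          fun ε hε => ⟨by linarith [(hit ε hε).1], ?_, (hit ε hε).2⟩,
          fun h => absurd h hgt.ne', fun _ _ => rfl⟩
        refine (Real.log_le_self (Real.log_nonneg ?_)).trans (hlog ε hε.1)
        rw [le_div_iff₀ hε.1]
        linarith [hε.2, hε₁.2]
    obtain ⟨cg, hcg, cH, hcH, ceig, hceig, hmain⟩ :=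
      SHSODM.exists_constants_of_iterations n (σg := σg) (σh := σh) hge hα2 hCgd hLH hΔ₀ hA
        hε₁.2.le fun ε hε => (hℓ ε hε).2
    -- The line-search tolerance is tied to the perturbation as `newton_step` requires; the factor
    -- `cg + cH + 2` bounds the rounded batch sizes in units of `ε ^ (-2 / α)`.
    refine ⟨cg, hcg, cH, hcH, ceig, hceig, ceig / (LH + 4), by positivity,
      A * (cg + cH + 2), by positivity, ε₁, hε₁, ?_⟩
    intro ε hε
    obtain ⟨K, hK, hrun⟩ := hmain ε hε
    have hℓ0 := (hℓ ε hε).1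
    have hN := SHSODM.add_ceil_le hcg hcH hε.1 (hε.2.trans hε₁.2) hα0
    have e0 : 0 < ε ^ (-2 / α) := Real.rpow_pos_of_pos hε.1 _
    have hK1 : (K : ℝ) ≤ A * (cg + cH + 2) * ℓ ε := by
      refine hK.trans ?_
      gcongr
      exact le_mul_of_one_le_right hA.le (by linarith)
    have hK2 : (K : ℝ) * ((⌈cg * ε ^ (-2 / α)⌉₊ : ℕ) + (⌈cH * ε ^ (-1 / α)⌉₊ : ℕ)) ≤
        A * (cg + cH + 2) * (ℓ ε * ε ^ (-2 / α)) := by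
      calc _ ≤ A * ℓ ε * ((cg + cH + 2) * ε ^ (-2 / α)) := by gcongr
        _ = _ := by ring
    refine ⟨_, _, K, rfl, rfl, fun h => absurd h (not_lt.2 hge), fun h => ?_, fun h => ?_, ?_⟩
    · rw [← h1 h ε]; exact ⟨hK1, hK2⟩
    · rw [← h2 h ε]; exact ⟨hK1, hK2⟩
    · intro F x₀ hgd hb hF hx₀ Ξ _ D _ G Q hO Ω _ P _ ℱ ξ x hx
      exact hrun _ _ (Nat.le_ceil _) (Nat.le_ceil _) F x₀ hgd hb hF hx₀ D G Q hO P ℱ ξ x hx
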